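/- Conventions. Let $K$ be a field of characteristic zero, $\otimes=\otimes_K$, $D^o$ the opposite algebra of $D$; Noetherian means left and right Noetherian. Let $X$ be a smooth irreducible affine variety over $K$, i.e. its coordinate algebra $\mathcal O(X)$ is a smooth $K$-algebra (of finite type) which is a domain. Let $\mathcal D(X)\subseteq \mathrm{End}_K(\mathcal O(X))$ be the ring of ($K$-linear, Grothendieck) differential operators on $\mathcal O(X)$. A quotient division algebra $\mathrm{Frac}(B)$ of an algebra $B$ is a division algebra containing $B$ all of whose elements have the form $a^{-1}b$, and also the form $b'a'^{-1}$, with $a,b,a',b'\in B$, $a,a'\ne 0$. A division $K$-algebra $E$ is finitely generated if, for some finite subset of $E$, the only division $K$-subalgebra of $E$ containing it is $E$. **Corollary 3.2.** The quotient division algebra $D=D(X)=\mathrm{Frac}(\mathcal D(X))$ exists, the algebra $D\otimes D^o$ is Noetherian, and if $X$ is geometrically irreducible (i.e. $\overline K\otimes\mathcal O(X)$ is a domain, which is automatic if $K$ is algebraically closed) then $D\otimes D^o$ is a domain. Moreover: 1. $D$ satisfies the ascending chain condition on division $K$-subalgebras, and every division $K$-subalgebra of $D$ is a finitely generated division $K$-algebra.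 Let further $\Delta=(\delta_1,\dots,\delta_t)$ be either a family of commuting $K$-derivations of $D$, in which case put $W=K^t$ (additive group), or a family of commuting $K$-automorphisms of $D$, in which case put $W=(K^*)^t$ (multiplicative group, written additively below). For $\lambda\in W$ let $D_\lambda=\{u\in D : \delta_i(u)=\lambda_i u,\ i=1,\dots,t\}$, and let $\mathrm{Ev}(\Delta)=\{\lambda\in W : D_\lambda\neq 0\}$, a subgroup of $W$. Then: 2. $\mathrm{Ev}(\Delta)$ is a finitely generated abelian group, and so $\mathrm{Ev}(\Delta)\cong\mathcal T\oplus\mathbb Z^r$, where $r=\dim_{\mathbb Q}(\mathbb Q\otimes_{\mathbb Z}\mathrm{Ev}(\Delta))$ is its rank and $\mathcal T$, its torsion subgroup, is finite. 3. The sum $D(\Delta)=\bigoplus_{\lambda\in\mathrm{Ev}(\Delta)}D_\lambda$ of subspaces of $D$ is direct, and $D(\Delta)$ is a Noetherian domain. $D_0$ is a division algebra, $D_{\mathcal T}=\bigoplus_{\lambda\in\mathcal T}D_\lambda$ is a division algebra of left and right dimension $|\mathcal T|$ over $D_0$, and $D(\Delta)$ is isomorphic, over $D_{\mathcal T}$,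 to an iterated skew Laurent extension $D_{\mathcal T}[x_1,x_1^{-1};\sigma_1]\cdots[x_r,x_r^{-1};\sigma_r]$. (Here $A[x,x^{-1};\sigma]$, for a $K$-automorphism $\sigma$ of $A$, is the free left $A$-module with basis $x^n$, $n\in\mathbb Z$, and multiplication given by $xa=\sigma(a)x$ for $a\in A$.) 4. For each subgroup $F$ of $\mathrm{Ev}(\Delta)$, the algebra $\mathcal F(F)=\bigoplus_{\lambda\in F}D_\lambda$ is a Noetherian domain; its quotient division algebra $Q=\mathrm{Frac}(\mathcal F(F))\subseteq D$ exists and is $\Delta$-invariant ($\delta_i(Q)\subseteq Q$ for all $i$); $\{\lambda\in W : Q\cap D_\lambda\neq 0\}=F$; and every nonzero $v\in Q\cap D_\lambda$, $\lambda\in W$, satisfies $\lambda\in F$ and has the form $v=u^{-1}w$ with $\mu\in F$, $0\neq u\in D_\mu$, $w\in D_{\lambda+\mu}$. -/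

import Mathlib

open scoped TensorProduct

universe u v w

/-! ### Rings of differential operators -/

section DiffOps

variable (K : Type v) [Field K] {A : Type u} [CommRing A] [Algebra K A]

/-- `IsDiffOp K n θ`: the `K`-linear endomorphism `θ` of the commutative `K`-algebra `A` is a
differential operator of order at most `n`: order `≤ 0` means that `θ` commutes with all
multiplication operators, and order `≤ n + 1` means that all commutators `[θ, a]`, `a ∈ A`, have
order `≤ n`. -/
def IsDiffOp : ℕ → Module.End K A → Prop
  | 0, θ => ∀ a : A, θ * LinearMap.mulLeft K a - LinearMap.mulLeft K a * θ = 0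
  | n + 1, θ => ∀ a : A, IsDiffOp n (θ * LinearMap.mulLeft K a - LinearMap.mulLeft K a * θ)

variable {K}

theorem IsDiffOp.zero (n : ℕ) : IsDiffOp K n (0 : Module.End K A) := by
  induction n with
  | zero => intro a; simp
  | succ n ih => intro a; simpa using ih

theorem IsDiffOp.add {n : ℕ} {θ η : Module.End K A} (h₁ : IsDiffOp K n θ) (h₂ : IsDiffOp K n η) :
    IsDiffOp K n (θ + η) := by
  induction n generalizing θ η with
  | zero =>
    intro a
    have e₁ := h₁ a
    have e₂ := h₂ a
    rw [add_mul, mul_add, add_sub_add_comm, e₁, e₂, add_zero]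
  | succ n ih =>
    intro a
    rw [add_mul, mul_add, add_sub_add_comm]
    exact ih (h₁ a) (h₂ a)

theorem IsDiffOp.succ {n : ℕ} {θ : Module.End K A} (h : IsDiffOp K n θ) :
    IsDiffOp K (n + 1) θ := by
  induction n generalizing θ with
  | zero =>
    intro a
    rw [show θ * LinearMap.mulLeft K a - LinearMap.mulLeft K a * θ = 0 from h a]
    exact IsDiffOp.zero 0
  | succ n ih => exact fun a => ih (h a)

theorem IsDiffOp.mono {m n : ℕ} (hmn : m ≤ n) {θ : Module.End K A} (h : IsDiffOp K m θ) :
    IsDiffOp K n θ := by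
  induction hmn with
  | refl => exact h
  | step _ ih => exact ih.succ

theorem commutator_mul {R : Type w} [Ring R] (x y a : R) :
    x * y * a - a * (x * y) = x * (y * a - a * y) + (x * a - a * x) * y := by
  simp only [mul_sub, sub_mul, mul_assoc]
  abel

theorem IsDiffOp.mul {N m n : ℕ} (hN : m + n ≤ N) {θ η : Module.End K A} (h₁ : IsDiffOp K m θ)
    (h₂ : IsDiffOp K n η) : IsDiffOp K N (θ * η) := by
  induction N generalizing m n θ η with
  | zero =>
    obtain ⟨rfl, rfl⟩ : m = 0 ∧ n = 0 := by omega
    intro a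
    rw [commutator_mul, show _ = _ from h₁ a, show _ = _ from h₂ a]; simp
  | succ N ih =>
    intro a
    rw [commutator_mul]
    refine IsDiffOp.add ?_ ?_
    · cases n with
      | zero =>
        rw [show _ = _ from h₂ a, mul_zero]
        exact IsDiffOp.zero N
      | succ n => exact ih (by omega) h₁ (h₂ a)
    · cases m with
      | zero =>
        rw [show _ = _ from h₁ a, zero_mul]
        exact IsDiffOp.zero N
      | succ m => exact ih (by omega) (h₁ a) h₂

variable (K A) in
/-- The `K`-algebra `𝒟(A) ⊆ End_K(A)` of `K`-linear differential operators on `A`. -/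
def DiffOps : Subalgebra K (Module.End K A) where
  carrier := {θ | ∃ n : ℕ, IsDiffOp K n θ}
  mul_mem' := by
    rintro θ η ⟨m, hm⟩ ⟨n, hn⟩
    exact ⟨m + n, hm.mul le_rfl hn⟩
  add_mem' := by
    rintro θ η ⟨m, hm⟩ ⟨n, hn⟩
    exact ⟨max m n, (hm.mono (le_max_left m n)).add (hn.mono (le_max_right m n))⟩
  algebraMap_mem' := by
    intro c
    refine ⟨0, fun a => ?_⟩
    rw [Algebra.commutes, sub_self]

end DiffOps

/-! ### Division subalgebras and quotient division algebras -/

section Division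

variable {K : Type v} [Field K] {D : Type w} [DivisionRing D] [Algebra K D]

/-- A `K`-subalgebra of the division algebra `D` is a division subalgebra. -/
def IsDivisionSubalgebra (E : Subalgebra K D) : Prop :=
  ∀ x ∈ E, x⁻¹ ∈ E

/-- `E` is a finitely generated division algebra: it is the least division `K`-subalgebra
containing some finite set. -/
def IsFinGenDivisionSubalgebra (E : Subalgebra K D) : Prop :=
  ∃ s : Finset D, IsLeast {E' : Subalgebra K D | IsDivisionSubalgebra E' ∧ (s : Set D) ⊆ E'} E

/-- Inside the division algebra `D`, the division subalgebra `Q` is the (two-sided) quotient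
division algebra of the subalgebra `B`: every element of `Q` is a left fraction `a⁻¹ b` and a
right fraction `b a⁻¹` of elements of `B`. -/
structure IsQuotientDivisionSubalgebra (B Q : Subalgebra K D) : Prop where
  isDivision : IsDivisionSubalgebra Q
  le : B ≤ Q
  left_fraction : ∀ q ∈ Q, ∃ a ∈ B, ∃ b ∈ B, a ≠ 0 ∧ q = a⁻¹ * b
  right_fraction : ∀ q ∈ Q, ∃ a ∈ B, ∃ b ∈ B, a ≠ 0 ∧ q = b * a⁻¹

/-- The division algebra `D`, with the `K`-algebra map `j : R → D`, is the quotient division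
algebra `Frac R` of `R`. -/
structure IsQuotientDivisionAlgebra {R : Type u} [Semiring R] [Algebra K R] (j : R →ₐ[K] D) :
    Prop where
  injective : Function.Injective j
  fractions : IsQuotientDivisionSubalgebra j.range ⊤

/-- `B` has left dimension `n` over its division subalgebra `C`. -/
def HasLeftDimension (C B : Subalgebra K D) (n : ℕ) : Prop :=
  C ≤ B ∧ ∃ b : Fin n → B, ∀ x : B, ∃! c : Fin n → C, (x : D) = ∑ i, (c i : D) * (b i : D)

/-- `B` has right dimension `n` over its division subalgebra `C`. -/
def HasRightDimension (C B : Subalgebra K D) (n : ℕ) : Prop :=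
  C ≤ B ∧ ∃ b : Fin n → B, ∀ x : B, ∃! c : Fin n → C, (x : D) = ∑ i, (b i : D) * (c i : D)

end Division

/-- A ring is Noetherian if it is left and right Noetherian. -/
def IsTwoSidedNoetherian (R : Type u) [Ring R] : Prop :=
  IsNoetherianRing R ∧ IsNoetherianRing Rᵐᵒᵖ

/-! ### Iterated skew Laurent extensions -/

section SkewLaurent

variable {K : Type v} [Field K]

/-- `B = A[x, x⁻¹; σ]` via `ι : A → B`: the element `x` is a unit of `B`, `x a = σ(a) x` for
`a ∈ A`, and `B` is a free left `A`-module with basis `xⁿ`, `n ∈ ℤ`. -/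
def IsSkewLaurentExtension {A B : Type w} [Ring A] [Algebra K A] [Ring B] [Algebra K B]
    (ι : A →ₐ[K] B) (σ : A ≃ₐ[K] A) (x : Bˣ) : Prop :=
  (∀ a : A, (x : B) * ι a = ι (σ a) * (x : B)) ∧
    Function.Bijective fun f : ℤ →₀ A => f.sum fun n a => ι a * ((x ^ n : Bˣ) : B)

/-- `B` is, via `ι : Γ → B`, an iterated skew Laurent extension
`Γ[x₁, x₁⁻¹; σ₁] ⋯ [xₙ, xₙ⁻¹; σₙ]` (up to isomorphism), where `σᵢ` is a `K`-automorphism of the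
`(i - 1)`-st extension. -/
def IsIteratedSkewLaurentExtension {Γ : Type w} [Ring Γ] [Algebra K Γ] :
    ℕ → ∀ {B : Type w} [Ring B] [Algebra K B], (Γ →ₐ[K] B) → Prop
  | 0, _, _, _, ι => Function.Bijective ι
  | n + 1, B, _, _, ι =>
    ∃ (A : Type w) (_ : Ring A) (_ : Algebra K A) (κ : Γ →ₐ[K] A) (ι' : A →ₐ[K] B)
      (σ : A ≃ₐ[K] A) (x : Bˣ),
      IsIteratedSkewLaurentExtension n κ ∧ IsSkewLaurentExtension ι' σ x ∧ ι = ι'.comp κ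

end SkewLaurent

/-! ### Common eigenvectors -/

section Weights

variable {K : Type v} [Field K] {D : Type w} [DivisionRing D] [Algebra K D]

/-- The space of all `u` with `δᵢ(u) = cᵢ u` for all `i`. -/
def commonEigenspace {t : ℕ} (δ : Fin t → D →ₗ[K] D) (c : Fin t → K) : Submodule K D :=
  ⨅ i, LinearMap.ker (δ i - c i • LinearMap.id)

theorem mem_commonEigenspace {t : ℕ} {δ : Fin t → D →ₗ[K] D} {c : Fin t → K} {u : D} :
    u ∈ commonEigenspace δ c ↔ ∀ i, δ i u = c i • u := by
  simp [commonEigenspace, sub_eq_zero]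

/-- Common terminology for the two cases (derivations, automorphisms): operators `δ₁, …, δ_t` on
`D` with eigenvalues in the additively written group `W`, where `w ∈ W` stands for the tuple
`val w ∈ Kᵗ`. The only two instances used are `derivationWeights` and `automorphismWeights`. -/
structure WeightSystem (K : Type v) [Field K] (D : Type w) [DivisionRing D] [Algebra K D]
    (t : ℕ) (W : Type v) [AddCommGroup W] where
  op : Fin t → D →ₗ[K] D
  val : W → Fin t → K
  one_mem : 1 ∈ commonEigenspace op (val 0)
  mul_mem : ∀ {a b : W} {x y : D}, x ∈ commonEigenspace op (val a) →
    y ∈ commonEigenspace op (val b) → x * y ∈ commonEigenspace op (val (a + b))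
  inv_mem : ∀ {a : W} {x : D}, x ∈ commonEigenspace op (val a) →
    x⁻¹ ∈ commonEigenspace op (val (-a))

/-- A family `δ₁, …, δ_t` of commuting `K`-derivations of `D`. -/
structure CommutingDerivations (K : Type v) [Field K] (D : Type w) [DivisionRing D] [Algebra K D]
    (t : ℕ) where
  toFun : Fin t → D →ₗ[K] D
  leibniz : ∀ i x y, toFun i (x * y) = toFun i x * y + x * toFun i y
  comm : ∀ i j x, toFun i (toFun j x) = toFun j (toFun i x)

/-- A family `δ₁, …, δ_t` of commuting `K`-automorphisms of `D`. -/
structure CommutingAutomorphisms (K : Type v) [Field K] (D : Type w) [DivisionRing D]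
    [Algebra K D] (t : ℕ) where
  toFun : Fin t → D ≃ₐ[K] D
  comm : ∀ i j x, toFun i (toFun j x) = toFun j (toFun i x)

/-- For commuting derivations, the eigenvalues are taken in the additive group `Kᵗ`. -/
def derivationWeights {t : ℕ} (δ : CommutingDerivations K D t) :
    WeightSystem K D t (Fin t → K) where
  op := δ.toFun
  val c := c
  one_mem := by
    rw [mem_commonEigenspace]
    intro i
    have h := δ.leibniz i 1 1
    simpa using h
  mul_mem := by
    intro a b x y hx hy
    rw [mem_commonEigenspace] at *
    intro i
    rw [δ.leibniz, hx, hy, Pi.add_apply, add_smul, smul_mul_assoc, mul_smul_comm]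
  inv_mem := by
    intro a x hx
    rw [mem_commonEigenspace] at *
    intro i
    rcases eq_or_ne x 0 with rfl | h0
    · simp
    have h1 : δ.toFun i 1 = 0 := by
      have h := δ.leibniz i 1 1
      simpa using h
    have h := δ.leibniz i x x⁻¹
    rw [mul_inv_cancel₀ h0, h1, hx, smul_mul_assoc, mul_inv_cancel₀ h0] at h
    have h2 : x * δ.toFun i x⁻¹ = -(a i • (1 : D)) := (neg_eq_of_add_eq_zero_right h.symm).symm
    calc δ.toFun i x⁻¹ = x⁻¹ * (x * δ.toFun i x⁻¹) := by rw [inv_mul_cancel_left₀ h0]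
      _ = (-a) i • x⁻¹ := by rw [h2, mul_neg, mul_smul_comm, mul_one, Pi.neg_apply, neg_smul]

/-- For commuting automorphisms, the eigenvalues are taken in the group `(K^*)ᵗ`, written
additively. -/
def automorphismWeights {t : ℕ} (δ : CommutingAutomorphisms K D t) :
    WeightSystem K D t (Additive (Fin t → Kˣ)) where
  op i := (δ.toFun i).toLinearMap
  val c i := ((Additive.toMul c i : Kˣ) : K)
  one_mem := by
    rw [mem_commonEigenspace]
    intro i
    simp
  mul_mem := by
    intro a b x y hx hy
    rw [mem_commonEigenspace] at *
    intro i
    have h1 := hx i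
    have h2 := hy i
    simp only [AlgEquiv.toLinearMap_apply] at h1 h2 ⊢
    rw [map_mul, h1, h2, smul_mul_smul_comm]
    simp
  inv_mem := by
    intro a x hx
    rw [mem_commonEigenspace] at *
    intro i
    have h1 := hx i
    simp only [AlgEquiv.toLinearMap_apply] at h1 ⊢
    rcases eq_or_ne x 0 with rfl | h0
    · simp
    have hc : ((Additive.toMul a i : Kˣ) : K) ≠ 0 := Units.ne_zero _
    rw [map_inv₀, h1]
    simp only [toMul_neg, Pi.inv_apply, Units.val_inv_eq_inv_val]
    refine inv_eq_of_mul_eq_one_right ?_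
    rw [smul_mul_smul_comm, mul_inv_cancel₀ hc, mul_inv_cancel₀ h0, one_smul]

namespace WeightSystem

variable {t : ℕ} {W : Type v} [AddCommGroup W] (S : WeightSystem K D t W)

/-- The eigenspace `D_a = {u ∈ D ∣ δᵢ(u) = aᵢ u for all i}`. -/
def space (a : W) : Submodule K D :=
  commonEigenspace S.op (S.val a)

/-- The group `Ev(Δ)` of common eigenvalues. -/
def Ev : AddSubgroup W where
  carrier := {a | ∃ u ∈ S.space a, u ≠ 0}
  zero_mem' := ⟨1, S.one_mem, one_ne_zero⟩
  add_mem' := by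
    rintro a b ⟨x, hx, hx0⟩ ⟨y, hy, hy0⟩
    exact ⟨x * y, S.mul_mem hx hy, mul_ne_zero hx0 hy0⟩
  neg_mem' := by
    rintro a ⟨x, hx, hx0⟩
    exact ⟨x⁻¹, S.inv_mem hx, inv_ne_zero hx0⟩

/-- For a group `F` of eigenvalues, the subalgebra `∑_{a ∈ F} D_a` of `D`. -/
def algebraOf (F : AddSubgroup W) : Subalgebra K D :=
  (⨆ a : F, S.space (a : W)).toSubalgebra
    (Submodule.mem_iSup_of_mem (0 : F) S.one_mem)
    (by
      intro x y hx hy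
      induction hx using Submodule.iSup_induction' with
      | mem a x hx =>
        induction hy using Submodule.iSup_induction' with
        | mem b y hy => exact Submodule.mem_iSup_of_mem (a + b) (S.mul_mem hx hy)
        | zero => rw [mul_zero]; exact Submodule.zero_mem _
        | add y z _ _ h₁ h₂ => rw [mul_add]; exact Submodule.add_mem _ h₁ h₂
      | zero => rw [zero_mul]; exact Submodule.zero_mem _
      | add x z _ _ h₁ h₂ => rw [add_mul]; exact Submodule.add_mem _ h₁ h₂)

theorem algebraOf_mono {F G : AddSubgroup W} (h : F ≤ G) : S.algebraOf F ≤ S.algebraOf G := by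
  have key : (⨆ a : F, S.space (a : W)) ≤ ⨆ a : G, S.space (a : W) :=
    iSup_le fun a => le_iSup (fun b : G => S.space (b : W)) ⟨a, h a.2⟩
  exact fun x hx => key hx

/-- The torsion subgroup `T` of `Ev(Δ)`. -/
def Tor : AddSubgroup W :=
  S.Ev ⊓ AddCommGroup.torsion W

/-- The rank `dim_ℚ (ℚ ⊗ Ev(Δ))` of the group `Ev(Δ)`. -/
noncomputable def rank : ℕ :=
  Module.finrank ℚ (ℚ ⊗[ℤ] S.Ev)

/-- `Ev(Δ)` is a finitely generated abelian group, isomorphic to `T ⊕ ℤʳ` with `T` its (finite)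
torsion subgroup and `r` its rank. -/
def EigenvaluesFinGen : Prop :=
  S.Ev.FG ∧ Finite S.Tor ∧ Nonempty (S.Ev ≃+ S.Tor × (Fin S.rank → ℤ))

/-- The eigen-algebra `D(Δ) = ⨁_{a ∈ Ev(Δ)} D_a` (the sum inside `D` is direct) is a Noetherian
domain; `D_T = ⨁_{a ∈ T} D_a` is a division algebra of left and right dimension `|T|` over the
division algebra `D_0`; and `D(Δ)` is an iterated skew Laurent extension of `D_T` in `r`
variables. -/
structure EigenalgebraStructure : Prop where
  direct : iSupIndep fun a : S.Ev => S.space (a : W)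
  noetherian : IsTwoSidedNoetherian (S.algebraOf S.Ev)
  domain : IsDomain (S.algebraOf S.Ev)
  division_zero : IsDivisionSubalgebra (S.algebraOf ⊥)
  division_torsion : IsDivisionSubalgebra (S.algebraOf S.Tor)
  left_dim : HasLeftDimension (S.algebraOf ⊥) (S.algebraOf S.Tor) (Nat.card S.Tor)
  right_dim : HasRightDimension (S.algebraOf ⊥) (S.algebraOf S.Tor) (Nat.card S.Tor)
  laurent : IsIteratedSkewLaurentExtension S.rank
    (Subalgebra.inclusion (S.algebraOf_mono (inf_le_left : S.Tor ≤ S.Ev)))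

/-- For each subgroup `F` of `Ev(Δ)`, the algebra `⨁_{a ∈ F} D_a` is a Noetherian domain; it has
a quotient division algebra `Q` (inside `D`), which is `Δ`-invariant; the group of eigenvalues of
`Δ` in `Q` is `F`; and each eigenvector in `Q` is a left fraction of eigenvectors with eigenvalues
in `F`. -/
def SubgroupStructure : Prop :=
  ∀ F : AddSubgroup W, F ≤ S.Ev →
    IsTwoSidedNoetherian (S.algebraOf F) ∧ IsDomain (S.algebraOf F) ∧
    ∃ Q : Subalgebra K D, IsQuotientDivisionSubalgebra (S.algebraOf F) Q ∧
      (∀ i, ∀ q ∈ Q, S.op i q ∈ Q) ∧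
      (∀ a : W, (∃ q ∈ Q, q ∈ S.space a ∧ q ≠ 0) ↔ a ∈ F) ∧
      (∀ a : W, ∀ q ∈ Q, q ∈ S.space a → q ≠ 0 →
        a ∈ F ∧ ∃ b ∈ F, ∃ y ∈ S.space b, ∃ z ∈ S.space (a + b), y ≠ 0 ∧ q = y⁻¹ * z)

/-- All assertions about the common eigenvectors of `Δ`. -/
structure EigenConclusions : Prop where
  eigenvalues : S.EigenvaluesFinGen
  eigenalgebra : S.EigenalgebraStructure
  subgroups : S.SubgroupStructure

end WeightSystem

end Weights

/-! Every finiteness statement comes from a single fact: the ring D ⊗ Dᵒ is left Noetherian.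

To see this, let L = Frac A and choose x₁, …, xₙ ∈ A whose differentials form a basis of Ω_{L/K}
(`exists_isDualDerivations`). The dual derivations dᵢ of L commute, and L together with the dᵢ
generates a Weyl-type algebra S ⊆ End_K(L). In characteristic zero every differential operator on A
extends uniquely to an element of S (`exists_diffOps_algHom`). Conversely, an element of S
multiplied on either side by a suitable nonzero element of A restricts to an operator on A
(`exists_left_denominator`, `exists_right_denominator`). Hence 𝒟(A) and S have the same quotient
division algebra D. It exists because S is a Noetherian domain: adjoin the dᵢ one at a time and use
leading coefficients. The algebra S ⊗ Sᵒ is again of Weyl type, over L ⊗ L, which is a localization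
of the Noetherian ring A ⊗ A. Passing to D ⊗ Dᵒ only inverts more elements, which preserves the
Noetherian property and, when L ⊗ L is a domain, the absence of zero divisors.

A division subalgebra E is recovered from the left ideal of D ⊗ Dᵒ generated by the elements e ⊗ 1 -
1 ⊗ e (`mem_iff_mem_diagonalIdeal`), because D is a left vector space over E and linear functionals
separate E from its complement. So division subalgebras satisfy the ascending chain condition, and a
maximal finitely generated one inside E must be E.

For the eigenvectors: D_λ = D₀u for any nonzero u ∈ D_λ, so for a finitely generated group F of
eigenvalues the algebra ⨁_F D_λ arises from the division ring D₀ by adjoining finitely many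
normalizing units. It is therefore Noetherian and has a quotient division algebra Q(F) ⊆ D.
Comparing components in a v = b shows that eigenvectors in Q(F) have eigenvalues in F
(`exists_fraction_of_mem_space`). Thus Q(F) determines F, and the chain condition on the Q(F) forces
Ev(Δ) to be finitely generated (`Ev_fg`). Torsion eigenvalues contribute a finite extension of D₀,
and a basis modulo torsion supplies the skew Laurent variables. -/

set_option linter.unusedSectionVars false

/-! ### Rings generated by a subring and one skew-commuting element -/

section SkewPolynomial

variable {R T : Type*} [Ring R] [Ring T]

/-- The additive group of all `∑_{i < n} zⁱ f(rᵢ)`. -/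
def powFiltration (f : R →+* T) (z : T) : ℕ → AddSubgroup T
  | 0 => ⊥
  | n + 1 => powFiltration f z n ⊔ f.range.toAddSubgroup.map (AddMonoidHom.mulLeft (z ^ n))

/-- `z` skew-commutes with the image of `f`: `z f(R) + f(R) = f(R) z + f(R)`. -/
structure SkewCommutes (f : R →+* T) (z : T) : Prop where
  left : ∀ r, ∃ s t, z * f r = f s * z + f t
  right : ∀ r, ∃ s t, f r * z = z * f s + f t

namespace powFiltration

variable {f : R →+* T} {z : T}

theorem mem_succ {n : ℕ} {t : T} :
    t ∈ powFiltration f z (n + 1) ↔ ∃ r, t - z ^ n * f r ∈ powFiltration f z n := by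
  rw [powFiltration, AddSubgroup.mem_sup]
  constructor
  · rintro ⟨y, hy, _, ⟨_, ⟨r, rfl⟩, rfl⟩, rfl⟩
    exact ⟨r, by simpa using hy⟩
  · rintro ⟨r, hr⟩
    exact ⟨_, hr, _, ⟨_, ⟨r, rfl⟩, rfl⟩, by simp⟩

theorem pow_mul_mem (n : ℕ) (r : R) : z ^ n * f r ∈ powFiltration f z (n + 1) :=
  mem_succ.2 ⟨r, by simp⟩

theorem mono : Monotone (powFiltration f z) :=
  monotone_nat_of_le_succ fun _ => le_sup_left

theorem z_mul {n : ℕ} {t : T} (ht : t ∈ powFiltration f z n) :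
    z * t ∈ powFiltration f z (n + 1) := by
  induction n generalizing t with
  | zero =>
    have : t = 0 := ht
    simp [this]
  | succ n ih =>
    obtain ⟨r, hr⟩ := mem_succ.1 ht
    refine mem_succ.2 ⟨r, ?_⟩
    have := ih hr
    rwa [mul_sub, ← mul_assoc, ← pow_succ'] at this

theorem pow_mul {n : ℕ} {t : T} (ht : t ∈ powFiltration f z n) (m : ℕ) :
    z ^ m * t ∈ powFiltration f z (m + n) := by
  induction m with
  | zero => simpa using ht
  | succ m ih =>
    rw [pow_succ', mul_assoc, add_right_comm]
    exact z_mul ih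

theorem mul_map {n : ℕ} {t : T} (ht : t ∈ powFiltration f z n) (r : R) :
    t * f r ∈ powFiltration f z n := by
  induction n generalizing t with
  | zero =>
    have : t = 0 := ht
    simp [this]
  | succ n ih =>
    obtain ⟨s, hs⟩ := mem_succ.1 ht
    refine mem_succ.2 ⟨s * r, ?_⟩
    have := ih hs
    rwa [sub_mul, mul_assoc, ← map_mul] at this

/-- Moving a coefficient across a power of `z` changes it, but only modulo lower degree. This
direction shows that left multiplication by coefficients respects the filtration. -/
theorem exists_map_mul_pow (h : SkewCommutes f z) (n : ℕ) (r : R) :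
    ∃ s, f r * z ^ n - z ^ n * f s ∈ powFiltration f z n := by
  induction n generalizing r with
  | zero => exact ⟨r, by simp⟩
  | succ n ih =>
    obtain ⟨s, t, hst⟩ := h.right r
    obtain ⟨s', hs'⟩ := ih s
    obtain ⟨t', ht'⟩ := ih t
    refine ⟨s', ?_⟩
    have e : f r * z ^ (n + 1) - z ^ (n + 1) * f s' =
        z * (f s * z ^ n - z ^ n * f s') + (f t * z ^ n - z ^ n * f t' + z ^ n * f t') := by
      rw [pow_succ', ← mul_assoc, hst]
      noncomm_ring
    rw [e]
    exact add_mem (z_mul hs') (add_mem (mono n.le_succ ht') (pow_mul_mem n t'))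

theorem map_mul_pow_mem (h : SkewCommutes f z) (n : ℕ) (r : R) :
    f r * z ^ n ∈ powFiltration f z (n + 1) :=
  mem_succ.2 (exists_map_mul_pow h n r)

theorem map_mul (h : SkewCommutes f z) {n : ℕ} {t : T} (ht : t ∈ powFiltration f z n) (r : R) :
    f r * t ∈ powFiltration f z n := by
  induction n generalizing t with
  | zero =>
    have : t = 0 := ht
    simp [this]
  | succ n ih =>
    obtain ⟨s, hs⟩ := mem_succ.1 ht
    have e : f r * t = f r * (t - z ^ n * f s) + f r * z ^ n * f s := by noncomm_ring
    rw [e]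
    exact add_mem (mono n.le_succ (ih hs)) (mul_map (map_mul_pow_mem h n r) s)

/-- The converse direction: any prescribed right coefficient of `z ^ n` is reached from a left one.
This is what makes leading coefficients of a left ideal into a left ideal, although they are written
on the right. -/
theorem exists_pow_mul_map (h : SkewCommutes f z) (n : ℕ) (s : R) :
    ∃ r, f r * z ^ n - z ^ n * f s ∈ powFiltration f z n := by
  induction n with
  | zero => exact ⟨s, by simp⟩
  | succ n ih =>
    obtain ⟨r, hr⟩ := ih
    obtain ⟨s', t', hst⟩ := h.left r
    refine ⟨s', ?_⟩
    have e : f s' * z ^ (n + 1) - z ^ (n + 1) * f s =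
        z * (f r * z ^ n - z ^ n * f s) - f t' * z ^ n := by
      rw [mul_sub, ← mul_assoc, hst, pow_succ']
      noncomm_ring
    rw [e]
    exact sub_mem (z_mul hr) (map_mul_pow_mem h n t')

/-- Index `n` means degree less than `n`, so degrees below `m` and at most `n` give a product of
degree below `m + n`. -/
theorem mul_mem (h : SkewCommutes f z) {m n : ℕ} {t u : T} (ht : t ∈ powFiltration f z m)
    (hu : u ∈ powFiltration f z (n + 1)) : t * u ∈ powFiltration f z (m + n) := by
  induction m generalizing t with
  | zero =>
    have : t = 0 := ht
    simp [this]
  | succ m ih =>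
    obtain ⟨r, hr⟩ := mem_succ.1 ht
    have e : t * u = (t - z ^ m * f r) * u + z ^ m * (f r * u) := by noncomm_ring
    rw [e]
    refine add_mem (mono (by omega) (ih hr)) ?_
    have := pow_mul (map_mul h hu r) m
    rwa [show m + 1 + n = m + (n + 1) by omega]

theorem exists_mem (h : SkewCommutes f z)
    (hgen : ∀ U : Subring T, (∀ r, f r ∈ U) → z ∈ U → U = ⊤) (t : T) :
    ∃ n, t ∈ powFiltration f z n := by
  let U : Subring T :=
    { carrier := {t | ∃ n, t ∈ powFiltration f z n}
      mul_mem' := by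
        rintro a b ⟨m, hm⟩ ⟨n, hn⟩
        exact ⟨m + n, mul_mem h hm (mono n.le_succ hn)⟩
      one_mem' := ⟨1, by simpa using pow_mul_mem (f := f) (z := z) 0 1⟩
      add_mem' := by
        rintro a b ⟨m, hm⟩ ⟨n, hn⟩
        exact ⟨max m n, add_mem (mono (le_max_left _ _) hm) (mono (le_max_right _ _) hn)⟩
      zero_mem' := ⟨0, zero_mem _⟩
      neg_mem' := by
        rintro a ⟨m, hm⟩
        exact ⟨m, neg_mem hm⟩ }
  have : U = ⊤ := hgen U (fun r => ⟨1, by simpa using pow_mul_mem (f := f) (z := z) 0 r⟩)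
    ⟨2, by simpa using pow_mul_mem (f := f) (z := z) 1 1⟩
  exact (this ▸ Subring.mem_top t : t ∈ U)

/-- The left ideal of leading coefficients in degree `n` of a left ideal. -/
def leadingCoeffs (h : SkewCommutes f z) (I : Ideal T) (n : ℕ) : Ideal R where
  carrier := {r | ∃ t ∈ I, t - z ^ n * f r ∈ powFiltration f z n}
  add_mem' := by
    rintro a b ⟨t, ht, hta⟩ ⟨u, hu, hub⟩
    refine ⟨t + u, add_mem ht hu, ?_⟩
    have := add_mem hta hub
    rwa [sub_add_sub_comm, ← mul_add, ← map_add] at this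
  zero_mem' := ⟨0, zero_mem _, by simp⟩
  smul_mem' := by
    rintro s r ⟨t, ht, htr⟩
    obtain ⟨s', hs'⟩ := exists_pow_mul_map h n s
    refine ⟨f s' * t, I.mul_mem_left _ ht, ?_⟩
    have e : f s' * t - z ^ n * f (s • r) =
        f s' * (t - z ^ n * f r) + (f s' * z ^ n - z ^ n * f s) * f r := by
      rw [smul_eq_mul, _root_.map_mul]
      noncomm_ring
    rw [e]
    exact add_mem (map_mul h htr s') (mul_map hs' r)

theorem leadingCoeffs_mono (h : SkewCommutes f z) {I J : Ideal T} (hIJ : I ≤ J) {m n : ℕ}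
    (hmn : m ≤ n) : leadingCoeffs h I m ≤ leadingCoeffs h J n := by
  rintro r ⟨t, ht, htr⟩
  refine ⟨z ^ (n - m) * t, J.mul_mem_left _ (hIJ ht), ?_⟩
  have := pow_mul htr (n - m)
  rwa [mul_sub, ← mul_assoc, ← pow_add, Nat.sub_add_cancel hmn] at this

/-- Subtract from an element of `J` an element of `I` with the same leading coefficient: the
difference lies in `J` and has smaller degree. Leading coefficients need not be unique for this. -/
theorem le_of_leadingCoeffs_le (h : SkewCommutes f z)
    (hgen : ∀ U : Subring T, (∀ r, f r ∈ U) → z ∈ U → U = ⊤) {I J : Ideal T} (hIJ : I ≤ J)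
    (hlead : ∀ n, leadingCoeffs h J n ≤ leadingCoeffs h I n) : J ≤ I := by
  have key : ∀ n, ∀ t ∈ J, t ∈ powFiltration f z n → t ∈ I := by
    intro n
    induction n with
    | zero =>
      intro t _ ht
      have : t = 0 := ht
      simp [this]
    | succ n ih =>
      intro t htJ ht
      obtain ⟨r, hr⟩ := mem_succ.1 ht
      obtain ⟨u, huI, hu⟩ := hlead n ⟨t, htJ, hr⟩
      have h1 : t - u ∈ I := by
        refine ih _ (sub_mem htJ (hIJ huI)) ?_
        have := sub_mem hr hu
        rwa [sub_sub_sub_cancel_right] at this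
      simpa using add_mem h1 huI
  intro t ht
  obtain ⟨n, hn⟩ := exists_mem h hgen t
  exact key n t ht hn

end powFiltration

open powFiltration in
/-- Hilbert's basis theorem for a ring generated by a left Noetherian ring and a skew-commuting
element. -/
theorem SkewCommutes.isNoetherianRing {f : R →+* T} {z : T} (h : SkewCommutes f z)
    (hgen : ∀ U : Subring T, (∀ r, f r ∈ U) → z ∈ U → U = ⊤) [IsNoetherianRing R] :
    IsNoetherianRing T := by
  refine monotone_stabilizes_iff_noetherian.1 fun I => ?_
  have hmono : ∀ {a b c d : ℕ}, a ≤ b → c ≤ d →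
      leadingCoeffs h (I a) c ≤ leadingCoeffs h (I b) d :=
    fun hab hcd => leadingCoeffs_mono h (I.monotone hab) hcd
  -- The leading ideals increase both in the degree and along the chain. The diagonal bounds all
  -- degrees from `M` on; the finitely many smaller degrees are stabilized one by one below.
  obtain ⟨M, hM⟩ := monotone_stabilizes_iff_noetherian.2 (inferInstanceAs (IsNoetherian R R))
    ⟨fun n => leadingCoeffs h (I n) n, fun a b hab => hmono hab hab⟩
  have hcol : ∀ n, ∃ k, ∀ m, k ≤ m → leadingCoeffs h (I k) n = leadingCoeffs h (I m) n := fun n =>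
    monotone_stabilizes_iff_noetherian.2 (inferInstanceAs (IsNoetherian R R))
      ⟨fun k => leadingCoeffs h (I k) n, fun a b hab => hmono hab le_rfl⟩
  choose k hk using hcol
  let N := max M ((Finset.range M).sup k)
  refine ⟨N, fun m hm => le_antisymm (I.monotone hm)
    (le_of_leadingCoeffs_le h hgen (I.monotone hm) fun n => ?_)⟩
  rcases lt_or_ge n M with hn | hn
  · have h1 : k n ≤ N := (Finset.le_sup (f := k) (Finset.mem_range.2 hn)).trans (le_max_right _ _)
    rw [← hk n m (h1.trans hm), hk n N h1]
  · have hMN : M ≤ N := le_max_left _ _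
    calc leadingCoeffs h (I m) n ≤ leadingCoeffs h (I (max m n)) (max m n) :=
          hmono (le_max_left _ _) (le_max_right _ _)
      _ = leadingCoeffs h (I M) M := (hM _ (hn.trans (le_max_right _ _))).symm
      _ ≤ leadingCoeffs h (I N) n := hmono hMN hn

open powFiltration in
/-- A ring of characteristic zero generated by a domain `R` and an element `z` with `[z, R] ⊆ R`
is a domain, if there is an element `x` commuting with `R` such that `[z, x] = 1`. -/
theorem noZeroDivisors_of_commutator {f : R →+* T} {z x : T} [IsDomain R] [CharZero R]
    (hf : Function.Injective f) (h : ∀ r, ∃ s, z * f r - f r * z = f s)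
    (hgen : ∀ U : Subring T, (∀ r, f r ∈ U) → z ∈ U → U = ⊤)
    (hx : ∀ r, Commute x (f r)) (hzx : z * x - x * z = 1) : NoZeroDivisors T := by
  have hskew : SkewCommutes f z := by
    refine ⟨fun r => ?_, fun r => ?_⟩ <;> obtain ⟨s, hs⟩ := h r
    · exact ⟨r, s, by rw [← hs]; abel⟩
    · exact ⟨r, -s, by rw [map_neg, ← hs]; abel⟩
  -- The bracket with `x` acts as d/dz. It lowers degree and multiplies leading coefficients by
  -- positive integers, which are nonzero in characteristic zero.
  have hpow : ∀ n : ℕ, z ^ (n + 1) * x - x * z ^ (n + 1) = (n + 1 : ℕ) • z ^ n := by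
    intro n
    induction n with
    | zero => simpa using hzx
    | succ n ih =>
      have e : z ^ (n + 1 + 1) * x - x * z ^ (n + 1 + 1) =
          z * (z ^ (n + 1) * x - x * z ^ (n + 1)) + (z * x - x * z) * z ^ (n + 1) := by
        rw [pow_succ' z (n + 1)]
        noncomm_ring
      rw [e, ih, hzx, mul_smul_comm, ← pow_succ', one_mul, succ_nsmul _ (n + 1)]
  have hterm : ∀ (n : ℕ) (r : R), z ^ (n + 1) * f r * x - x * (z ^ (n + 1) * f r) =
      z ^ n * f ((n + 1 : ℕ) • r) := by
    intro n r
    rw [mul_assoc, ← (hx r).eq, ← mul_assoc, ← mul_assoc, ← sub_mul, hpow, map_nsmul,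
      mul_smul_comm, smul_mul_assoc]
  have hder : ∀ n, ∀ t ∈ powFiltration f z (n + 1), t * x - x * t ∈ powFiltration f z n := by
    intro n
    induction n with
    | zero =>
      intro t ht
      obtain ⟨r, hr⟩ := mem_succ.1 ht
      have : t = f r := by simpa [sub_eq_zero] using (show t - z ^ 0 * f r = 0 from hr)
      rw [this, (hx r).eq, sub_self]
      exact zero_mem _
    | succ n ih =>
      intro t ht
      obtain ⟨r, hr⟩ := mem_succ.1 ht
      refine mem_succ.2 ⟨(n + 1 : ℕ) • r, ?_⟩
      have e : t * x - x * t - z ^ n * f ((n + 1 : ℕ) • r) =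
          (t - z ^ (n + 1) * f r) * x - x * (t - z ^ (n + 1) * f r) := by
        rw [← hterm]
        noncomm_ring
      rw [e]
      exact ih _ hr
  -- Differentiating n times shows that the powers of `z` are independent over `R`, so leading
  -- coefficients are well defined.
  have hindep : ∀ (n : ℕ) (r : R), z ^ n * f r ∈ powFiltration f z n → r = 0 := by
    intro n
    induction n with
    | zero =>
      intro r hr
      have : f r = 0 := by simpa using (show z ^ 0 * f r = 0 from hr)
      exact (map_eq_zero_iff f hf).1 this
    | succ n ih =>
      intro r hr
      have h1 := hder n _ hr
      rw [hterm] at h1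
      have h2 := ih _ h1
      rw [nsmul_eq_mul, mul_eq_zero] at h2
      exact h2.resolve_left (Nat.cast_ne_zero.2 n.succ_ne_zero)
  have hlead : ∀ t : T, t ≠ 0 → ∃ n r, r ≠ 0 ∧ t - z ^ n * f r ∈ powFiltration f z n := by
    intro t ht
    obtain ⟨n, hn⟩ := exists_mem hskew hgen t
    induction n with
    | zero => exact absurd hn ht
    | succ n ih =>
      obtain ⟨r, hr⟩ := mem_succ.1 hn
      rcases eq_or_ne r 0 with rfl | h0
      · exact ih (by simpa using hr)
      · exact ⟨n, r, h0, hr⟩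
  -- Since `[z, R] ⊆ R`, coefficients pass through powers of `z` unchanged modulo lower degree;
  -- leading coefficients are therefore multiplicative.
  have hcomm : ∀ (n : ℕ) (r : R), f r * z ^ n - z ^ n * f r ∈ powFiltration f z n := by
    intro n
    induction n with
    | zero => intro r; simp
    | succ n ih =>
      intro r
      obtain ⟨s, hs⟩ := h r
      have e : f r * z ^ (n + 1) - z ^ (n + 1) * f r =
          z * (f r * z ^ n - z ^ n * f r) - f s * z ^ n := by
        rw [← hs, pow_succ']
        noncomm_ring
      rw [e]
      exact sub_mem (z_mul (ih r)) (map_mul_pow_mem hskew n s)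
  refine ⟨fun {a b} hab => ?_⟩
  by_contra! hne
  obtain ⟨m, r, hr0, hr⟩ := hlead a hne.1
  obtain ⟨n, s, hs0, hs⟩ := hlead b hne.2
  refine mul_ne_zero hr0 hs0 (hindep (m + n) _ ?_)
  have hb : b ∈ powFiltration f z (n + 1) := mem_succ.2 ⟨s, hs⟩
  have e : z ^ (m + n) * f (r * s) = -((a - z ^ m * f r) * b + z ^ m * (f r * (b - z ^ n * f s)) +
      z ^ m * (f r * z ^ n - z ^ n * f r) * f s) := by
    have e1 : (a - z ^ m * f r) * b + z ^ m * (f r * (b - z ^ n * f s)) +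
      z ^ m * (f r * z ^ n - z ^ n * f r) * f s = a * b - z ^ m * z ^ n * (f r * f s) := by
      noncomm_ring
    rw [e1, hab, zero_sub, neg_neg, _root_.map_mul, pow_add]
  rw [e]
  exact neg_mem (add_mem (add_mem (mul_mem hskew hr hb) (pow_mul (map_mul hskew hs r) m))
    (mul_map (pow_mul (hcomm n r) m) s))

end SkewPolynomial

/-! ### Left denominators -/

section Denominators

/-- Every element of `S` is a left fraction, with an invertible denominator, of elements of the
image of `f`. -/
def HasLeftDenominators {B S : Type*} [Ring B] [Ring S] (f : B →+* S) : Prop :=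
  ∀ s : S, ∃ b c : B, IsUnit (f b) ∧ f b * s = f c

namespace HasLeftDenominators

variable {B S : Type*} [Ring B] [Ring S] {f : B →+* S}

/-- A left ideal of `S` is determined by its contraction to `B`: multiplying an element by its
denominator, a unit, lands in the contraction. -/
theorem isNoetherianRing (h : HasLeftDenominators f) [IsNoetherianRing B] :
    IsNoetherianRing S := by
  refine monotone_stabilizes_iff_noetherian.1 fun I => ?_
  obtain ⟨n, hn⟩ := monotone_stabilizes_iff_noetherian.2 (inferInstanceAs (IsNoetherian B B))
    (⟨fun n => Ideal.comap f (I n), fun a b hab => Ideal.comap_mono (I.monotone hab)⟩ :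
      ℕ →o Submodule B B)
  refine ⟨n, fun m hm => le_antisymm (I.monotone hm) fun s hs => ?_⟩
  obtain ⟨b, c, hb, hbc⟩ := h s
  have hc : c ∈ Ideal.comap f (I m) := by
    rw [Ideal.mem_comap, ← hbc]
    exact Ideal.mul_mem_left (I m) _ hs
  have hnm : Ideal.comap f (I n) = Ideal.comap f (I m) := hn m hm
  have hc' : c ∈ Ideal.comap f (I n) := hnm ▸ hc
  rw [Ideal.mem_comap, ← hbc] at hc'
  obtain ⟨u, hu⟩ := hb
  rw [← hu] at hc'
  simpa using Ideal.mul_mem_left (I n) (↑u⁻¹ : S) hc'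

/-- No Ore condition is assumed on `B`; it is extracted from the denominators. If `f c * s = 0` with
`s = b⁻¹d`, rewriting `c b⁻¹` as a left fraction `b'⁻¹d'` turns the relation into `d' * d = 0` in
`B`. -/
theorem noZeroDivisors (h : HasLeftDenominators f) (hf : Function.Injective f)
    [NoZeroDivisors B] : NoZeroDivisors S := by
  have key : ∀ (c : B) (s : S), f c * s = 0 → c = 0 ∨ s = 0 := by
    intro c s hcs
    obtain ⟨b, d, ⟨u, hu⟩, hbd⟩ := h s
    rcases eq_or_ne c 0 with hc | hc
    · exact Or.inl hc
    right
    obtain ⟨b', d', ⟨u', hu'⟩, hbd'⟩ := h (f c * (↑u⁻¹ : S))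
    have h1 : f (d' * d) = 0 := by
      rw [map_mul, ← hbd', ← hbd, ← hu]
      simp only [mul_assoc, Units.inv_mul_cancel_left]
      rw [hcs, mul_zero]
    have h2 : d' * d = 0 := (map_eq_zero_iff f hf).1 h1
    rcases mul_eq_zero.1 h2 with h3 | h3
    · rw [h3, map_zero, ← hu', Units.mul_right_eq_zero, Units.mul_left_eq_zero] at hbd'
      exact absurd ((map_eq_zero_iff f hf).1 hbd') hc
    · rwa [h3, map_zero, ← hu, Units.mul_right_eq_zero] at hbd
  refine ⟨fun {s t} hst => ?_⟩
  obtain ⟨b, c, ⟨u, hu⟩, hbc⟩ := h s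
  have h1 : f c * t = 0 := by rw [← hbc, mul_assoc, hst, mul_zero]
  rcases key c t h1 with hc | ht
  · rw [hc, map_zero, ← hu, Units.mul_right_eq_zero] at hbc
    exact Or.inl hbc
  · exact Or.inr ht

theorem exists_common (h : HasLeftDenominators f) (t : Finset S) :
    ∃ b : B, IsUnit (f b) ∧ ∀ s ∈ t, ∃ c, f b * s = f c := by
  classical
  induction t using Finset.induction_on with
  | empty => exact ⟨1, by simp, by simp⟩
  | insert a t _ ih =>
    obtain ⟨b, hb, hbt⟩ := ih
    obtain ⟨b', c', hb', hbc'⟩ := h (f b * a)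
    refine ⟨b' * b, by rw [map_mul]; exact hb'.mul hb, fun s hs => ?_⟩
    rcases Finset.mem_insert.1 hs with rfl | hs
    · exact ⟨c', by rw [map_mul, mul_assoc, hbc']⟩
    · obtain ⟨c, hc⟩ := hbt s hs
      exact ⟨b' * c, by rw [map_mul, map_mul, mul_assoc, hc]⟩

/-- A tensor is a finite sum, so its left factors have a common denominator `b`, its right factors a
common denominator `c`, and `b ⊗ c` clears the whole sum. -/
theorem tensorProduct {K : Type*} [Field K] {B₁ S₁ B₂ S₂ : Type*} [Ring B₁] [Ring S₁] [Ring B₂]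
    [Ring S₂] [Algebra K B₁] [Algebra K S₁] [Algebra K B₂] [Algebra K S₂] {f : B₁ →ₐ[K] S₁}
    {g : B₂ →ₐ[K] S₂} (hf : HasLeftDenominators (f : B₁ →+* S₁))
    (hg : HasLeftDenominators (g : B₂ →+* S₂)) :
    HasLeftDenominators (Algebra.TensorProduct.map f g : B₁ ⊗[K] B₂ →+* S₁ ⊗[K] S₂) := by
  classical
  intro x
  obtain ⟨t, rfl⟩ := TensorProduct.exists_finset x
  obtain ⟨b, hb, hbt⟩ := hf.exists_common (t.image Prod.fst)
  obtain ⟨c, hc, hct⟩ := hg.exists_common (t.image Prod.snd)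
  have h1 : ∀ i : S₁ × S₂, ∃ y : B₁ ⊗[K] B₂, i ∈ t →
      Algebra.TensorProduct.map f g (b ⊗ₜ c) * (i.1 ⊗ₜ i.2) =
        Algebra.TensorProduct.map f g y := by
    intro i
    by_cases hi : i ∈ t
    · obtain ⟨b', hb'⟩ := hbt i.1 (Finset.mem_image_of_mem _ hi)
      obtain ⟨c', hc'⟩ := hct i.2 (Finset.mem_image_of_mem _ hi)
      refine ⟨b' ⊗ₜ c', fun _ => ?_⟩
      have e1 : f b * i.1 = f b' := hb'
      have e2 : g c * i.2 = g c' := hc'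
      simp [e1, e2]
    · exact ⟨0, fun h => absurd h hi⟩
  choose y hy using h1
  refine ⟨b ⊗ₜ c, ∑ i ∈ t, y i, ?_, ?_⟩
  · obtain ⟨u, hu⟩ := hb
    obtain ⟨v, hv⟩ := hc
    have hu' : f b = u := hu.symm
    have hv' : g c = v := hv.symm
    simp only [RingHom.coe_coe, Algebra.TensorProduct.map_tmul]
    rw [hu', hv']
    refine ⟨⟨u ⊗ₜ v, ↑u⁻¹ ⊗ₜ ↑v⁻¹, ?_, ?_⟩, rfl⟩ <;>
      simp [Algebra.TensorProduct.tmul_mul_tmul, Algebra.TensorProduct.one_def]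
  · simp only [RingHom.coe_coe, map_sum, Finset.mul_sum]
    exact Finset.sum_congr rfl fun i hi => hy i hi

end HasLeftDenominators

end Denominators

/-! ### Ore domains and quotient division algebras -/

section Ore

/-- Otherwise `r` and `s` would be two linearly independent elements of the left module `R`, which
has rank one. -/
theorem exists_left_common_multiple {R : Type*} [Ring R] [IsDomain R] [IsNoetherianRing R]
    (r : R) {s : R} (hs : s ≠ 0) : ∃ a b, a ≠ 0 ∧ a * r = b * s := by
  by_contra! hcon
  have hli : LinearIndependent R ![r, s] := by
    rw [LinearIndependent.pair_iff]
    intro a b hab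
    have ha : a = 0 := by
      by_contra ha
      refine hcon a (-b) ha ?_
      rw [neg_mul]
      exact eq_neg_of_add_eq_zero_left hab
    subst ha
    refine ⟨rfl, ?_⟩
    simpa [hs] using hab
  simpa using hli.fintype_card_le_finrank

theorem exists_right_common_multiple {R : Type*} [Ring R] [IsDomain R] [IsNoetherianRing Rᵐᵒᵖ]
    (r : R) {s : R} (hs : s ≠ 0) : ∃ a b, a ≠ 0 ∧ r * a = s * b := by
  obtain ⟨a, b, ha, hab⟩ := exists_left_common_multiple (MulOpposite.op r)
    (s := MulOpposite.op s) (by simpa using hs)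
  exact ⟨a.unop, b.unop, by simpa using ha, by simpa using congrArg MulOpposite.unop hab⟩

variable {K : Type*} [Field K] {D : Type*} [DivisionRing D] [Algebra K D]

/-- A (left and right) Noetherian subalgebra of a division algebra has a quotient division
algebra. -/
theorem exists_isQuotientDivisionSubalgebra (B : Subalgebra K D) [IsNoetherianRing B]
    [IsNoetherianRing Bᵐᵒᵖ] : ∃ Q : Subalgebra K D, IsQuotientDivisionSubalgebra B Q := by
  have ore : ∀ r ∈ B, ∀ s ∈ B, s ≠ 0 → ∃ a ∈ B, ∃ b ∈ B, a ≠ 0 ∧ a * r = b * s := by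
    intro r hr s hs hs0
    obtain ⟨a, b, ha, hab⟩ := exists_left_common_multiple (⟨r, hr⟩ : B) (s := ⟨s, hs⟩)
      (by simpa [Subtype.ext_iff] using hs0)
    exact ⟨a, a.2, b, b.2, by simpa using ha, congrArg Subtype.val hab⟩
  have ore' : ∀ r ∈ B, ∀ s ∈ B, s ≠ 0 → ∃ a ∈ B, ∃ b ∈ B, a ≠ 0 ∧ r * a = s * b := by
    intro r hr s hs hs0
    obtain ⟨a, b, ha, hab⟩ := exists_right_common_multiple (⟨r, hr⟩ : B) (s := ⟨s, hs⟩)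
      (by simpa [Subtype.ext_iff] using hs0)
    exact ⟨a, a.2, b, b.2, by simpa using ha, congrArg Subtype.val hab⟩
  have hfrac : ∀ {q s : D}, s ≠ 0 → s ∈ B → s * q ∈ B → ∃ a ∈ B, ∃ b ∈ B, a ≠ 0 ∧ q = a⁻¹ * b :=
    fun {q s} h0 hs hq => ⟨s, hs, _, hq, h0, by rw [inv_mul_cancel_left₀ h0]⟩
  refine ⟨⟨⟨⟨⟨{q | ∃ a ∈ B, ∃ b ∈ B, a ≠ 0 ∧ q = a⁻¹ * b}, ?_⟩, ?_⟩, ?_, ?_⟩, ?_⟩, ?_, ?_, ?_, ?_⟩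
  · rintro x y ⟨a, ha, b, hb, ha0, rfl⟩ ⟨c, hc, d, hd, hc0, rfl⟩
    obtain ⟨e, he, g, hg, he0, heg⟩ := ore b hb c hc hc0
    refine hfrac (mul_ne_zero he0 ha0) (mul_mem he ha) ?_
    have : e * a * (a⁻¹ * b * (c⁻¹ * d)) = g * d := by
      simp only [mul_assoc, mul_inv_cancel_left₀ ha0]
      rw [← mul_assoc e b, heg, mul_assoc, mul_inv_cancel_left₀ hc0]
    rw [this]
    exact mul_mem hg hd
  · exact ⟨1, one_mem _, 1, one_mem _, one_ne_zero, by simp⟩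
  · rintro x y ⟨a, ha, b, hb, ha0, rfl⟩ ⟨c, hc, d, hd, hc0, rfl⟩
    obtain ⟨e, he, g, hg, he0, heg⟩ := ore a ha c hc hc0
    refine hfrac (mul_ne_zero he0 ha0) (mul_mem he ha) ?_
    have : e * a * (a⁻¹ * b + c⁻¹ * d) = e * b + g * d := by
      rw [mul_add, mul_assoc, mul_inv_cancel_left₀ ha0, heg, mul_assoc, mul_inv_cancel_left₀ hc0]
    rw [this]
    exact add_mem (mul_mem he hb) (mul_mem hg hd)
  · exact ⟨1, one_mem _, 0, zero_mem _, one_ne_zero, by simp⟩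
  · intro r
    exact ⟨1, one_mem _, _, B.algebraMap_mem r, one_ne_zero, by simp⟩
  · rintro x ⟨a, ha, b, hb, ha0, rfl⟩
    rcases eq_or_ne b 0 with rfl | hb0
    · exact ⟨1, one_mem _, 0, zero_mem _, one_ne_zero, by simp⟩
    · exact ⟨b, hb, a, ha, hb0, by simp⟩
  · intro b hb
    exact ⟨1, one_mem _, b, hb, one_ne_zero, by simp⟩
  · rintro q ⟨a, ha, b, hb, ha0, rfl⟩
    exact ⟨a, ha, b, hb, ha0, rfl⟩
  · rintro q ⟨a, ha, b, hb, ha0, rfl⟩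
    obtain ⟨e, he, g, hg, he0, heg⟩ := ore' b hb a ha ha0
    refine ⟨e, he, g, hg, he0, ?_⟩
    rw [eq_mul_inv_iff_mul_eq₀ he0, mul_assoc, heg, inv_mul_cancel_left₀ ha0]

theorem IsQuotientDivisionAlgebra.hasLeftDenominators {R : Type*} [Ring R] [Algebra K R]
    {j : R →ₐ[K] D} (h : IsQuotientDivisionAlgebra j) :
    HasLeftDenominators (j : R →+* D) := by
  intro d
  obtain ⟨_, ⟨a, rfl⟩, _, ⟨b, rfl⟩, ha0, rfl⟩ := h.fractions.left_fraction d Algebra.mem_top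
  exact ⟨a, b, isUnit_iff_ne_zero.2 ha0, mul_inv_cancel_left₀ ha0 _⟩

theorem IsQuotientDivisionAlgebra.hasLeftDenominators_op {R : Type*} [Ring R] [Algebra K R]
    {j : R →ₐ[K] D} (h : IsQuotientDivisionAlgebra j) :
    HasLeftDenominators (AlgHom.op j : Rᵐᵒᵖ →+* Dᵐᵒᵖ) := by
  intro d
  obtain ⟨_, ⟨a, rfl⟩, _, ⟨b, rfl⟩, ha0, hd⟩ := h.fractions.right_fraction d.unop Algebra.mem_top
  refine ⟨MulOpposite.op a, MulOpposite.op b, isUnit_iff_ne_zero.2 ?_, ?_⟩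
  · simpa using ha0
  · apply MulOpposite.unop_injective
    have ha0' : j a ≠ 0 := ha0
    simp [hd, ha0']

theorem exists_nonZeroDivisors_unitsHom {R : Type*} [Ring R] [Nontrivial R] [Algebra K R]
    (j : R →ₐ[K] D) (hj : Function.Injective j) :
    ∃ jS : nonZeroDivisors R →* Units D, ∀ s : nonZeroDivisors R, (j : R →+* D) s = jS s := by
  have hne : ∀ s : nonZeroDivisors R, j s ≠ 0 := fun s =>
    (map_ne_zero_iff j hj).2 (nonZeroDivisors.ne_zero s.2)
  exact ⟨{ toFun := fun s => Units.mk0 (j s) (hne s)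
           map_one' := by ext; simp
           map_mul' := fun a b => by ext; simp }, fun s => rfl⟩

/-- The universal property of quotient division algebras. -/
theorem IsQuotientDivisionAlgebra.exists_lift {R : Type*} [Ring R] [Algebra K R]
    {j : R →ₐ[K] D} (h : IsQuotientDivisionAlgebra j) {D' : Type*} [DivisionRing D']
    [Algebra K D'] (j' : R →ₐ[K] D') (hj' : Function.Injective j') :
    ∃ φ : D →ₐ[K] D', ∀ r, φ (j r) = j' r := by
  have : IsDomain R := h.injective.isDomain j.toRingHom
  have hore : ∀ (r : R) (s : nonZeroDivisors R), ∃ (r' : R) (s' : nonZeroDivisors R),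
      s' * r = r' * s := by
    intro r s
    have hs0 : j s ≠ 0 := (map_ne_zero_iff j h.injective).2 (nonZeroDivisors.ne_zero s.2)
    -- Writing `r s⁻¹` as a left fraction `a⁻¹b` is the same as the Ore relation `a r = b s`.
    obtain ⟨a, b, ha, hab⟩ := h.hasLeftDenominators (j r * (j s)⁻¹)
    have ha0 : a ≠ 0 := by
      rintro rfl
      simp at ha
    refine ⟨b, ⟨a, mem_nonZeroDivisors_of_ne_zero ha0⟩, h.injective ?_⟩
    have hab' : j a * (j r * (j s)⁻¹) = j b := hab
    rw [map_mul, map_mul, ← hab', mul_assoc, mul_assoc, inv_mul_cancel₀ hs0, mul_one]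
  obtain ⟨inst⟩ := OreLocalization.nonempty_oreSet_iff_of_noZeroDivisors.2 hore
  obtain ⟨jS, hjS⟩ := exists_nonZeroDivisors_unitsHom j h.injective
  obtain ⟨jS', hjS'⟩ := exists_nonZeroDivisors_unitsHom j' hj'
  let ψ := OreLocalization.universalHom (j : R →+* D) jS hjS
  let ψ' := OreLocalization.universalHom (j' : R →+* D') jS' hjS'
  have hψ : Function.Bijective ψ := by
    refine ⟨ψ.injective, fun d => ?_⟩
    obtain ⟨a, b, ha, hab⟩ := h.hasLeftDenominators d
    have ha0 : a ≠ 0 := by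
      rintro rfl
      simp at ha
    refine ⟨OreLocalization.oreDiv b ⟨a, mem_nonZeroDivisors_of_ne_zero ha0⟩, ?_⟩
    rw [OreLocalization.universalHom_apply, ← hab, Units.inv_mul_eq_iff_eq_mul, ← hjS]
  let e := RingEquiv.ofBijective ψ hψ
  have he : ∀ r, ψ' (e.symm (j r)) = j' r := by
    intro r
    have h1 : e (OreLocalization.numeratorHom r) = j r :=
      OreLocalization.universalHom_commutes (j : R →+* D) jS hjS
    rw [← h1, e.symm_apply_apply]
    exact OreLocalization.universalHom_commutes (j' : R →+* D') jS' hjS'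
  refine ⟨{ ψ'.comp (e.symm : D →+* _) with
    commutes' := fun c => ?_ }, he⟩
  have := he (algebraMap K R c)
  rw [AlgHom.commutes, AlgHom.commutes] at this
  exact this

/-- The lift given by the universal property is injective, and it is onto because its image is
closed under fractions of elements of `R`. The two division algebras may live in different
universes. -/
theorem IsQuotientDivisionAlgebra.nonempty_algEquiv {R : Type*} [Ring R] [Algebra K R]
    {j : R →ₐ[K] D} (h : IsQuotientDivisionAlgebra j) {D' : Type*} [DivisionRing D']
    [Algebra K D'] {j' : R →ₐ[K] D'} (h' : IsQuotientDivisionAlgebra j') :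
    Nonempty (D ≃ₐ[K] D') := by
  obtain ⟨φ, hφ⟩ := h.exists_lift j' h'.injective
  refine ⟨AlgEquiv.ofBijective φ ⟨φ.toRingHom.injective, fun d => ?_⟩⟩
  obtain ⟨a, b, ha, hab⟩ := h'.hasLeftDenominators d
  have ha0 : j' a ≠ 0 := ha.ne_zero
  refine ⟨(j a)⁻¹ * j b, ?_⟩
  have hab' : j' a * d = j' b := hab
  rw [map_mul, map_inv₀, hφ, hφ, ← hab', inv_mul_cancel_left₀ ha0]

/-- A (left and right) Noetherian domain has a quotient division algebra. -/
theorem exists_isQuotientDivisionAlgebra (R : Type u) [Ring R] [IsDomain R] [Algebra K R]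
    [IsNoetherianRing R] [IsNoetherianRing Rᵐᵒᵖ] :
    ∃ (E : Type u) (_ : DivisionRing E) (_ : Algebra K E) (j : R →ₐ[K] E),
      IsQuotientDivisionAlgebra j := by
  have hore : ∀ (r : R) (s : nonZeroDivisors R), ∃ (r' : R) (s' : nonZeroDivisors R),
      s' * r = r' * s := by
    intro r s
    obtain ⟨a, b, ha, hab⟩ := exists_left_common_multiple r (nonZeroDivisors.ne_zero s.2)
    exact ⟨b, ⟨a, mem_nonZeroDivisors_of_ne_zero ha⟩, hab⟩
  obtain ⟨inst⟩ := OreLocalization.nonempty_oreSet_iff_of_noZeroDivisors.2 hore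
  let j : R →ₐ[K] OreLocalization (nonZeroDivisors R) R :=
    { OreLocalization.numeratorRingHom with commutes' := fun c => rfl }
  have hj : Function.Injective j :=
    OreLocalization.numeratorHom_inj inf_le_left
  have hleft : ∀ q : OreLocalization (nonZeroDivisors R) R, ∃ a b, a ≠ 0 ∧ q = (j a)⁻¹ * j b := by
    intro q
    induction q using OreLocalization.ind with
    | _ r s =>
      refine ⟨s, r, nonZeroDivisors.ne_zero s.2, ?_⟩
      have h0 : j s ≠ 0 := (map_ne_zero_iff j hj).2 (nonZeroDivisors.ne_zero s.2)
      rw [eq_inv_mul_iff_mul_eq₀ h0]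
      exact OreLocalization.mul_cancel
  refine ⟨OreLocalization (nonZeroDivisors R) R, inferInstance, inferInstance, j, hj,
    fun _ _ => Algebra.mem_top, le_top, fun q _ => ?_, fun q _ => ?_⟩
  · obtain ⟨a, b, ha, hq⟩ := hleft q
    exact ⟨j a, ⟨a, rfl⟩, j b, ⟨b, rfl⟩, (map_ne_zero_iff j hj).2 ha, hq⟩
  · obtain ⟨a, b, ha, hq⟩ := hleft q
    -- The right Ore relation `b c = a d` converts the left fraction `a⁻¹b` into the right fraction
    -- `d c⁻¹`.
    obtain ⟨c, d, hc, hcd⟩ := exists_right_common_multiple b ha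
    have ha' := (map_ne_zero_iff j hj).2 ha
    have hc' := (map_ne_zero_iff j hj).2 hc
    refine ⟨j c, ⟨c, rfl⟩, j d, ⟨d, rfl⟩, hc', ?_⟩
    rw [hq, eq_mul_inv_iff_mul_eq₀ hc', mul_assoc, ← map_mul, hcd, map_mul,
      inv_mul_cancel_left₀ ha']

end Ore

/-! ### Algebras generated by a commutative algebra and commuting derivations -/

section WeylPresentation

variable {K : Type*} [Field K]

/-- The algebra `S` is generated by the image of the commutative algebra `C` and commuting elements
`zᵢ` with `[zᵢ, C] ⊆ C`, and there are `xᵢ ∈ C` with `[zᵢ, xⱼ] = δᵢⱼ`. -/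
structure IsWeylPresentation {C S : Type*} [CommRing C] [Algebra K C] [Ring S] [Algebra K S]
    (f : C →ₐ[K] S) {ι : Type*} (z : ι → S) (x : ι → C) : Prop where
  comm : ∀ i j, Commute (z i) (z j)
  der : ∀ i c, ∃ d, z i * f c - f c * z i = f d
  pair_self : ∀ i, z i * f (x i) - f (x i) * z i = 1
  pair_ne : ∀ i j, i ≠ j → Commute (z i) (f (x j))
  gen : Algebra.adjoin K (Set.range f ∪ Set.range z) = ⊤

namespace IsWeylPresentation

variable {C S : Type*} [CommRing C] [Algebra K C] [Ring S] [Algebra K S]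
  {f : C →ₐ[K] S} {ι : Type*} {z : ι → S} {x : ι → C}

/-- Passing to the opposite algebra changes the sign of every bracket, so replacing `xᵢ` by `-xᵢ`
restores the pairing. -/
theorem op (h : IsWeylPresentation f z x) :
    IsWeylPresentation (f.toOpposite fun _ _ => Commute.all _ _ |>.map f)
      (fun i => MulOpposite.op (z i)) (fun i => -x i) where
  comm i j := (h.comm i j).op
  der i c := by
    obtain ⟨d, hd⟩ := h.der i c
    refine ⟨-d, MulOpposite.unop_injective ?_⟩
    simp [← hd]
  pair_self i := by
    apply MulOpposite.unop_injective
    simpa [neg_add_eq_sub] using h.pair_self i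
  pair_ne i j hij := by
    have := (h.pair_ne i j hij).neg_right.op
    simpa using this
  gen := by
    rw [← top_le_iff, ← Subalgebra.unop_le_unop_iff, Subalgebra.unop_top, ← h.gen,
      Algebra.adjoin_le_iff]
    rintro _ (⟨c, rfl⟩ | ⟨i, rfl⟩)
    · exact Algebra.subset_adjoin (Or.inl ⟨c, rfl⟩)
    · exact Algebra.subset_adjoin (Or.inr ⟨i, rfl⟩)

/-- Elements of different tensor factors commute, so all mixed brackets vanish and the presentations
are simply juxtaposed. -/
theorem tensorProduct {C' S' : Type*} [CommRing C'] [Algebra K C'] [Ring S'] [Algebra K S']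
    {f' : C' →ₐ[K] S'} {ι' : Type*} {z' : ι' → S'} {x' : ι' → C'}
    (h : IsWeylPresentation f z x) (h' : IsWeylPresentation f' z' x') :
    IsWeylPresentation (Algebra.TensorProduct.map f f')
      (Sum.elim (fun i => z i ⊗ₜ[K] (1 : S')) fun i => (1 : S) ⊗ₜ[K] z' i)
      (Sum.elim (fun i => x i ⊗ₜ[K] (1 : C')) fun i => (1 : C) ⊗ₜ[K] x' i) where
  comm i j := by
    rcases i with i | i <;> rcases j with j | j
    · simp [commute_iff_eq, (h.comm i j).eq]
    · simp [commute_iff_eq]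
    · simp [commute_iff_eq]
    · simp [commute_iff_eq, (h'.comm i j).eq]
  der i c := by
    induction c with
    | zero => exact ⟨0, by simp⟩
    | add a b ha hb =>
      obtain ⟨d, hd⟩ := ha
      obtain ⟨e, he⟩ := hb
      refine ⟨d + e, ?_⟩
      rw [map_add, map_add, ← hd, ← he]
      noncomm_ring
    | tmul a b =>
      rcases i with i | i
      · obtain ⟨d, hd⟩ := h.der i a
        exact ⟨d ⊗ₜ b, by simp [← hd, TensorProduct.sub_tmul]⟩
      · obtain ⟨d, hd⟩ := h'.der i b
        exact ⟨a ⊗ₜ d, by simp [← hd, TensorProduct.tmul_sub]⟩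
  pair_self i := by
    rcases i with i | i
    · simp [← TensorProduct.sub_tmul, h.pair_self, Algebra.TensorProduct.one_def]
    · simp [← TensorProduct.tmul_sub, h'.pair_self, Algebra.TensorProduct.one_def]
  pair_ne i j hij := by
    rcases i with i | i <;> rcases j with j | j
    · simp [commute_iff_eq, (h.pair_ne i j (by simpa using hij)).eq]
    · simp [commute_iff_eq]
    · simp [commute_iff_eq]
    · simp [commute_iff_eq, (h'.pair_ne i j (by simpa using hij)).eq]
  gen := by
    set U := Algebra.adjoin K (Set.range (Algebra.TensorProduct.map f f') ∪
      Set.range (Sum.elim (fun i => z i ⊗ₜ[K] (1 : S')) fun i => (1 : S) ⊗ₜ[K] z' i)) with hU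
    have h1 : (⊤ : Subalgebra K S) ≤
        U.comap (Algebra.TensorProduct.includeLeft : S →ₐ[K] S ⊗[K] S') := by
      rw [← h.gen, Algebra.adjoin_le_iff]
      rintro _ (⟨c, rfl⟩ | ⟨i, rfl⟩)
      · exact Algebra.subset_adjoin (Or.inl ⟨c ⊗ₜ 1, by simp⟩)
      · exact Algebra.subset_adjoin (Or.inr ⟨Sum.inl i, by simp⟩)
    have h2 : (⊤ : Subalgebra K S') ≤
        U.comap (Algebra.TensorProduct.includeRight : S' →ₐ[K] S ⊗[K] S') := by
      rw [← h'.gen, Algebra.adjoin_le_iff]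
      rintro _ (⟨c, rfl⟩ | ⟨i, rfl⟩)
      · exact Algebra.subset_adjoin (Or.inl ⟨1 ⊗ₜ c, by simp⟩)
      · exact Algebra.subset_adjoin (Or.inr ⟨Sum.inr i, by simp⟩)
    rw [eq_top_iff]
    intro t _
    induction t with
    | zero => exact zero_mem _
    | add a b ha hb => exact add_mem (ha trivial) (hb trivial)
    | tmul a b =>
      have ha : a ⊗ₜ[K] (1 : S') ∈ U := h1 (Algebra.mem_top (x := a))
      have hb : (1 : S) ⊗ₜ[K] b ∈ U := h2 (Algebra.mem_top (x := b))
      simpa using mul_mem ha hb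

variable (f z) in
/-- The subalgebra generated by `C` and some of the `zᵢ`. -/
def partialAlgebra (s : Finset ι) : Subalgebra K S :=
  Algebra.adjoin K (Set.range f ∪ z '' s)

theorem map_mem (s : Finset ι) (c : C) : f c ∈ partialAlgebra f z s :=
  Algebra.subset_adjoin (Or.inl ⟨c, rfl⟩)

theorem gen_mem {s : Finset ι} {i : ι} (hi : i ∈ s) : z i ∈ partialAlgebra f z s :=
  Algebra.subset_adjoin (Or.inr ⟨i, hi, rfl⟩)

theorem partialAlgebra_mono {s t : Finset ι} (h : s ⊆ t) :
    partialAlgebra f z s ≤ partialAlgebra f z t :=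
  Algebra.adjoin_mono (Set.union_subset_union_right _ (Set.image_mono (by exact_mod_cast h)))

/-- The bracket with `zᵢ` is a derivation; on generators it maps `C` into `C` and kills every `zⱼ`.
-/
theorem bracket_mem (h : IsWeylPresentation f z x) (s : Finset ι) (i : ι) {r : S}
    (hr : r ∈ partialAlgebra f z s) : z i * r - r * z i ∈ partialAlgebra f z s := by
  induction hr using Algebra.adjoin_induction with
  | mem r hr =>
    rcases hr with ⟨c, rfl⟩ | ⟨j, _, rfl⟩
    · obtain ⟨d, hd⟩ := h.der i c
      rw [hd]
      exact map_mem s d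
    · rw [(h.comm i j).eq, sub_self]
      exact zero_mem _
  | algebraMap c =>
    rw [Algebra.commutes, sub_self]
    exact zero_mem _
  | add a b _ _ ha hb =>
    rw [mul_add, add_mul, add_sub_add_comm]
    exact add_mem ha hb
  | mul a b hma hmb ha hb =>
    have e : z i * (a * b) - a * b * z i = (z i * a - a * z i) * b + a * (z i * b - b * z i) := by
      noncomm_ring
    rw [e]
    exact add_mem (mul_mem ha hmb) (mul_mem hma hb)

theorem commute_of_notMem (h : IsWeylPresentation f z x) {s : Finset ι} {i : ι} (hi : i ∉ s) {r : S}
    (hr : r ∈ partialAlgebra f z s) : Commute (f (x i)) r := by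
  induction hr using Algebra.adjoin_induction with
  | mem r hr =>
    rcases hr with ⟨c, rfl⟩ | ⟨j, hj, rfl⟩
    · exact (Commute.all _ _).map f
    · refine (h.pair_ne j i ?_).symm
      rintro rfl
      exact hi hj
  | algebraMap c => exact (Algebra.commutes c _).symm
  | add a b _ _ ha hb => exact ha.add_right hb
  | mul a b _ _ ha hb => exact ha.mul_right hb

theorem eq_top_of_insert [DecidableEq ι] {s : Finset ι} {i : ι}
    (U : Subring (partialAlgebra f z (insert i s)))
    (hU : ∀ r : partialAlgebra f z s,
      Subalgebra.inclusion (partialAlgebra_mono (Finset.subset_insert i s)) r ∈ U)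
    (hz : (⟨z i, gen_mem (Finset.mem_insert_self i s)⟩ : partialAlgebra f z (insert i s)) ∈ U) :
    U = ⊤ := by
  rw [eq_top_iff]
  rintro ⟨t, ht⟩ -
  have key : ∃ ht, (⟨t, ht⟩ : partialAlgebra f z (insert i s)) ∈ U := by
    induction ht using Algebra.adjoin_induction with
    | mem r hr =>
      rcases hr with ⟨c, rfl⟩ | ⟨j, hj, rfl⟩
      · exact ⟨_, hU ⟨f c, map_mem s c⟩⟩
      · rcases Finset.mem_insert.1 hj with rfl | hj
        · exact ⟨_, hz⟩
        · exact ⟨_, hU ⟨z j, gen_mem hj⟩⟩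
    | algebraMap c => exact ⟨_, hU (algebraMap K _ c)⟩
    | add a b _ _ ha hb =>
      obtain ⟨_, ha⟩ := ha
      obtain ⟨_, hb⟩ := hb
      exact ⟨_, add_mem ha hb⟩
    | mul a b _ _ ha hb =>
      obtain ⟨_, ha⟩ := ha
      obtain ⟨_, hb⟩ := hb
      exact ⟨_, mul_mem ha hb⟩
  exact key.2

theorem surjective_empty : Function.Surjective
    ((f.codRestrict (partialAlgebra f z ∅) (map_mem ∅)) : C →+* partialAlgebra f z ∅) := by
  rintro ⟨t, ht⟩
  have h1 : partialAlgebra f z ∅ ≤ f.range := by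
    refine Algebra.adjoin_le ?_
    rintro _ (⟨c, rfl⟩ | ⟨j, hj, rfl⟩)
    · exact ⟨c, rfl⟩
    · simp at hj
  obtain ⟨c, hc⟩ := h1 ht
  exact ⟨c, Subtype.ext hc⟩

theorem partialAlgebra_univ (h : IsWeylPresentation f z x) [Fintype ι] :
    partialAlgebra f z Finset.univ = ⊤ := by
  rw [← h.gen, partialAlgebra, Finset.coe_univ, Set.image_univ]

/-- The `zᵢ` are adjoined one at a time. By `bracket_mem` each skew-commutes with the algebra built
so far, so the Hilbert basis theorem applies at each stage. -/
theorem isNoetherianRing (h : IsWeylPresentation f z x) [Finite ι] [IsNoetherianRing C] :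
    IsNoetherianRing S := by
  classical
  obtain ⟨_⟩ := nonempty_fintype ι
  have key : ∀ s : Finset ι, IsNoetherianRing (partialAlgebra f z s) := by
    intro s
    induction s using Finset.induction_on with
    | empty => exact isNoetherianRing_of_surjective _ _ _ surjective_empty
    | insert i s _ ih =>
      have hskew : SkewCommutes (Subalgebra.inclusion
          (partialAlgebra_mono (f := f) (z := z) (Finset.subset_insert i s))).toRingHom
          ⟨z i, gen_mem (Finset.mem_insert_self i s)⟩ := by
        refine ⟨fun r => ⟨r, ⟨_, h.bracket_mem s i r.2⟩, Subtype.ext ?_⟩,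
          fun r => ⟨r, -⟨_, h.bracket_mem s i r.2⟩, Subtype.ext ?_⟩⟩
        · simp
        · simp
      exact hskew.isNoetherianRing eq_top_of_insert
  have := key Finset.univ
  rw [h.partialAlgebra_univ] at this
  exact isNoetherianRing_of_ringEquiv _ (Subalgebra.topEquiv (R := K) (A := S)).toRingEquiv

/-- Same induction, with `xᵢ` as the element that detects degrees in `zᵢ`: it commutes with the
algebra built before `zᵢ` and satisfies `[zᵢ, xᵢ] = 1`. -/
theorem isDomain (h : IsWeylPresentation f z x) [Finite ι] [CharZero K] [IsDomain C]
    (hf : Function.Injective f) : IsDomain S := by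
  classical
  obtain ⟨_⟩ := nonempty_fintype ι
  have : Nontrivial S := hf.nontrivial
  have key : ∀ s : Finset ι, NoZeroDivisors (partialAlgebra f z s) := by
    intro s
    induction s using Finset.induction_on with
    | empty =>
      have e := RingEquiv.ofBijective
        ((f.codRestrict (partialAlgebra f z ∅) (map_mem ∅)) : C →+* partialAlgebra f z ∅)
        ⟨fun a b hab => hf (congrArg Subtype.val hab), surjective_empty⟩
      exact e.symm.injective.noZeroDivisors e.symm (map_zero _) (map_mul _)
    | insert i s hi ih =>
      have : IsDomain (partialAlgebra f z s) := NoZeroDivisors.to_isDomain _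
      have : CharZero (partialAlgebra f z s) :=
        charZero_of_injective_algebraMap (algebraMap K _).injective
      exact noZeroDivisors_of_commutator (f := (Subalgebra.inclusion
          (partialAlgebra_mono (f := f) (z := z) (Finset.subset_insert i s))).toRingHom)
          (z := ⟨z i, gen_mem (Finset.mem_insert_self i s)⟩) (x := ⟨f (x i), map_mem _ _⟩)
        (Subalgebra.inclusion_injective _) (fun r => ⟨⟨_, h.bracket_mem s i r.2⟩, rfl⟩)
        eq_top_of_insert (fun r => Subtype.ext (h.commute_of_notMem hi r.2))
        (Subtype.ext (h.pair_self i))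
  have := key Finset.univ
  rw [h.partialAlgebra_univ] at this
  have : NoZeroDivisors S := (Subalgebra.topEquiv (R := K) (A := S)).symm.injective.noZeroDivisors
    (Subalgebra.topEquiv (R := K) (A := S)).symm (map_zero _) (map_mul _)
  exact NoZeroDivisors.to_isDomain S

end IsWeylPresentation

end WeylPresentation

/-! ### Dual derivations of the fraction field -/

section DualDerivations

variable {K : Type*} [Field K] {A : Type*} [CommRing A] [Algebra K A] {L : Type*} [Field L]
  [Algebra K L] [Algebra A L] [IsScalarTower K A L]

/-- The elements `xᵢ ∈ A` and the `K`-derivations `dᵢ` of `L` form dual bases. -/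
structure IsDualDerivations {ι : Type*} (x : ι → A) (d : ι → Derivation K L L) : Prop where
  self : ∀ i, d i (algebraMap A L (x i)) = 1
  ne : ∀ i j, i ≠ j → d i (algebraMap A L (x j)) = 0
  comm : ∀ i j a, d i (d j a) = d j (d i a)
  ext : ∀ δ : Derivation K A L, (∀ j, δ (x j) = 0) → δ = 0

variable (K A L) in
-- The space Ω_{L/K} is finite-dimensional and spanned by the differentials of elements of `A`. The
-- `xᵢ` are chosen so that their differentials form a basis, and the `dᵢ` correspond to the dual
-- basis.
theorem exists_isDualDerivations [Algebra.FiniteType K A] [IsFractionRing A L] :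
    ∃ (n : ℕ) (x : Fin n → A) (d : Fin n → Derivation K L L), IsDualDerivations x d := by
  classical
  have hess : Algebra.EssFiniteType K L :=
    have : Algebra.EssFiniteType A L := .of_isLocalization L (nonZeroDivisors A)
    .comp K A L
  have hspan : ⊤ ≤ Submodule.span L (Set.range fun a : A =>
      KaehlerDifferential.D K L (algebraMap A L a)) := by
    have := KaehlerDifferential.span_range_map_derivation_of_isLocalization K A L
      (nonZeroDivisors A)
    rw [← this]
    refine Submodule.span_mono ?_
    rintro _ ⟨a, rfl⟩
    exact ⟨a, by simp⟩
  let b₀ := Module.Basis.ofSpan hspan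
  have : Finite _ := Module.Finite.finite_basis b₀
  let n := Module.finrank L (Ω[L⁄K])
  let b : Module.Basis (Fin n) L (Ω[L⁄K]) := b₀.reindex
    (Finite.equivFinOfCardEq (by rw [← Module.finrank_eq_nat_card_basis b₀]))
  have hb : ∀ i, ∃ a : A, KaehlerDifferential.D K L (algebraMap A L a) = b i := by
    intro i
    obtain ⟨a, ha⟩ := Module.Basis.ofSpan_subset hspan ⟨_, rfl⟩
    exact ⟨a, ha.trans (by simp only [b, Module.Basis.reindex_apply]; rfl)⟩
  choose x hx using hb
  let d : Fin n → Derivation K L L := fun i => (b.coord i).compDer (KaehlerDifferential.D K L)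
  have hd : ∀ i j, d i (algebraMap A L (x j)) = if i = j then 1 else 0 := by
    intro i j
    change b.coord i (KaehlerDifferential.D K L (algebraMap A L (x j))) = _
    rw [hx]
    simp [Finsupp.single_apply, eq_comm]
  have hext : ∀ δ : Derivation K L L, (∀ j, δ (algebraMap A L (x j)) = 0) → δ = 0 := by
    intro δ hδ
    have h1 : δ.liftKaehlerDifferential = 0 := b.ext fun i => by
      rw [← hx, Derivation.liftKaehlerDifferential_comp_D, hδ, LinearMap.zero_apply]
    rw [← Derivation.liftKaehlerDifferential_comp δ, h1]
    ext
    simp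
  refine ⟨n, x, d, fun i => by simp [hd], fun i j hij => by simp [hd, hij], fun i j a => ?_,
    fun δ hδ => ?_⟩
  · have h1 : ⁅d i, d j⁆ = 0 := by
      refine hext _ fun k => ?_
      rw [Derivation.commutator_apply, hd, hd]
      split_ifs <;> simp
    have h2 := congrArg (fun e : Derivation K L L => e a) h1
    simpa [Derivation.commutator_apply, sub_eq_zero] using h2
  -- A localization is formally étale, so Ω_{L/K} is the base change of Ω_{A/K}; derivations from
  -- `A` to `L` are thus linear forms on Ω_{L/K}, tested on the basis of the `d xᵢ`.
  · have : Algebra.FormallyEtale A L := Algebra.FormallyEtale.of_isLocalization (nonZeroDivisors A)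
    have hbc := KaehlerDifferential.isBaseChange_of_formallyEtale K A L
    have h1 : hbc.lift δ.liftKaehlerDifferential = 0 := b.ext fun i => by
      have h2 := hbc.lift_eq δ.liftKaehlerDifferential (KaehlerDifferential.D K A (x i))
      rw [KaehlerDifferential.map_D, hx, Derivation.liftKaehlerDifferential_comp_D, hδ] at h2
      rw [h2, LinearMap.zero_apply]
    ext a
    have h2 := hbc.lift_eq δ.liftKaehlerDifferential (KaehlerDifferential.D K A a)
    rw [h1, Derivation.liftKaehlerDifferential_comp_D] at h2
    simpa using h2.symm

end DualDerivations

/-! ### Differential operators with values in the fraction field -/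

section DiffHoms

section DerHom

variable {K : Type*} [Field K] {A : Type*} [CommRing A] [Algebra K A] {L : Type*} [Field L]
  [Algebra K L]

/-- The composition `θ ↦ dθ` with a derivation `d`, on `Hom_K(A, L)`. -/
def derHom (d : Derivation K L L) : Module.End K (A →ₗ[K] L) where
  toFun θ := d.toLinearMap ∘ₗ θ
  map_add' θ η := by
    ext
    simp
  map_smul' c θ := by
    ext
    simp

@[simp]
theorem derHom_apply (d : Derivation K L L) (θ : A →ₗ[K] L) (b : A) :
    derHom d θ b = d (θ b) := rfl

end DerHom

variable {K : Type*} [Field K] {A : Type*} [CommRing A] [Algebra K A] {L : Type*} [Field L]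
  [Algebra K L] [Algebra A L] [IsScalarTower K A L]

variable (K L) in
/-- The commutator `θ ↦ θ a - a θ` on `Hom_K(A, L)`. -/
def adHom (a : A) : Module.End K (A →ₗ[K] L) where
  toFun θ := θ ∘ₗ LinearMap.mulLeft K a - algebraMap A L a • θ
  map_add' θ η := by
    ext
    simp
    ring
  map_smul' c θ := by
    ext
    simp [Algebra.smul_def]
    ring

@[simp]
theorem adHom_apply (a b : A) (θ : A →ₗ[K] L) :
    adHom K L a θ b = θ (a * b) - algebraMap A L a * θ b := rfl

theorem adHom_comm (a b : A) : Commute (adHom K L a) (adHom K L b) := by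
  ext θ c
  simp only [Module.End.mul_apply, adHom_apply, mul_left_comm a b]
  ring

/-- The canonical commutation relation. With dual `xᵢ` and `dⱼ`, the operators `adHom K L (x i)`
behave as partial derivatives with respect to the symbols `dⱼ`. -/
theorem adHom_derHom (d : Derivation K L L) (a : A) (θ : A →ₗ[K] L) :
    adHom K L a (derHom d θ) = derHom d (adHom K L a θ) + d (algebraMap A L a) • θ := by
  ext b
  simp
  ring

/-- Differential operators of order at most `n` from `A` to `L`. -/
def IsDiffHom : ℕ → (A →ₗ[K] L) → Prop
  | 0, θ => ∀ a : A, adHom K L a θ = 0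
  | n + 1, θ => ∀ a : A, IsDiffHom n (adHom K L a θ)

namespace IsDiffHom

theorem zero (n : ℕ) : IsDiffHom n (0 : A →ₗ[K] L) := by
  induction n with
  | zero => exact fun a => map_zero _
  | succ n ih =>
    intro a
    rwa [map_zero]

theorem add {n : ℕ} {θ η : A →ₗ[K] L} (h₁ : IsDiffHom n θ) (h₂ : IsDiffHom n η) :
    IsDiffHom n (θ + η) := by
  induction n generalizing θ η with
  | zero =>
    intro a
    rw [map_add, h₁ a, h₂ a, add_zero]
  | succ n ih =>
    intro a
    rw [map_add]
    exact ih (h₁ a) (h₂ a)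

theorem smul {n : ℕ} {θ : A →ₗ[K] L} (h : IsDiffHom n θ) (c : L) : IsDiffHom n (c • θ) := by
  have key : ∀ (a : A) (η : A →ₗ[K] L), adHom K L a (c • η) = c • adHom K L a η := by
    intro a η
    ext b
    simp
    ring
  induction n generalizing θ with
  | zero =>
    intro a
    rw [key, h a, smul_zero]
  | succ n ih =>
    intro a
    rw [key]
    exact ih (h a)

theorem succ {n : ℕ} {θ : A →ₗ[K] L} (h : IsDiffHom n θ) : IsDiffHom (n + 1) θ := by
  induction n generalizing θ with
  | zero =>
    intro a
    rw [h a]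
    exact zero 0
  | succ n ih => exact fun a => ih (h a)

theorem mono {m n : ℕ} (hmn : m ≤ n) {θ : A →ₗ[K] L} (h : IsDiffHom m θ) : IsDiffHom n θ := by
  induction hmn with
  | refl => exact h
  | step _ ih => exact ih.succ

theorem derHom {n : ℕ} {θ : A →ₗ[K] L} (h : IsDiffHom n θ) (d : Derivation K L L) :
    IsDiffHom (n + 1) (derHom d θ) := by
  induction n generalizing θ with
  | zero =>
    intro a
    rw [adHom_derHom, h a, map_zero, zero_add]
    exact h.smul _
  | succ n ih =>
    intro a
    rw [adHom_derHom]
    exact (ih (h a)).add (h.smul _)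

theorem adHom {n : ℕ} {θ : A →ₗ[K] L} (h : IsDiffHom n θ) (a : A) :
    IsDiffHom n (adHom K L a θ) := by
  cases n with
  | zero =>
    rw [h a]
    exact zero 0
  | succ n => exact (h a).succ

theorem adHom_pow_eq_zero {n : ℕ} {θ : A →ₗ[K] L} (h : IsDiffHom n θ) (a : A) :
    (_root_.adHom K L a ^ (n + 1)) θ = 0 := by
  induction n generalizing θ with
  | zero => simpa using h a
  | succ n ih =>
    rw [pow_succ, Module.End.mul_apply]
    exact ih (h a)

/-- By induction on the order, applied to all commutators of `θ`, double commutators vanish, that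
is, `θ` has order at most one. Then `a ↦ θ a - a θ(1)` is a derivation from `A` to `L` vanishing at
all `xᵢ`, hence zero. -/
theorem eq_smul_of_adHom_eq_zero {ι : Type*} {x : ι → A} {d : ι → Derivation K L L}
    (hxd : IsDualDerivations x d) {n : ℕ} {θ : A →ₗ[K] L} (h : IsDiffHom n θ)
    (h0 : ∀ i, _root_.adHom K L (x i) θ = 0) (a : A) : θ a = algebraMap A L a * θ 1 := by
  have key : ∀ a, _root_.adHom K L a θ = 0 := by
    induction n generalizing θ with
    | zero => exact h
    | succ n ih =>
      have h1 : ∀ a b, _root_.adHom K L b (_root_.adHom K L a θ) = 0 := fun a b =>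
        ih (h a) (fun i => by
          rw [← Module.End.mul_apply, (adHom_comm _ _).eq, Module.End.mul_apply, h0, map_zero]) b
      have h2 : ∀ a b, θ (a * b) =
          algebraMap A L a * θ b + algebraMap A L b * (θ a - algebraMap A L a * θ 1) := by
        intro a b
        have := congrArg (fun η : A →ₗ[K] L => η 1) (h1 a b)
        simp only [adHom_apply, LinearMap.zero_apply, mul_one, sub_eq_zero] at this
        rw [← this]
        ring
      let δ : Derivation K A L := Derivation.mk'
        (θ - (LinearMap.mulRight K (θ 1)) ∘ₗ (IsScalarTower.toAlgHom K A L).toLinearMap) (by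
          intro a b
          simp [h2, Algebra.smul_def]
          ring)
      have hδ : δ = 0 := hxd.ext δ fun j => by
        have := congrArg (fun η : A →ₗ[K] L => η 1) (h0 j)
        simpa [δ] using this
      have h3 : ∀ a, θ a = algebraMap A L a * θ 1 := by
        intro a
        have := congrArg (fun η : Derivation K A L => η a) hδ
        simpa [δ, sub_eq_zero] using this
      intro a
      ext b
      rw [adHom_apply, h3 (a * b), h3 b, map_mul, LinearMap.zero_apply]
      ring
  have := congrArg (fun η : A →ₗ[K] L => η 1) (key a)
  simpa [sub_eq_zero] using this

end IsDiffHom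

theorem IsDiffOp.isDiffHom {n : ℕ} {θ : Module.End K A} (h : IsDiffOp K n θ) :
    IsDiffHom n ((IsScalarTower.toAlgHom K A L).toLinearMap ∘ₗ θ) := by
  have key : ∀ (η : Module.End K A) (a : A),
      adHom K L a ((IsScalarTower.toAlgHom K A L).toLinearMap ∘ₗ η) =
        (IsScalarTower.toAlgHom K A L).toLinearMap ∘ₗ
          (η * LinearMap.mulLeft K a - LinearMap.mulLeft K a * η) := by
    intro η a
    ext b
    simp
  induction n generalizing θ with
  | zero =>
    intro a
    rw [key, show _ = _ from h a, LinearMap.comp_zero]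
  | succ n ih =>
    intro a
    rw [key]
    exact ih (h a)

/-- The Weyl-algebra version of the fact that the n-th derivative of tⁿ is n!. It provides the
antiderivatives in `IsDiffHom.exists_mem_derivationAlgebra`. -/
theorem pow_mul_pow_apply_of_commutator {M : Type*} [AddCommGroup M] [Module K M]
    {a d : Module.End K M} (h : a * d = d * a + 1) {c : M} (hc : a c = 0) (n : ℕ) :
    (a ^ n) ((d ^ n) c) = n.factorial • c := by
  have h1 : ∀ n : ℕ, a ((d ^ (n + 1)) c) = (n + 1) • (d ^ n) c := by
    intro n
    induction n with
    | zero =>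
      have := congrArg (fun e : Module.End K M => e c) h
      simpa [hc] using this
    | succ n ih =>
      have := congrArg (fun e : Module.End K M => e ((d ^ (n + 1)) c)) h
      simp only [Module.End.mul_apply, LinearMap.add_apply, Module.End.one_apply, ih] at this
      rw [pow_succ' d, Module.End.mul_apply, this, map_nsmul, ← Module.End.mul_apply, ← pow_succ',
        ← succ_nsmul]
  induction n with
  | zero => simp
  | succ n ih =>
    rw [pow_succ, Module.End.mul_apply, h1, map_nsmul, ih, Nat.factorial_succ, mul_smul]

/-- The algebra of differential operators on `L` generated by `L` and the `dᵢ`. -/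
def derivationAlgebra {ι : Type*} (d : ι → Derivation K L L) : Subalgebra K (Module.End K L) :=
  Algebra.adjoin K (Set.range (Algebra.lmul K L) ∪ Set.range fun i => (d i).toLinearMap)

end DiffHoms

/-! ### Comparison of differential operators on A with the algebra generated by L and the dual
derivations -/

section DerivationAlgebra

variable {K : Type*} [Field K] {A : Type*} [CommRing A] [Algebra K A] {L : Type*} [Field L]
  [Algebra K L] [Algebra A L] [IsScalarTower K A L] {ι : Type*} {x : ι → A}
  {d : ι → Derivation K L L}

theorem lmul_mem_derivationAlgebra (l : L) : Algebra.lmul K L l ∈ derivationAlgebra d :=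
  Algebra.subset_adjoin (Or.inl ⟨l, rfl⟩)

theorem derivation_mem_derivationAlgebra (i : ι) : (d i).toLinearMap ∈ derivationAlgebra d :=
  Algebra.subset_adjoin (Or.inr ⟨i, rfl⟩)

theorem isWeylPresentation_derivationAlgebra (h : IsDualDerivations x d) :
    IsWeylPresentation (S := derivationAlgebra d)
      ((Algebra.lmul K L).codRestrict (derivationAlgebra d) lmul_mem_derivationAlgebra)
      (fun i => ⟨(d i).toLinearMap, derivation_mem_derivationAlgebra i⟩)
      (fun i => algebraMap A L (x i)) where
  comm i j := by
    apply Subtype.ext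
    ext a
    exact h.comm i j a
  der i c := by
    refine ⟨d i c, ?_⟩
    apply Subtype.ext
    ext a
    simp [mul_comm]
  pair_self i := by
    apply Subtype.ext
    ext a
    simp [h.self]
  pair_ne i j hij := by
    apply Subtype.ext
    ext a
    simp [h.ne i j hij]
  gen := by
    refine top_le_iff.1 ((Algebra.adjoin_adjoin_coe_preimage (R := K) (s := Set.range
      (Algebra.lmul K L) ∪ Set.range fun i => (d i).toLinearMap)).ge.trans
        (Algebra.adjoin_mono ?_))
    rintro ⟨w, hw⟩ (⟨c, hc⟩ | ⟨i, hi⟩)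
    · exact Or.inl ⟨c, Subtype.ext hc⟩
    · exact Or.inr ⟨i, Subtype.ext hi⟩

/-- Integration with respect to the symbols `dᵢ`. The outer induction is on the set of indices `i`
for which the commutator with `xᵢ` may be nonzero, the inner one on the nilpotency exponent of a
single such commutator; when all of them vanish the operator is multiplication by an element of `L`.
-/
theorem IsDiffHom.exists_mem_derivationAlgebra [CharZero K] [Finite ι] (h : IsDualDerivations x d)
    {n : ℕ} {θ : A →ₗ[K] L} (hθ : IsDiffHom n θ) :
    ∃ w ∈ derivationAlgebra d, θ = w ∘ₗ (IsScalarTower.toAlgHom K A L).toLinearMap := by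
  classical
  obtain ⟨_⟩ := nonempty_fintype ι
  let V : Submodule K (A →ₗ[K] L) := (Subalgebra.toSubmodule (derivationAlgebra d)).map
    (LinearMap.lcomp K L (IsScalarTower.toAlgHom K A L).toLinearMap)
  have hder : ∀ i, ∀ η ∈ V, _root_.derHom (d i) η ∈ V := by
    rintro i _ ⟨w, hw, rfl⟩
    exact ⟨(d i).toLinearMap * w,
      (derivationAlgebra d).mul_mem (derivation_mem_derivationAlgebra i) hw, rfl⟩
  have hderpow : ∀ i (j : ℕ), ∀ η ∈ V, (_root_.derHom (d i) ^ j) η ∈ V := by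
    intro i j η hη
    induction j with
    | zero => exact hη
    | succ j ih =>
      rw [pow_succ', Module.End.mul_apply]
      exact hder i _ ih
  have hcomm : ∀ i k, i ≠ k → Commute (_root_.adHom K L (x i)) (_root_.derHom (d k)) := by
    intro i k hik
    refine LinearMap.ext fun η => ?_
    simp [adHom_derHom, h.ne k i hik.symm]
  have hcomm' : ∀ k, _root_.adHom K L (x k) * _root_.derHom (d k) =
      _root_.derHom (d k) * _root_.adHom K L (x k) + 1 := by
    intro k
    refine LinearMap.ext fun η => ?_
    simp [adHom_derHom, h.self]
  have hderdiff : ∀ i (j : ℕ), ∀ η : A →ₗ[K] L, (∃ n, IsDiffHom n η) →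
      ∃ n, IsDiffHom n ((_root_.derHom (d i) ^ j) η) := by
    intro i j η hη
    induction j with
    | zero => exact hη
    | succ j ih =>
      obtain ⟨n, hn⟩ := ih
      rw [pow_succ', Module.End.mul_apply]
      exact ⟨_, hn.derHom _⟩
  have haddiff : ∀ (a : A) (j : ℕ) (n : ℕ), ∀ η : A →ₗ[K] L, IsDiffHom n η →
      IsDiffHom n ((_root_.adHom K L a ^ j) η) := by
    intro a j n η hη
    induction j with
    | zero => exact hη
    | succ j ih =>
      rw [pow_succ', Module.End.mul_apply]
      exact ih.adHom a
  have key : ∀ s : Finset ι, ∀ η : A →ₗ[K] L, (∃ n, IsDiffHom n η) →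
      (∀ i, i ∉ s → _root_.adHom K L (x i) η = 0) → η ∈ V := by
    intro s
    induction s using Finset.induction_on with
    | empty =>
      rintro η ⟨n, hn⟩ h0
      refine ⟨Algebra.lmul K L (η 1), lmul_mem_derivationAlgebra _, ?_⟩
      ext a
      rw [hn.eq_smul_of_adHom_eq_zero h (fun i => h0 i (Finset.notMem_empty i)) a]
      simp [mul_comm]
    | insert k s hk ih =>
      have inner : ∀ j : ℕ, ∀ η : A →ₗ[K] L, (∃ n, IsDiffHom n η) →
          (∀ i, i ∉ insert k s → _root_.adHom K L (x i) η = 0) →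
          (_root_.adHom K L (x k) ^ j) η = 0 → η ∈ V := by
        intro j
        induction j with
        | zero =>
          intro η _ _ h0
          have : η = 0 := h0
          rw [this]
          exact zero_mem _
        | succ j ihj =>
          rintro η ⟨n, hn⟩ hη h0
          set c := (_root_.adHom K L (x k) ^ j) η with hc
          have hck : _root_.adHom K L (x k) c = 0 := by
            rwa [pow_succ', Module.End.mul_apply] at h0
          have hci : ∀ i, i ∉ insert k s → _root_.adHom K L (x i) c = 0 := by
            intro i hi
            rw [hc, ← Module.End.mul_apply, ((adHom_comm _ _).pow_right j).eq,
              Module.End.mul_apply, hη i hi, map_zero]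
          have hcn : IsDiffHom n c := haddiff _ _ _ _ hn
          have hcV : c ∈ V := by
            refine ih c ⟨n, hcn⟩ fun i hi => ?_
            by_cases hik : i = k
            · rw [hik, hck]
            · exact hci i (by simp [hik, hi])
          -- A j-fold antiderivative of `c`: it has the same j-th commutator with `x k` as `η`, so
          -- `η - q` has a smaller nilpotency exponent. Division by `j!` is where characteristic
          -- zero enters.
          let q : A →ₗ[K] L := (j.factorial : K)⁻¹ • (_root_.derHom (d k) ^ j) c
          have hqV : q ∈ V := V.smul_mem _ (hderpow k j c hcV)
          have hsub : η - q ∈ V := by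
            refine ihj _ ?_ ?_ ?_
            · obtain ⟨m, hm⟩ := hderdiff k j c ⟨n, hcn⟩
              refine ⟨max n m, ?_⟩
              have hq : IsDiffHom m ((-algebraMap K L (j.factorial : K)⁻¹) •
                  (_root_.derHom (d k) ^ j) c) := hm.smul _
              have e : η - q = η + (-algebraMap K L (j.factorial : K)⁻¹) •
                  (_root_.derHom (d k) ^ j) c := by
                ext b
                simp [q, Algebra.smul_def]
                ring
              rw [e]
              exact (hn.mono (le_max_left _ _)).add (hq.mono (le_max_right _ _))
            · intro i hi
              have hik : i ≠ k := fun e => hi (by simp [e])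
              rw [map_sub, hη i hi, map_smul, ← Module.End.mul_apply,
                ((hcomm i k hik).pow_right j).eq, Module.End.mul_apply, hci i hi, map_zero,
                smul_zero, sub_zero]
            · rw [map_sub, map_smul, pow_mul_pow_apply_of_commutator (hcomm' k) hck, ← hc,
                ← Nat.cast_smul_eq_nsmul K, inv_smul_smul₀, sub_self]
              exact_mod_cast j.factorial_ne_zero
          simpa using add_mem hsub hqV
      rintro η ⟨n, hn⟩ h0
      exact inner (n + 1) η ⟨n, hn⟩ h0 (hn.adHom_pow_eq_zero _)
  obtain ⟨w, hw, hwθ⟩ := key Finset.univ θ ⟨n, hθ⟩ fun i hi => absurd (Finset.mem_univ i) hi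
  exact ⟨w, hw, hwθ.symm⟩

theorem derivationAlgebra_le_diffOps : derivationAlgebra d ≤ DiffOps K L := by
  refine Algebra.adjoin_le ?_
  rintro _ (⟨c, rfl⟩ | ⟨i, rfl⟩)
  · refine ⟨0, fun a => ?_⟩
    ext b
    simp [mul_left_comm]
  · refine ⟨1, fun a b => ?_⟩
    ext c
    simp
    ring

/-- The commutator with an element `s` of `A` has lower order and still vanishes on `A`, so it is
zero by induction. Hence `s · w(a / s) = w(a) = 0`. This gives the uniqueness of extensions from `A`
to `L`. -/
theorem IsDiffOp.eq_zero_of_comp_eq_zero [IsFractionRing A L] {n : ℕ} {w : Module.End K L}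
    (hw : IsDiffOp K n w) (h0 : ∀ a : A, w (algebraMap A L a) = 0) : w = 0 := by
  have hfin : ∀ w : Module.End K L, (∀ a : A, w (algebraMap A L a) = 0) →
      (∀ s : A, w * LinearMap.mulLeft K (algebraMap A L s) -
        LinearMap.mulLeft K (algebraMap A L s) * w = 0) → w = 0 := by
    intro w h0 hw
    ext l
    obtain ⟨a, s, hs, rfl⟩ := IsFractionRing.div_surjective (A := A) l
    have hs0 : algebraMap A L s ≠ 0 := (IsLocalization.map_units L ⟨s, hs⟩).ne_zero
    have h1 := congrArg (fun e : Module.End K L => e (algebraMap A L a / algebraMap A L s)) (hw s)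
    simp only [LinearMap.sub_apply, Module.End.mul_apply, LinearMap.mulLeft_apply,
      mul_div_cancel₀ _ hs0, h0, LinearMap.zero_apply, zero_sub, neg_eq_zero, mul_eq_zero, hs0,
      false_or] at h1
    simpa using h1
  induction n generalizing w with
  | zero => exact hfin w h0 fun s => hw _
  | succ n ih =>
    refine hfin w h0 fun s => ih (hw _) fun a => ?_
    simp only [LinearMap.sub_apply, Module.End.mul_apply, LinearMap.mulLeft_apply, h0, mul_zero,
      sub_zero]
    rw [← map_mul, h0]

theorem eq_of_comp_eq [IsFractionRing A L] {v w : Module.End K L} (hv : v ∈ derivationAlgebra d)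
    (hw : w ∈ derivationAlgebra d) (h : ∀ a : A, v (algebraMap A L a) = w (algebraMap A L a)) :
    v = w := by
  obtain ⟨n, hn⟩ := derivationAlgebra_le_diffOps (sub_mem hv hw)
  exact sub_eq_zero.1 (hn.eq_zero_of_comp_eq_zero (A := A) fun a => by
    rw [LinearMap.sub_apply, h, sub_self])

/-- A differential operator on `A` extends uniquely to the fraction field. -/
theorem exists_diffOps_algHom [CharZero K] [Finite ι] [IsFractionRing A L]
    (h : IsDualDerivations x d) : ∃ φ : DiffOps K A →ₐ[K] derivationAlgebra d,
      ∀ (P : DiffOps K A) (a : A),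
        (φ P : Module.End K L) (algebraMap A L a) = algebraMap A L ((P : Module.End K A) a) := by
  have hex : ∀ P : DiffOps K A, ∃ w : derivationAlgebra d, ∀ a : A,
      (w : Module.End K L) (algebraMap A L a) = algebraMap A L ((P : Module.End K A) a) := by
    rintro ⟨P, n, hn⟩
    obtain ⟨w, hw, hwP⟩ := (hn.isDiffHom (L := L)).exists_mem_derivationAlgebra h
    refine ⟨⟨w, hw⟩, fun a => ?_⟩
    have := congrArg (fun e : A →ₗ[K] L => e a) hwP
    simpa using this.symm
  choose φ hφ using hex
  have huniq : ∀ v w : derivationAlgebra d, (∀ a : A, (v : Module.End K L) (algebraMap A L a) =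
      (w : Module.End K L) (algebraMap A L a)) → v = w := fun v w hvw =>
    Subtype.ext (eq_of_comp_eq v.2 w.2 hvw)
  refine ⟨AlgHom.ofLinearMap ⟨⟨φ, fun P Q => huniq _ _ fun a => ?_⟩,
    fun c P => huniq _ _ fun a => ?_⟩ (huniq _ _ fun a => ?_) fun P Q => huniq _ _ fun a => ?_, hφ⟩
  · simp [hφ]
  · simp only [hφ, Subalgebra.coe_smul, LinearMap.smul_apply, RingHom.id_apply]
    rw [Algebra.smul_def, Algebra.smul_def, map_mul, ← IsScalarTower.algebraMap_apply]
  · change (φ 1 : Module.End K L) (algebraMap A L a) = _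
    simp [hφ]
  · change (φ (P * Q) : Module.End K L) (algebraMap A L a) = (φ P : Module.End K L)
      ((φ Q : Module.End K L) (algebraMap A L a))
    simp [hφ]

theorem Derivation.toLinearMap_mem_diffOps (δ : Derivation K A A) :
    (δ : A →ₗ[K] A) ∈ DiffOps K A := by
  refine ⟨1, fun a b => ?_⟩
  ext c
  simp
  ring

theorem mulLeft_mem_diffOps (a : A) : LinearMap.mulLeft K a ∈ DiffOps K A := by
  refine ⟨0, fun b => ?_⟩
  ext c
  simp [mul_left_comm]

/-- A multiple of a derivation of the fraction field of an affine domain restricts to a derivation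
of the domain. -/
theorem exists_multiple_derivation [IsDomain A] [IsFractionRing A L] [Algebra.FiniteType K A]
    (δ : Derivation K L L) : ∃ f : A, f ≠ 0 ∧ ∃ η : Derivation K A A, ∀ a,
      algebraMap A L (η a) = algebraMap A L f * δ (algebraMap A L a) := by
  classical
  obtain ⟨s, hs⟩ := Algebra.FiniteType.out (R := K) (A := A)
  obtain ⟨f, hf⟩ := IsLocalization.exist_integer_multiples_of_finset (nonZeroDivisors A)
    (s.image fun a => δ (algebraMap A L a))
  have hinj := IsFractionRing.injective A L
  have hall : ∀ a : A, ∃ b : A, algebraMap A L b = algebraMap A L f * δ (algebraMap A L a) := by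
    intro a
    have ha : a ∈ Algebra.adjoin K (s : Set A) := hs ▸ Algebra.mem_top
    induction ha using Algebra.adjoin_induction with
    | mem a ha =>
      obtain ⟨b, hb⟩ := hf _ (Finset.mem_image_of_mem _ ha)
      exact ⟨b, by rw [hb, Algebra.smul_def]⟩
    | algebraMap c =>
      exact ⟨0, by rw [← IsScalarTower.algebraMap_apply, Derivation.map_algebraMap]; simp⟩
    | add a b _ _ ha hb =>
      obtain ⟨a', ha'⟩ := ha
      obtain ⟨b', hb'⟩ := hb
      exact ⟨a' + b', by rw [map_add, ha', hb', map_add, map_add, mul_add]⟩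
    | mul a b _ _ ha hb =>
      obtain ⟨a', ha'⟩ := ha
      obtain ⟨b', hb'⟩ := hb
      refine ⟨a * b' + b * a', ?_⟩
      rw [map_add, map_mul, map_mul, ha', hb', map_mul, Derivation.leibniz, smul_eq_mul,
        smul_eq_mul]
      ring
  choose η hη using hall
  have hsmul : ∀ (c : K) (a : A), algebraMap A L (c • a) = c • algebraMap A L a :=
    map_smul (IsScalarTower.toAlgHom K A L)
  refine ⟨f, nonZeroDivisors.ne_zero f.2, Derivation.mk' ⟨⟨η, fun a b => hinj ?_⟩,
    fun c a => IsFractionRing.injective A L ?_⟩ fun a b => IsFractionRing.injective A L ?_, hη⟩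
  · rw [hη, map_add, map_add, map_add, hη, hη, mul_add]
  · change algebraMap A L (η (c • a)) = algebraMap A L (c • η a)
    rw [hη, hsmul, hsmul, Derivation.map_smul, hη, mul_smul_comm]
  · change algebraMap A L (η (a * b)) = algebraMap A L (a * η b + b * η a)
    rw [hη, map_add, RingHom.map_mul, RingHom.map_mul, RingHom.map_mul, hη, hη,
      Derivation.leibniz, smul_eq_mul, smul_eq_mul]
    ring

/-- The set `Z` of operators admitting a left denominator is stable under left multiplication by the
generators of the algebra, and it contains `1`. -/
theorem exists_left_denominator [IsDomain A] [IsFractionRing A L] [Algebra.FiniteType K A]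
    {w : Module.End K L} (hw : w ∈ derivationAlgebra d) : ∃ a : A, a ≠ 0 ∧ ∃ P ∈ DiffOps K A,
      ∀ b, algebraMap A L a * w (algebraMap A L b) = algebraMap A L (P b) := by
  let Z : Set (Module.End K L) := {w | ∃ a : A, a ≠ 0 ∧ ∃ P ∈ DiffOps K A,
      ∀ b, algebraMap A L a * w (algebraMap A L b) = algebraMap A L (P b)}
  have hadd : ∀ v ∈ Z, ∀ w ∈ Z, v + w ∈ Z := by
    rintro v ⟨a, ha, P, hP, hv⟩ w ⟨a', ha', P', hP', hw⟩
    refine ⟨a * a', mul_ne_zero ha ha', LinearMap.mulLeft K a' * P + LinearMap.mulLeft K a * P',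
      add_mem (mul_mem (mulLeft_mem_diffOps _) hP) (mul_mem (mulLeft_mem_diffOps _) hP'),
      fun b => ?_⟩
    simp only [LinearMap.add_apply, Module.End.mul_apply, LinearMap.mulLeft_apply, map_add,
      map_mul, ← hv, ← hw]
    ring
  have hsmul : ∀ c : K, ∀ v ∈ Z, c • v ∈ Z := by
    rintro c v ⟨a, ha, P, hP, hv⟩
    refine ⟨a, ha, c • P, Subalgebra.smul_mem _ hP c, fun b => ?_⟩
    rw [LinearMap.smul_apply, mul_smul_comm, hv, LinearMap.smul_apply, Algebra.smul_def,
      Algebra.smul_def, map_mul, ← IsScalarTower.algebraMap_apply]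
  have hle : derivationAlgebra d ≤
      { carrier := {w | ∀ z ∈ Z, w * z ∈ Z}
        mul_mem' := fun {v w} hv hw z hz => by
          rw [mul_assoc]
          exact hv _ (hw z hz)
        add_mem' := fun {v w} hv hw z hz => by
          rw [add_mul]
          exact hadd _ (hv z hz) _ (hw z hz)
        algebraMap_mem' := fun c z hz => by
          rw [← Algebra.smul_def]
          exact hsmul c z hz : Subalgebra K (Module.End K L) } := by
    refine Algebra.adjoin_le ?_
    rintro _ (⟨l, rfl⟩ | ⟨i, rfl⟩) z ⟨a, ha, P, hP, hz⟩
    · obtain ⟨p, q, hq, rfl⟩ := IsFractionRing.div_surjective (A := A) l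
      have hq0 : algebraMap A L q ≠ 0 := by simpa using nonZeroDivisors.ne_zero hq
      refine ⟨q * a, mul_ne_zero (nonZeroDivisors.ne_zero hq) ha, LinearMap.mulLeft K p * P,
        mul_mem (mulLeft_mem_diffOps _) hP, fun b => ?_⟩
      simp only [Module.End.mul_apply, Algebra.coe_lmul_eq_mul, LinearMap.mul_apply',
        LinearMap.mulLeft_apply, map_mul, ← hz]
      field_simp
    · obtain ⟨f, hf, η, hη⟩ := exists_multiple_derivation (A := A) (d i)
      -- With `a z = P` and `f dᵢ = η` on `A`, apply `dᵢ` to `a z(b) = P(b)` and multiply by `f a`.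
      -- The result is `f a² dᵢ(z(b)) = a η(P(b)) - η(a) P(b)`.
      refine ⟨f * a * a, mul_ne_zero (mul_ne_zero hf ha) ha, LinearMap.mulLeft K a * (η * P) -
        LinearMap.mulLeft K (η a) * P, sub_mem (mul_mem (mulLeft_mem_diffOps _)
          (mul_mem η.toLinearMap_mem_diffOps hP)) (mul_mem (mulLeft_mem_diffOps _) hP),
        fun b => ?_⟩
      have h1 := congrArg (d i) (hz b)
      rw [Derivation.leibniz, smul_eq_mul, smul_eq_mul] at h1
      simp only [Module.End.mul_apply, LinearMap.sub_apply, LinearMap.mulLeft_apply,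
        Derivation.coeFn_coe, map_sub, map_mul, hη]
      rw [← h1, ← hz]
      ring
  have h1 : (1 : Module.End K L) ∈ Z := ⟨1, one_ne_zero, 1, one_mem _, by simp⟩
  have h2 : w * 1 ∈ Z := hle hw 1 h1
  rwa [mul_one] at h2

/-- Mirror image of the left case: operators admitting a right denominator are stable under right
multiplication by the generators. -/
theorem exists_right_denominator [IsDomain A] [IsFractionRing A L] [Algebra.FiniteType K A]
    {w : Module.End K L} (hw : w ∈ derivationAlgebra d) : ∃ a : A, a ≠ 0 ∧ ∃ P ∈ DiffOps K A,
      ∀ b, w (algebraMap A L (a * b)) = algebraMap A L (P b) := by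
  let Z : Set (Module.End K L) := {w | ∃ a : A, a ≠ 0 ∧ ∃ P ∈ DiffOps K A,
      ∀ b, w (algebraMap A L (a * b)) = algebraMap A L (P b)}
  have hadd : ∀ v ∈ Z, ∀ w ∈ Z, v + w ∈ Z := by
    rintro v ⟨a, ha, P, hP, hv⟩ w ⟨a', ha', P', hP', hw⟩
    refine ⟨a * a', mul_ne_zero ha ha', P * LinearMap.mulLeft K a' + P' * LinearMap.mulLeft K a,
      add_mem (mul_mem hP (mulLeft_mem_diffOps _)) (mul_mem hP' (mulLeft_mem_diffOps _)),
      fun b => ?_⟩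
    simp only [LinearMap.add_apply, Module.End.mul_apply, LinearMap.mulLeft_apply, map_add,
      ← hv, ← hw, mul_assoc, mul_left_comm a']
  have hsmul : ∀ c : K, ∀ v ∈ Z, c • v ∈ Z := by
    rintro c v ⟨a, ha, P, hP, hv⟩
    refine ⟨a, ha, c • P, Subalgebra.smul_mem _ hP c, fun b => ?_⟩
    rw [LinearMap.smul_apply, hv, LinearMap.smul_apply, Algebra.smul_def,
      Algebra.smul_def, map_mul, ← IsScalarTower.algebraMap_apply]
  have hle : derivationAlgebra d ≤
      { carrier := {w | ∀ z ∈ Z, z * w ∈ Z}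
        mul_mem' := fun {v w} hv hw z hz => by
          rw [← mul_assoc]
          exact hw _ (hv z hz)
        add_mem' := fun {v w} hv hw z hz => by
          rw [mul_add]
          exact hadd _ (hv z hz) _ (hw z hz)
        algebraMap_mem' := fun c z hz => by
          rw [← Algebra.commutes, ← Algebra.smul_def]
          exact hsmul c z hz : Subalgebra K (Module.End K L) } := by
    refine Algebra.adjoin_le ?_
    rintro _ (⟨l, rfl⟩ | ⟨i, rfl⟩) z ⟨a, ha, P, hP, hz⟩
    · obtain ⟨p, q, hq, rfl⟩ := IsFractionRing.div_surjective (A := A) l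
      have hq0 : algebraMap A L q ≠ 0 := by simpa using nonZeroDivisors.ne_zero hq
      refine ⟨q * a, mul_ne_zero (nonZeroDivisors.ne_zero hq) ha, P * LinearMap.mulLeft K p,
        mul_mem hP (mulLeft_mem_diffOps _), fun b => ?_⟩
      simp only [Module.End.mul_apply, Algebra.coe_lmul_eq_mul, LinearMap.mul_apply',
        LinearMap.mulLeft_apply, ← hz]
      congr 1
      simp only [map_mul]
      field_simp
    · obtain ⟨f, hf, η, hη⟩ := exists_multiple_derivation (A := A) (d i)
      -- Squaring `f a` ensures that `dᵢ((f a)² b)` is `a` times an element of `A`, namely `a (f a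
      -- η(b) + 2 η(f a) b)`; then `z` composed with `a` may be replaced by `P`.
      refine ⟨f * a * (f * a), mul_ne_zero (mul_ne_zero hf ha) (mul_ne_zero hf ha),
        P * (LinearMap.mulLeft K (f * a) * η + LinearMap.mulLeft K (2 * a * η f + 2 * f * η a)),
        mul_mem hP (add_mem (mul_mem (mulLeft_mem_diffOps _) η.toLinearMap_mem_diffOps)
          (mulLeft_mem_diffOps _)), fun b => ?_⟩
      simp only [Module.End.mul_apply, LinearMap.add_apply, LinearMap.mulLeft_apply,
        Derivation.coeFn_coe, ← hz]
      congr 1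
      simp only [map_mul, map_add, hη, Derivation.leibniz, smul_eq_mul, map_ofNat]
      ring
  have h1 : (1 : Module.End K L) ∈ Z := ⟨1, one_ne_zero, 1, one_mem _, by simp⟩
  have h2 : 1 * w ∈ Z := hle hw 1 h1
  rwa [one_mul] at h2

end DerivationAlgebra

/-! ### The quotient division algebra of the algebra of differential operators -/

section TensorDomain

variable {k : Type*} [Field k] {A : Type*} [CommRing A] [IsDomain A] [Algebra k A]
  [Algebra.FiniteType k A]

/-- Nullstellensatz: residue fields at maximal ideals are finite over `k` and embed in the algebraic
closure, so `a` lies in every maximal ideal. In a Jacobson domain the intersection of these is zero.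
-/
theorem eq_zero_of_forall_algHom_algebraicClosure {a : A}
    (ha : ∀ φ : A →ₐ[k] AlgebraicClosure k, φ a = 0) : a = 0 := by
  have hJ : IsJacobsonRing A := isJacobsonRing_of_finiteType (A := k)
  have h0 : a ∈ (⊥ : Ideal A).jacobson := by
    rw [Ideal.jacobson, Ideal.mem_sInf]
    rintro m ⟨-, hm⟩
    let _ : Field (A ⧸ m) := Ideal.Quotient.field m
    have : Module.Finite k (A ⧸ m) := finite_of_finite_type_of_isJacobsonRing k (A ⧸ m)
    have h1 := ha ((IsAlgClosed.lift : (A ⧸ m) →ₐ[k] AlgebraicClosure k).comp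
      (Ideal.Quotient.mkₐ k m))
    rw [AlgHom.comp_apply, map_eq_zero] at h1
    exact Ideal.Quotient.eq_zero_iff_mem.1 h1
  rw [← Ideal.radical_eq_jacobson, Ideal.mem_radical_iff] at h0
  obtain ⟨n, hn⟩ := h0
  exact eq_zero_of_pow_eq_zero hn

/-- The tensor product of an affine domain and a geometrically integral algebra is a domain. -/
theorem noZeroDivisors_tensorProduct {B : Type*} [CommRing B] [Algebra k B]
    [IsDomain (AlgebraicClosure k ⊗[k] B)] : NoZeroDivisors (A ⊗[k] B) := by
  let b := Module.Basis.ofVectorSpace k B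
  let e := Algebra.TensorProduct.basis A b
  let e' := Algebra.TensorProduct.basis (AlgebraicClosure k) b
  have hev : ∀ (φ : A →ₐ[k] AlgebraicClosure k) (u : A ⊗[k] B) i,
      e'.repr (Algebra.TensorProduct.map φ (AlgHom.id k B) u) i = φ (e.repr u i) := by
    intro φ u i
    induction u with
    | zero => simp
    | add x y hx hy => simp only [map_add, Finsupp.add_apply, hx, hy]
    | tmul x y => simp [e, e', Algebra.TensorProduct.basis_repr_tmul]
  refine ⟨fun {u v} huv => ?_⟩
  by_contra! hne
  obtain ⟨i, hi⟩ : ∃ i, e.repr u i ≠ 0 := by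
    by_contra! h
    exact hne.1 (e.repr.map_eq_zero_iff.1 (Finsupp.ext h))
  obtain ⟨j, hj⟩ : ∃ j, e.repr v j ≠ 0 := by
    by_contra! h
    exact hne.2 (e.repr.map_eq_zero_iff.1 (Finsupp.ext h))
  -- At every geometric point of `A` one of the two specialized tensors vanishes, since the fibre is
  -- a domain. So the product of any coordinate of `u` and any coordinate of `v` vanishes at all
  -- points.
  refine mul_ne_zero hi hj (eq_zero_of_forall_algHom_algebraicClosure (k := k) fun φ => ?_)
  have h1 : Algebra.TensorProduct.map φ (AlgHom.id k B) u *
      Algebra.TensorProduct.map φ (AlgHom.id k B) v = 0 := by rw [← map_mul, huv, map_zero]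
  rw [map_mul, ← hev, ← hev]
  rcases mul_eq_zero.1 h1 with h | h <;> simp [h]

end TensorDomain

/-! ### Transfer to the quotient division algebra and its enveloping algebra -/

section QuotientDivisionAlgebra

variable {K : Type*} [Field K]

/-- If every element of `S` is a left and a right fraction of elements of `R` with denominator in
`R`, then the quotient division algebra of `S` is that of `R`. -/
theorem IsQuotientDivisionAlgebra.comp {R S : Type*} [Ring R] [Algebra K R] [Ring S] [Algebra K S]
    {D : Type*} [DivisionRing D] [Algebra K D] {j : S →ₐ[K] D} (h : IsQuotientDivisionAlgebra j)
    {φ : R →ₐ[K] S} (hφ : Function.Injective φ) (hl : ∀ s, ∃ a ≠ 0, ∃ b, φ a * s = φ b)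
    (hr : ∀ s, ∃ a ≠ 0, ∃ b, s * φ a = φ b) : IsQuotientDivisionAlgebra (j.comp φ) := by
  have hne : ∀ {a}, a ≠ 0 → j (φ a) ≠ 0 := fun ha =>
    (map_ne_zero_iff j h.injective).2 ((map_ne_zero_iff φ hφ).2 ha)
  refine ⟨h.injective.comp hφ, fun _ _ => Algebra.mem_top, le_top, fun q _ => ?_, fun q _ => ?_⟩
  · obtain ⟨_, ⟨s, rfl⟩, _, ⟨t, rfl⟩, hs, rfl⟩ := h.fractions.left_fraction q Algebra.mem_top
    obtain ⟨a, ha, b, hab⟩ := hl s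
    obtain ⟨c, hc, e, hce⟩ := hl (φ a * t)
    have h1 : j (φ b) = j (φ a) * j s := by rw [← hab, map_mul]
    have h2 : j (φ e) = j (φ c) * (j (φ a) * j t) := by rw [← hce, map_mul, map_mul]
    have hs0 : j s ≠ 0 := hs
    have hcb : j (φ (c * b)) = j (φ c) * (j (φ a) * j s) := by rw [map_mul, map_mul, h1]
    have h0 : j (φ (c * b)) ≠ 0 := by
      rw [hcb]
      exact mul_ne_zero (hne hc) (mul_ne_zero (hne ha) hs)
    refine ⟨j (φ (c * b)), ⟨c * b, rfl⟩, j (φ e), ⟨e, rfl⟩, h0, ?_⟩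
    rw [eq_inv_mul_iff_mul_eq₀ h0, hcb, h2]
    change _ * ((j s)⁻¹ * j t) = _
    simp only [mul_assoc, mul_inv_cancel_left₀ hs0]
  · obtain ⟨_, ⟨s, rfl⟩, _, ⟨t, rfl⟩, hs, rfl⟩ := h.fractions.right_fraction q Algebra.mem_top
    obtain ⟨a, ha, b, hab⟩ := hr s
    obtain ⟨c, hc, e, hce⟩ := hr (t * φ a)
    have h1 : j (φ b) = j s * j (φ a) := by rw [← hab, map_mul]
    have h2 : j (φ e) = j t * j (φ a) * j (φ c) := by rw [← hce, map_mul, map_mul]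
    have hs0 : j s ≠ 0 := hs
    have hcb : j (φ (b * c)) = j s * j (φ a) * j (φ c) := by rw [map_mul, map_mul, h1]
    have h0 : j (φ (b * c)) ≠ 0 := by
      rw [hcb]
      exact mul_ne_zero (mul_ne_zero hs (hne ha)) (hne hc)
    refine ⟨j (φ (b * c)), ⟨b * c, rfl⟩, j (φ e), ⟨e, rfl⟩, h0, ?_⟩
    rw [eq_mul_inv_iff_mul_eq₀ h0, hcb, h2]
    change (j t * (j s)⁻¹) * _ = _
    simp only [mul_assoc, inv_mul_cancel_left₀ hs0]

theorem hasLeftDenominators_of_isFractionRing {A : Type*} [CommRing A] (L : Type*) [Field L]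
    [Algebra A L] [IsFractionRing A L] [Algebra K A] [Algebra K L] [IsScalarTower K A L] :
    HasLeftDenominators (IsScalarTower.toAlgHom K A L : A →+* L) := by
  intro l
  obtain ⟨a, s, hs, rfl⟩ := IsFractionRing.div_surjective (A := A) l
  have hs0 := (IsLocalization.map_units L ⟨s, hs⟩)
  exact ⟨s, a, hs0, mul_div_cancel₀ _ hs0.ne_zero⟩

theorem tensorProduct_map_injective {R S R' S' : Type*} [Ring R] [Ring S] [Ring R'] [Ring S']
    [Algebra K R] [Algebra K S] [Algebra K R'] [Algebra K S'] {f : R →ₐ[K] S} {g : R' →ₐ[K] S'}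
    (hf : Function.Injective f) (hg : Function.Injective g) :
    Function.Injective (Algebra.TensorProduct.map f g) :=
  TensorProduct.map_injective_of_flat_flat f.toLinearMap g.toLinearMap hf hg

/-- `S ⊗ Sᵒ` has a Weyl presentation over `C ⊗ C`. Every element of `D ⊗ Dᵒ` is a left fraction over
it, where right fractions in `D` serve as left fractions in `Dᵒ`. -/
theorem IsWeylPresentation.isNoetherianRing_tensorProduct_op {C S : Type*} [CommRing C]
    [Algebra K C] [Ring S] [Algebra K S] {f : C →ₐ[K] S} {ι : Type*} [Finite ι] {z : ι → S}
    {x : ι → C} (h : IsWeylPresentation f z x) [IsNoetherianRing (C ⊗[K] C)] {D : Type*}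
    [DivisionRing D] [Algebra K D] {j : S →ₐ[K] D} (hj : IsQuotientDivisionAlgebra j) :
    IsNoetherianRing (D ⊗[K] Dᵐᵒᵖ) :=
  have : IsNoetherianRing (S ⊗[K] Sᵐᵒᵖ) := (h.tensorProduct h.op).isNoetherianRing
  (hj.hasLeftDenominators.tensorProduct hj.hasLeftDenominators_op).isNoetherianRing

theorem IsWeylPresentation.isDomain_tensorProduct_op [CharZero K] {C S : Type*} [CommRing C]
    [Algebra K C] [Ring S] [Algebra K S] {f : C →ₐ[K] S} {ι : Type*} [Finite ι] {z : ι → S}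
    {x : ι → C} (h : IsWeylPresentation f z x) (hf : Function.Injective f)
    [IsDomain (C ⊗[K] C)] {D : Type*} [DivisionRing D] [Algebra K D] {j : S →ₐ[K] D}
    (hj : IsQuotientDivisionAlgebra j) : IsDomain (D ⊗[K] Dᵐᵒᵖ) := by
  have : IsDomain (S ⊗[K] Sᵐᵒᵖ) := (h.tensorProduct h.op).isDomain
    (tensorProduct_map_injective hf fun a b hab => hf (MulOpposite.op_injective hab))
  have : NoZeroDivisors (D ⊗[K] Dᵐᵒᵖ) :=
    (hj.hasLeftDenominators.tensorProduct hj.hasLeftDenominators_op).noZeroDivisors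
      (tensorProduct_map_injective hj.injective fun a b hab =>
        MulOpposite.unop_injective (hj.injective (MulOpposite.op_injective hab)))
  exact NoZeroDivisors.to_isDomain _

/-- The facts about differential operators on an affine domain `A` needed for the study of the
quotient division algebra `D`. -/
theorem exists_quotientDivisionAlgebra_diffOps [CharZero K] {A : Type u} [CommRing A] [IsDomain A]
    [Algebra K A] [Algebra.FiniteType K A] :
    ∃ (D : Type u) (_ : DivisionRing D) (_ : Algebra K D) (j : DiffOps K A →ₐ[K] D),
      IsQuotientDivisionAlgebra j ∧ IsNoetherianRing (D ⊗[K] Dᵐᵒᵖ) ∧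
      (IsDomain (AlgebraicClosure K ⊗[K] A) → IsDomain (D ⊗[K] Dᵐᵒᵖ)) := by
  let L := FractionRing A
  obtain ⟨n, x, d, hxd⟩ := exists_isDualDerivations K A L
  have hL := hasLeftDenominators_of_isFractionRing (K := K) (A := A) L
  let S := derivationAlgebra d
  have hS := isWeylPresentation_derivationAlgebra hxd
  have hinj : Function.Injective ((Algebra.lmul K L).codRestrict S lmul_mem_derivationAlgebra) :=
    fun a b hab => by
      have := congrArg (fun w : S => (w : Module.End K L) 1) hab
      simpa using this
  have : IsDomain S := hS.isDomain hinj
  have : IsNoetherianRing S := hS.isNoetherianRing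
  have : IsNoetherianRing Sᵐᵒᵖ := hS.op.isNoetherianRing
  obtain ⟨D, _, _, j, hj⟩ := exists_isQuotientDivisionAlgebra (K := K) S
  obtain ⟨φ, hφ⟩ := exists_diffOps_algHom hxd
  have hφinj : Function.Injective φ := by
    rw [injective_iff_map_eq_zero]
    intro P hP
    apply Subtype.ext
    ext a
    apply IsFractionRing.injective A L
    rw [← hφ, hP]
    simp
  have heq : ∀ v w : S, (∀ a : A, (v : Module.End K L) (algebraMap A L a) =
      (w : Module.End K L) (algebraMap A L a)) → v = w := fun v w hvw =>
    Subtype.ext (eq_of_comp_eq v.2 w.2 hvw)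
  have hmul : ∀ {a : A}, a ≠ 0 → (⟨_, mulLeft_mem_diffOps a⟩ : DiffOps K A) ≠ 0 := by
    intro a ha h0
    have := congrArg (fun P : DiffOps K A => (P : Module.End K A) 1) h0
    exact ha (by simpa using this)
  have hφmul : ∀ a : A, φ ⟨_, mulLeft_mem_diffOps a⟩ =
      ⟨Algebra.lmul K L (algebraMap A L a), lmul_mem_derivationAlgebra _⟩ := fun a =>
    heq _ _ fun b => by
      rw [hφ]
      simp
  refine ⟨D, inferInstance, inferInstance, j.comp φ,
    IsQuotientDivisionAlgebra.comp (R := DiffOps K A) (S := S) hj hφinj ?_ ?_, ?_, fun hA => ?_⟩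
  · intro s
    obtain ⟨a, ha, P, hP, haP⟩ := exists_left_denominator (A := A) s.2
    refine ⟨⟨_, mulLeft_mem_diffOps a⟩, hmul ha, ⟨P, hP⟩, heq _ _ fun b => ?_⟩
    rw [hφ, ← haP, hφmul]
    rfl
  · intro s
    obtain ⟨a, ha, P, hP, haP⟩ := exists_right_denominator (A := A) s.2
    refine ⟨⟨_, mulLeft_mem_diffOps a⟩, hmul ha, ⟨P, hP⟩, heq _ _ fun b => ?_⟩
    rw [hφ, ← haP]
    change (s : Module.End K L) ((φ _ : Module.End K L) _) = _
    rw [hφ]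
    rfl
  -- `L ⊗ L` itself need not be of finite type; it is Noetherian as a ring of fractions of the
  -- affine algebra `A ⊗ A`.
  · have h1 : IsNoetherianRing (L ⊗[K] L) := by
      have : IsNoetherianRing A := Algebra.FiniteType.isNoetherianRing K A
      have : IsNoetherianRing (A ⊗[K] A) := Algebra.FiniteType.isNoetherianRing A _
      exact (hL.tensorProduct hL).isNoetherianRing
    exact IsWeylPresentation.isNoetherianRing_tensorProduct_op (S := S) hS hj
  · have : NoZeroDivisors (A ⊗[K] A) := noZeroDivisors_tensorProduct
    have h1 : NoZeroDivisors (L ⊗[K] L) :=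
      (hL.tensorProduct hL).noZeroDivisors
        (tensorProduct_map_injective (f := IsScalarTower.toAlgHom K A L)
          (g := IsScalarTower.toAlgHom K A L) (IsFractionRing.injective A L)
          (IsFractionRing.injective A L))
    have : IsDomain (L ⊗[K] L) := NoZeroDivisors.to_isDomain _
    exact IsWeylPresentation.isDomain_tensorProduct_op (S := S) hS hinj hj

/-- The ring `D ⊗ Dᵒ` is left Noetherian if and only if it is right Noetherian. -/
theorem isTwoSidedNoetherian_tensorProduct_op (D : Type*) [Ring D] [Algebra K D]
    [IsNoetherianRing (D ⊗[K] Dᵐᵒᵖ)] : IsTwoSidedNoetherian (D ⊗[K] Dᵐᵒᵖ) := by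
  refine ⟨inferInstance, ?_⟩
  -- Exchanging the two factors identifies `D ⊗ Dᵒ` with its own opposite.
  let e : (D ⊗[K] Dᵐᵒᵖ) ≃ₐ[K] (D ⊗[K] Dᵐᵒᵖ)ᵐᵒᵖ :=
    (Algebra.TensorProduct.comm K D Dᵐᵒᵖ).trans <|
    (Algebra.TensorProduct.congr AlgEquiv.refl (AlgEquiv.opOp K D)).trans
      (Algebra.TensorProduct.opAlgEquiv K K D Dᵐᵒᵖ)
  exact isNoetherianRing_of_ringEquiv _ e.toRingEquiv

theorem IsQuotientDivisionAlgebra.tensorProduct_op [CharZero K] {A : Type*} [CommRing A]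
    [IsDomain A] [Algebra K A] [Algebra.FiniteType K A] {D : Type*} [DivisionRing D] [Algebra K D]
    {j : DiffOps K A →ₐ[K] D} (hj : IsQuotientDivisionAlgebra j) :
    IsTwoSidedNoetherian (D ⊗[K] Dᵐᵒᵖ) ∧
      (IsDomain (AlgebraicClosure K ⊗[K] A) → IsDomain (D ⊗[K] Dᵐᵒᵖ)) := by
  obtain ⟨E, _, _, k, hk, hnoeth, hdom⟩ := exists_quotientDivisionAlgebra_diffOps (K := K) (A := A)
  obtain ⟨e⟩ := IsQuotientDivisionAlgebra.nonempty_algEquiv (R := DiffOps K A) hk hj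
  let e' : (E ⊗[K] Eᵐᵒᵖ) ≃ₐ[K] (D ⊗[K] Dᵐᵒᵖ) := Algebra.TensorProduct.congr e (AlgEquiv.op e)
  have : IsNoetherianRing (D ⊗[K] Dᵐᵒᵖ) := isNoetherianRing_of_ringEquiv _ e'.toRingEquiv
  refine ⟨isTwoSidedNoetherian_tensorProduct_op D, fun hA => ?_⟩
  have := hdom hA
  exact e'.symm.toMulEquiv.isDomain

end QuotientDivisionAlgebra

/-! ### Division subalgebras -/

section DivisionSubalgebras

variable {K : Type*} [Field K] {D : Type*} [DivisionRing D] [Algebra K D]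

/-- A division subalgebra as a `Subfield` (which need not be commutative). -/
def IsDivisionSubalgebra.toSubfield {E : Subalgebra K D} (hE : IsDivisionSubalgebra E) :
    Subfield D :=
  { E.toSubring with inv_mem' := hE }

theorem IsDivisionSubalgebra.sInf {s : Set (Subalgebra K D)}
    (hs : ∀ E ∈ s, IsDivisionSubalgebra E) : IsDivisionSubalgebra (sInf s) := by
  intro x hx
  rw [Algebra.mem_sInf] at hx ⊢
  exact fun E hE => hs E hE x (hx E hE)

/-- The least division subalgebra containing a set. -/
def divisionClosure (K : Type*) [Field K] {D : Type*} [DivisionRing D] [Algebra K D] (s : Set D) :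
    Subalgebra K D :=
  sInf {E | IsDivisionSubalgebra E ∧ s ⊆ E}

theorem isLeast_divisionClosure (s : Set D) :
    IsLeast {E : Subalgebra K D | IsDivisionSubalgebra E ∧ s ⊆ E} (divisionClosure K s) := by
  refine ⟨⟨IsDivisionSubalgebra.sInf fun E hE => hE.1, fun x hx => ?_⟩, fun E hE => sInf_le hE⟩
  rw [SetLike.mem_coe, divisionClosure, Algebra.mem_sInf]
  exact fun E hE => hE.2 hx

/-- The left ideal of `D ⊗ Dᵒ` generated by all `e ⊗ 1 - 1 ⊗ e`, `e ∈ E`. -/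
def diagonalIdeal (E : Subalgebra K D) : Ideal (D ⊗[K] Dᵐᵒᵖ) :=
  Ideal.span ((fun e : D => e ⊗ₜ[K] (1 : Dᵐᵒᵖ) - 1 ⊗ₜ[K] MulOpposite.op e) '' E)

theorem diagonalIdeal_mono {E F : Subalgebra K D} (h : E ≤ F) :
    diagonalIdeal E ≤ diagonalIdeal F :=
  Ideal.span_mono (Set.image_mono h)

/-- The map `d ⊗ e ↦ (x ↦ d f(e x))`. -/
def twoSidedAction (f : D →ₗ[K] D) : D ⊗[K] Dᵐᵒᵖ →ₗ[K] (D →ₗ[K] D) :=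
  TensorProduct.lift (LinearMap.mk₂ K
    (fun d e => LinearMap.mulLeft K d ∘ₗ f ∘ₗ LinearMap.mulLeft K e.unop)
    (fun d d' e => by ext; simp [add_mul]) (fun c d e => by ext; simp)
    (fun d e e' => by ext; simp [add_mul, mul_add]) (fun c d e => by ext; simp))

theorem twoSidedAction_tmul (f : D →ₗ[K] D) (d : D) (e : Dᵐᵒᵖ) (x : D) :
    twoSidedAction f (d ⊗ₜ e) x = d * f (e.unop * x) := rfl

/-- For `f` left linear over `E`, the terms `d e ⊗ c` and `d ⊗ (c · op e)` act alike, because `d e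
f(c x) = d f(e c x)`. -/
theorem twoSidedAction_eq_zero {E : Subalgebra K D} {f : D →ₗ[K] D}
    (hf : ∀ e ∈ E, ∀ x, f (e * x) = e * f x) {t : D ⊗[K] Dᵐᵒᵖ} (ht : t ∈ diagonalIdeal E) :
    twoSidedAction f t = 0 := by
  have key : ∀ s, twoSidedAction f (s * t) = 0 := by
    induction ht using Submodule.span_induction with
    | mem t ht =>
      obtain ⟨e, he, rfl⟩ := ht
      intro s
      induction s with
      | zero => simp
      | add a b ha hb => rw [add_mul, map_add, ha, hb, add_zero]
      | tmul a b =>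
        ext x
        simp only [mul_sub, Algebra.TensorProduct.tmul_mul_tmul, mul_one, map_sub,
          LinearMap.sub_apply, twoSidedAction_tmul, LinearMap.zero_apply, MulOpposite.unop_mul,
          MulOpposite.unop_op]
        rw [mul_assoc e, hf e he, mul_assoc, sub_self]
    | zero => simp
    | add a b _ _ ha hb =>
      intro s
      rw [mul_add, map_add, ha, hb, add_zero]
    | smul a b _ hb =>
      intro s
      rw [smul_eq_mul, ← mul_assoc, hb]
  simpa using key 1

/-- If `d ∉ E`, then `d` and `1` are linearly independent over `E`, so some left `E`-linear map `f`
on `D` has `f 1 = 0` and `f d ≠ 0`. The element attached to `d` then acts at `1` as `-f d ≠ 0`,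
while the ideal of `E` acts as zero. -/
theorem mem_iff_mem_diagonalIdeal {E : Subalgebra K D} (hE : IsDivisionSubalgebra E) {d : D} :
    d ∈ E ↔ d ⊗ₜ[K] (1 : Dᵐᵒᵖ) - 1 ⊗ₜ[K] MulOpposite.op d ∈ diagonalIdeal E := by
  refine ⟨fun hd => Ideal.subset_span ⟨d, hd, rfl⟩, fun hd => ?_⟩
  by_contra hdE
  let F : Subfield D := hE.toSubfield
  have hdspan : d ∉ Submodule.span F {(1 : D)} := by
    rw [Submodule.mem_span_singleton]
    rintro ⟨c, hc⟩
    refine hdE ?_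
    rw [← hc]
    have : c • (1 : D) = c := mul_one _
    rw [this]
    exact c.2
  obtain ⟨g, hg, hg1⟩ := Submodule.exists_le_ker_of_notMem hdspan
  have hg1 : g 1 = 0 := hg1 (Submodule.mem_span_singleton_self 1)
  let f : D →ₗ[K] D :=
    { toFun := fun x => (g x : D)
      map_add' := fun x y => by rw [map_add]; rfl
      map_smul' := fun c x => by
        have h1 : c • x = (⟨algebraMap K D c, E.algebraMap_mem c⟩ : F) • x :=
          Algebra.smul_def c x
        rw [h1, map_smul, RingHom.id_apply, Algebra.smul_def]
        rfl }
  have hf : ∀ e ∈ E, ∀ x, f (e * x) = e * f x := by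
    intro e he x
    have h1 : e * x = (⟨e, he⟩ : F) • x := rfl
    change (g (e * x) : D) = _
    rw [h1, map_smul]
    rfl
  have h1 := congrArg (fun η : D →ₗ[K] D => η 1) (twoSidedAction_eq_zero hf hd)
  simp only [map_sub, LinearMap.sub_apply, twoSidedAction_tmul, LinearMap.zero_apply,
    MulOpposite.unop_one, MulOpposite.unop_op, mul_one, one_mul] at h1
  have h2 : f 1 = 0 := by
    change (g 1 : D) = 0
    rw [hg1]
    rfl
  rw [h2, mul_zero, zero_sub, neg_eq_zero] at h1
  exact hg (Subtype.ext h1)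

/-- Division subalgebras embed, strictly monotonically, in the left ideals of `D ⊗ Dᵒ`. -/
theorem wellFoundedGT_divisionSubalgebra [IsNoetherianRing (D ⊗[K] Dᵐᵒᵖ)] :
    WellFoundedGT {E : Subalgebra K D // IsDivisionSubalgebra E} := by
  have hmono : StrictMono fun E : {E : Subalgebra K D // IsDivisionSubalgebra E} =>
      diagonalIdeal E.1 := by
    intro E F hEF
    refine lt_of_le_of_ne (diagonalIdeal_mono hEF.le) fun h => hEF.not_ge fun d hd => ?_
    have h' : diagonalIdeal E.1 = diagonalIdeal F.1 := h
    rw [mem_iff_mem_diagonalIdeal E.2, h']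
    exact (mem_iff_mem_diagonalIdeal F.2).1 hd
  exact hmono.wellFoundedGT

theorem division_subalgebras_stabilize [IsNoetherianRing (D ⊗[K] Dᵐᵒᵖ)]
    (E : ℕ → Subalgebra K D) (hE : ∀ n, IsDivisionSubalgebra (E n)) (hmono : Monotone E) :
    ∃ n, ∀ m, n ≤ m → E m = E n := by
  have := wellFoundedGT_divisionSubalgebra (K := K) (D := D)
  obtain ⟨n, hn⟩ := WellFoundedGT.monotone_chain_condition
    (⟨fun n => ⟨E n, hE n⟩, hmono⟩ : ℕ →o {E : Subalgebra K D // IsDivisionSubalgebra E})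
  exact ⟨n, fun m hm => (congrArg Subtype.val (hn m hm)).symm⟩

theorem isFinGenDivisionSubalgebra [IsNoetherianRing (D ⊗[K] Dᵐᵒᵖ)] (E : Subalgebra K D)
    (hE : IsDivisionSubalgebra E) : IsFinGenDivisionSubalgebra E := by
  classical
  have := wellFoundedGT_divisionSubalgebra (K := K) (D := D)
  let cl : Finset D → {E : Subalgebra K D // IsDivisionSubalgebra E} := fun s =>
    ⟨divisionClosure K s, (isLeast_divisionClosure _).1.1⟩
  -- Among the division closures of finite subsets of `E`, take a maximal one; adjoining a further
  -- element of `E` cannot enlarge it.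
  obtain ⟨_, ⟨s, hs, rfl⟩, hmax⟩ := wellFounded_gt.has_min
    (cl '' {s | (s : Set D) ⊆ E}) ⟨_, ∅, by simp, rfl⟩
  refine ⟨s, ?_⟩
  convert! isLeast_divisionClosure (K := K) (s : Set D)
  refine le_antisymm (fun x hx => ?_) ((isLeast_divisionClosure _).2 ⟨hE, hs⟩)
  have hle : cl s ≤ cl (insert x s) := (isLeast_divisionClosure _).2
    ⟨(isLeast_divisionClosure _).1.1, (by simp : (s : Set D) ⊆ (insert x s : Finset D)).trans
      (isLeast_divisionClosure _).1.2⟩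
  have hnot := hmax (cl (insert x s)) ⟨insert x s, by
    rw [Set.mem_ofPred_eq, Finset.coe_insert, Set.insert_subset_iff]
    exact ⟨hx, hs⟩, rfl⟩
  have heq := hle.eq_or_lt.resolve_right hnot
  have hx' : x ∈ divisionClosure K ((insert x s : Finset D) : Set D) :=
    (isLeast_divisionClosure _).1.2 (by simp)
  have e : divisionClosure K (s : Set D) = divisionClosure K ((insert x s : Finset D) : Set D) :=
    congrArg Subtype.val heq
  rw [e]
  exact hx'

end DivisionSubalgebras

/-! ### Rings generated by a subring and an invertible normalizing element -/

section LaurentNoetherian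

/-- `T` is generated by the image of `f` and a unit `x` with `x f(R) = f(R) x`. -/
structure IsLaurentGenerated {R T : Type*} [Ring R] [Ring T] (f : R →+* T) (x : Tˣ) : Prop where
  left : ∀ r, ∃ s, x * f r = f s * x
  right : ∀ r, ∃ s, f r * x = x * f s
  gen : ∀ U : Subring T, (∀ r, f r ∈ U) → (x : T) ∈ U → ((x⁻¹ : Tˣ) : T) ∈ U → U = ⊤

namespace IsLaurentGenerated

variable {R T : Type*} [Ring R] [Ring T] {f : R →+* T} {x : Tˣ}

theorem op (h : IsLaurentGenerated f x) :
    IsLaurentGenerated (RingHom.op f) (Units.opEquiv.symm (MulOpposite.op x)) where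
  left r := by
    obtain ⟨s, hs⟩ := h.right r.unop
    exact ⟨MulOpposite.op s, MulOpposite.unop_injective (by simpa using hs)⟩
  right r := by
    obtain ⟨s, hs⟩ := h.left r.unop
    exact ⟨MulOpposite.op s, MulOpposite.unop_injective (by simpa using hs)⟩
  gen U h1 h2 h3 := by
    have h4 : U.unop = ⊤ := h.gen U.unop (fun r => h1 (MulOpposite.op r)) h2 h3
    rw [eq_top_iff]
    intro t _
    have : t.unop ∈ U.unop := h4 ▸ Subring.mem_top _
    exact this

/-- The subring `U` generated by `R` and `x`, without `x⁻¹`, is Noetherian by the Hilbert basis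
theorem. Since `x U ⊆ U x`, the elements that some power of `x` multiplies into `U` form a subring,
which is all of `T`. -/
theorem isNoetherianRing (h : IsLaurentGenerated f x) [IsNoetherianRing R] :
    IsNoetherianRing T := by
  let U : Subring T := Subring.closure (Set.range f ∪ {(x : T)})
  have hfU : ∀ r, f r ∈ U := fun r => Subring.subset_closure (Or.inl ⟨r, rfl⟩)
  have hxU : (x : T) ∈ U := Subring.subset_closure (Or.inr rfl)
  let z : U := ⟨x, hxU⟩
  let g : R →+* U := f.codRestrict U hfU
  have hskew : SkewCommutes g z := by
    refine ⟨fun r => ?_, fun r => ?_⟩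
    · obtain ⟨s, hs⟩ := h.left r
      exact ⟨s, 0, Subtype.ext (by simpa [z, g] using hs)⟩
    · obtain ⟨s, hs⟩ := h.right r
      exact ⟨s, 0, Subtype.ext (by simpa [z, g] using hs)⟩
  have hgen : ∀ V : Subring U, (∀ r, g r ∈ V) → z ∈ V → V = ⊤ := by
    intro V h1 h2
    have h3 : U ≤ V.map U.subtype := by
      rw [Subring.closure_le]
      rintro _ (⟨r, rfl⟩ | rfl)
      · exact ⟨g r, h1 r, rfl⟩
      · exact ⟨z, h2, rfl⟩
    rw [eq_top_iff]
    rintro ⟨t, ht⟩ -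
    obtain ⟨v, hv, hvt⟩ := h3 ht
    have : v = ⟨t, ht⟩ := Subtype.ext hvt
    rwa [← this]
  have : IsNoetherianRing U := hskew.isNoetherianRing hgen
  have hconj : ∀ t ∈ U, ∃ s ∈ U, (x : T) * t = s * x := by
    intro t ht
    induction ht using Subring.closure_induction with
    | mem t ht =>
      rcases ht with ⟨r, rfl⟩ | rfl
      · obtain ⟨s, hs⟩ := h.left r
        exact ⟨f s, hfU s, hs⟩
      · exact ⟨x, hxU, rfl⟩
    | zero => exact ⟨0, zero_mem _, by simp⟩
    | one => exact ⟨1, one_mem _, by simp⟩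
    | add a b _ _ ha hb =>
      obtain ⟨s, hs, hsa⟩ := ha
      obtain ⟨s', hs', hsb⟩ := hb
      exact ⟨s + s', add_mem hs hs', by rw [mul_add, add_mul, hsa, hsb]⟩
    | neg a _ ha =>
      obtain ⟨s, hs, hsa⟩ := ha
      exact ⟨-s, neg_mem hs, by rw [mul_neg, neg_mul, hsa]⟩
    | mul a b _ _ ha hb =>
      obtain ⟨s, hs, hsa⟩ := ha
      obtain ⟨s', hs', hsb⟩ := hb
      exact ⟨s * s', mul_mem hs hs', by rw [← mul_assoc, hsa, mul_assoc, hsb, mul_assoc]⟩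
  have hconjpow : ∀ (n : ℕ), ∀ t ∈ U, ∃ s ∈ U, (x : T) ^ n * t = s * (x : T) ^ n := by
    intro n t ht
    induction n with
    | zero => exact ⟨t, ht, by simp⟩
    | succ n ih =>
      obtain ⟨s, hs, hst⟩ := ih
      obtain ⟨s', hs', hst'⟩ := hconj s hs
      exact ⟨s', hs', by rw [pow_succ', mul_assoc, hst, ← mul_assoc, hst', mul_assoc]⟩
  have hden : HasLeftDenominators U.subtype := by
    let V : Subring T :=
      { carrier := {t | ∃ n : ℕ, (x : T) ^ n * t ∈ U}
        mul_mem' := by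
          rintro a b ⟨m, hm⟩ ⟨n, hn⟩
          obtain ⟨s, hs, hst⟩ := hconjpow n _ hm
          refine ⟨n + m, ?_⟩
          have e : (x : T) ^ (n + m) * (a * b) = s * ((x : T) ^ n * b) := by
            rw [← mul_assoc s, ← hst, pow_add]
            simp only [mul_assoc]
          rw [e]
          exact mul_mem hs hn
        one_mem' := ⟨0, by simp⟩
        add_mem' := by
          rintro a b ⟨m, hm⟩ ⟨n, hn⟩
          refine ⟨m + n, ?_⟩
          rw [mul_add]
          refine add_mem ?_ ?_
          · rw [add_comm m, pow_add, mul_assoc]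
            exact mul_mem (pow_mem hxU n) hm
          · rw [pow_add, mul_assoc]
            exact mul_mem (pow_mem hxU m) hn
        zero_mem' := ⟨0, by simp⟩
        neg_mem' := by
          rintro a ⟨m, hm⟩
          exact ⟨m, by rw [mul_neg]; exact neg_mem hm⟩ }
    have hV : V = ⊤ := h.gen V (fun r => ⟨0, by simpa using hfU r⟩) ⟨0, by simpa using hxU⟩
      ⟨1, by simp⟩
    intro t
    obtain ⟨n, hn⟩ : t ∈ V := hV ▸ Subring.mem_top t
    exact ⟨z ^ n, ⟨_, hn⟩, by simpa [z] using x.isUnit.pow n, rfl⟩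
  exact hden.isNoetherianRing

theorem isTwoSidedNoetherian (h : IsLaurentGenerated f x) (hR : IsTwoSidedNoetherian R) :
    IsTwoSidedNoetherian T := by
  have := hR.1
  have := hR.2
  exact ⟨h.isNoetherianRing, h.op.isNoetherianRing⟩

end IsLaurentGenerated

end LaurentNoetherian

/-! ### Eigenalgebras -/

namespace WeightSystem

variable {K : Type v} [Field K] {D : Type w} [DivisionRing D] [Algebra K D] {t : ℕ} {W : Type v}
  [AddCommGroup W] {S : WeightSystem K D t W}

/-- Independence of eigenvectors for distinct eigenvalues. To kill `f i`, choose an operator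
separating the eigenvalue of `i` from that of `i₀`; subtracting the eigenvalue at `i₀` from it
removes the `i₀` term and rescales the others. -/
theorem eq_zero_of_sum_eq_zero (hval : Function.Injective S.val) {ι : Type*} {g : ι → W}
    {s : Finset ι} (hg : Set.InjOn g s) {f : ι → D} (hf : ∀ i ∈ s, f i ∈ S.space (g i))
    (h0 : ∑ i ∈ s, f i = 0) : ∀ i ∈ s, f i = 0 := by
  classical
  induction s using Finset.induction_on generalizing f with
  | empty => simp
  | insert i₀ s hi₀ ih =>
    have hs : ∀ i ∈ s, f i = 0 := by
      intro i hi
      have hne : S.val (g i) ≠ S.val (g i₀) := by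
        intro h
        have h2 := hg (Finset.mem_insert_of_mem hi) (Finset.mem_insert_self i₀ s) (hval h)
        exact hi₀ (h2 ▸ hi)
      obtain ⟨k, hk⟩ := Function.ne_iff.1 hne
      have h1 := ih (hg.mono (by simp)) (f := fun i => (S.val (g i) k - S.val (g i₀) k) • f i)
        (fun i hi => Submodule.smul_mem _ _ (hf i (Finset.mem_insert_of_mem hi))) ?_ i hi
      · exact (smul_eq_zero.1 h1).resolve_left (sub_ne_zero.2 hk)
      · have hop : ∀ i ∈ insert i₀ s, S.op k (f i) = S.val (g i) k • f i := fun i hi =>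
          mem_commonEigenspace.1 (hf i hi) k
        have h2 : S.op k (∑ i ∈ insert i₀ s, f i) -
            S.val (g i₀) k • ∑ i ∈ insert i₀ s, f i = 0 := by simp [h0]
        rw [map_sum, Finset.sum_congr rfl hop, Finset.smul_sum, ← Finset.sum_sub_distrib,
          Finset.sum_insert hi₀, sub_self, zero_add] at h2
        simpa only [sub_smul] using h2
    intro i hi
    rcases Finset.mem_insert.1 hi with rfl | hi
    · rwa [Finset.sum_insert hi₀, Finset.sum_eq_zero hs, add_zero] at h0
    · exact hs i hi

theorem mem_space_of_mem {F : AddSubgroup W} {a : W} (ha : a ∈ F) {x : D} (hx : x ∈ S.space a) :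
    x ∈ S.algebraOf F :=
  Submodule.mem_iSup_of_mem (p := fun a : F => S.space (a : W)) ⟨a, ha⟩ hx

@[elab_as_elim]
theorem algebraOf_induction {F : AddSubgroup W} {p : ∀ x, x ∈ S.algebraOf F → Prop}
    (mem : ∀ a (ha : a ∈ F) x (hx : x ∈ S.space a), p x (mem_space_of_mem ha hx))
    (add : ∀ x y hx hy, p x hx → p y hy → p (x + y) (add_mem hx hy)) {x : D}
    (hx : x ∈ S.algebraOf F) : p x hx :=
  Submodule.iSup_induction' (fun a : F => S.space (a : W)) (motive := p)
    (fun a x hx => mem a a.2 x hx) (mem 0 F.zero_mem 0 (zero_mem _)) add hx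

variable (S) in
/-- The finitely supported family `f` of eigenvectors has sum `x`. -/
structure IsDecomposition (f : W →₀ D) (x : D) : Prop where
  mem : ∀ a, f a ∈ S.space a
  sum_eq : ∑ a ∈ f.support, f a = x

theorem exists_isDecomposition {F : AddSubgroup W} {x : D} (hx : x ∈ S.algebraOf F) :
    ∃ f, S.IsDecomposition f x ∧ ∀ a, f a ≠ 0 → a ∈ F := by
  classical
  induction hx using algebraOf_induction with
  | mem a ha x hx =>
    refine ⟨Finsupp.single a x, ⟨fun b => ?_, ?_⟩, fun b hb => ?_⟩
    · by_cases h : a = b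
      · subst h
        simpa using hx
      · simp [h]
    · exact Finsupp.sum_single_index (h := fun _ y => y) rfl
    · by_cases h : a = b
      · exact h ▸ ha
      · simp [h] at hb
  | add x y _ _ hx hy =>
    obtain ⟨f, hf, hfF⟩ := hx
    obtain ⟨g, hg, hgF⟩ := hy
    refine ⟨f + g, ⟨fun a => add_mem (hf.mem a) (hg.mem a), ?_⟩, fun a ha => ?_⟩
    · have := Finsupp.sum_add_index' (f := f) (g := g) (h := fun _ y => y) (fun _ => rfl)
        (fun _ _ _ => rfl)
      rw [← hf.sum_eq, ← hg.sum_eq]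
      exact this
    · by_contra h
      have h1 : f a = 0 := not_not.1 fun h' => h (hfF a h')
      have h2 : g a = 0 := not_not.1 fun h' => h (hgF a h')
      simp [h1, h2] at ha

theorem IsDecomposition.unique (hval : Function.Injective S.val) {f g : W →₀ D} {x : D}
    (hf : S.IsDecomposition f x) (hg : S.IsDecomposition g x) : f = g := by
  classical
  ext a
  by_cases ha : a ∈ f.support ∪ g.support
  · refine sub_eq_zero.1 (eq_zero_of_sum_eq_zero hval (g := id) (Set.injOn_id _)
      (f := fun a => f a - g a) (s := f.support ∪ g.support)
      (fun b _ => sub_mem (hf.mem b) (hg.mem b)) ?_ a ha)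
    rw [Finset.sum_sub_distrib,
      ← Finset.sum_subset Finset.subset_union_left (fun b _ hb => Finsupp.notMem_support_iff.1 hb),
      ← Finset.sum_subset Finset.subset_union_right (fun b _ hb => Finsupp.notMem_support_iff.1 hb),
      hf.sum_eq, hg.sum_eq, sub_self]
  · rw [Finset.mem_union, not_or, Finsupp.notMem_support_iff, Finsupp.notMem_support_iff] at ha
    rw [ha.1, ha.2]

theorem IsDecomposition.mul_right {f : W →₀ D} {x u : D} (hf : S.IsDecomposition f x) {b : W}
    (hu : u ∈ S.space b) : ∃ g, S.IsDecomposition g (x * u) ∧ ∀ a, g (a + b) = f a * u := by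
  classical
  let g : W →₀ D := (f.mapRange (fun y => y * u) (zero_mul u)).mapDomain (fun a => a + b)
  have hg : ∀ a, g (a + b) = f a * u := fun a => by
    rw [Finsupp.mapDomain_apply (add_left_injective b), Finsupp.mapRange_apply]
  refine ⟨g, ⟨fun a => ?_, ?_⟩, hg⟩
  · have h1 := hg (a - b)
    rw [sub_add_cancel] at h1
    rw [h1]
    have h2 := S.mul_mem (hf.mem (a - b)) hu
    rwa [sub_add_cancel] at h2
  · have h1 : g.sum (fun _ y => y) = f.sum fun _ y => y * u := by
      rw [Finsupp.sum_mapDomain_index_inj (add_left_injective b), Finsupp.sum_mapRange_index]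
      exact fun _ => rfl
    have h2 : f.sum (fun _ y => y * u) = x * u := by
      rw [← hf.sum_eq, Finset.sum_mul]
      rfl
    exact h1.trans h2

theorem iSupIndep_space (hval : Function.Injective S.val) {ι : Type*} {g : ι → W}
    (hg : Function.Injective g) : iSupIndep fun i => S.space (g i) := by
  classical
  rw [iSupIndep_iff_finsetSum_eq_zero_imp_eq_zero]
  exact fun s v hv h0 => eq_zero_of_sum_eq_zero hval hg.injOn hv h0

theorem mem_algebraOf_bot {x : D} : x ∈ S.algebraOf ⊥ ↔ x ∈ S.space 0 := by
  refine ⟨fun hx => ?_, fun hx => mem_space_of_mem (zero_mem _) hx⟩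
  induction hx using algebraOf_induction with
  | mem a ha x hx =>
    rw [AddSubgroup.mem_bot] at ha
    rwa [ha] at hx
  | add x y _ _ hx hy => exact add_mem hx hy

theorem isDivisionSubalgebra_bot : IsDivisionSubalgebra (S.algebraOf ⊥) := by
  intro x hx
  rw [mem_algebraOf_bot] at *
  have := S.inv_mem hx
  rwa [neg_zero] at this

theorem zpow_mem_space {a : W} {u : D} (hu : u ∈ S.space a) (n : ℤ) : u ^ n ∈ S.space (n • a) := by
  have hnat : ∀ n : ℕ, u ^ n ∈ S.space (n • a) := by
    intro n
    induction n with
    | zero =>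
      rw [pow_zero, zero_smul]
      exact S.one_mem
    | succ n ih =>
      rw [pow_succ, succ_nsmul]
      exact S.mul_mem ih hu
  obtain ⟨n, rfl | rfl⟩ := n.eq_nat_or_neg
  · simpa using hnat n
  · rw [zpow_neg, neg_smul, zpow_natCast, natCast_zsmul]
    exact S.inv_mem (hnat n)

theorem conj_mem_algebraOf {F : AddSubgroup W} {a : W} {u : D} (hu : u ∈ S.space a) {y : D}
    (hy : y ∈ S.algebraOf F) : u * y * u⁻¹ ∈ S.algebraOf F := by
  induction hy using algebraOf_induction with
  | mem b hb y hy =>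
    have := S.mul_mem (S.mul_mem hu hy) (S.inv_mem hu)
    rw [add_neg_cancel_comm] at this
    exact mem_space_of_mem hb this
  | add y z _ _ hy hz =>
    rw [mul_add, add_mul]
    exact add_mem hy hz

theorem conj_mem_algebraOf' {F : AddSubgroup W} {a : W} {u : D} (hu : u ∈ S.space a) {y : D}
    (hy : y ∈ S.algebraOf F) : u⁻¹ * y * u ∈ S.algebraOf F := by
  have := conj_mem_algebraOf (S.inv_mem hu) hy
  rwa [inv_inv] at this

theorem isLaurentGenerated {F G : AddSubgroup W} {a : W} (hG : G = F ⊔ AddSubgroup.zmultiples a)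
    (hFG : F ≤ G) {x : (S.algebraOf G)ˣ} (hx : ((x : S.algebraOf G) : D) ∈ S.space a) :
    IsLaurentGenerated (Subalgebra.inclusion (S.algebraOf_mono hFG)).toRingHom x := by
  set u : D := ((x : S.algebraOf G) : D) with hu
  have hu1 : u * (((x⁻¹ : (S.algebraOf G)ˣ) : S.algebraOf G) : D) = 1 :=
    congrArg Subtype.val x.mul_inv
  have hu0 : u ≠ 0 := left_ne_zero_of_mul_eq_one hu1
  have hinv : (((x⁻¹ : (S.algebraOf G)ˣ) : S.algebraOf G) : D) = u⁻¹ :=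
    (inv_eq_of_mul_eq_one_right hu1).symm
  refine ⟨fun r => ⟨⟨_, conj_mem_algebraOf hx r.2⟩, Subtype.ext ?_⟩,
    fun r => ⟨⟨_, conj_mem_algebraOf' hx r.2⟩,
    Subtype.ext ?_⟩,
    fun U h1 h2 h3 => ?_⟩
  · change u * (r : D) = u * r * u⁻¹ * u
    rw [mul_assoc _ _ u, inv_mul_cancel₀ hu0, mul_one]
  · change (r : D) * u = u * (u⁻¹ * r * u)
    rw [mul_assoc, mul_inv_cancel_left₀ hu0]
  · rw [eq_top_iff]
    rintro ⟨y, hy⟩ -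
    have hpow : ∀ n : ℤ, ∃ h, (⟨u ^ n, h⟩ : S.algebraOf G) ∈ U := by
      intro n
      obtain ⟨n, rfl | rfl⟩ := n.eq_nat_or_neg
      · have h4 := pow_mem h2 n
        have e : u ^ (n : ℤ) = (((x : S.algebraOf G) ^ n : S.algebraOf G) : D) := by simp [hu]
        exact ⟨e ▸ Subtype.prop _, by convert! h4⟩
      · have h4 := pow_mem h3 n
        have e : u ^ (-n : ℤ) =
            ((((x⁻¹ : (S.algebraOf G)ˣ) : S.algebraOf G) ^ n : S.algebraOf G) : D) := by
          simp [hinv]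
        exact ⟨e ▸ Subtype.prop _, by convert! h4⟩
    have key : ∃ h, (⟨y, h⟩ : S.algebraOf G) ∈ U := by
      induction hy using algebraOf_induction with
      | mem b hb y hy =>
        rw [hG, AddSubgroup.mem_sup] at hb
        obtain ⟨c, hc, _, ⟨n, rfl⟩, rfl⟩ := hb
        -- Dividing by `u ^ n` shifts the eigenvalue `c + n a` back to `c`, which lies in `F`.
        have h4 : y * u ^ (-n) ∈ S.algebraOf F := by
          have h5 := S.mul_mem hy (zpow_mem_space hx (-n))
          have e : c + (fun x => x • a) n + -n • a = c := by simp
          rw [e] at h5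
          exact mem_space_of_mem hc h5
        obtain ⟨h5, h6⟩ := hpow n
        have h7 := MulMemClass.mul_mem (h1 ⟨_, h4⟩) h6
        have e : y = y * u ^ (-n) * u ^ n := by
          rw [mul_assoc, ← zpow_add₀ hu0]
          simp
        refine ⟨e ▸ MulMemClass.mul_mem (S.algebraOf_mono hFG h4) h5, ?_⟩
        convert! h7
      | add y z _ _ hy hz =>
        obtain ⟨hy1, hy2⟩ := hy
        obtain ⟨hz1, hz2⟩ := hz
        exact ⟨add_mem hy1 hz1, add_mem hy2 hz2⟩
    exact key.2

theorem exists_unit {G : AddSubgroup W} {a : W} (ha : a ∈ G) (haE : a ∈ S.Ev) :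
    ∃ x : (S.algebraOf G)ˣ, ((x : S.algebraOf G) : D) ∈ S.space a := by
  obtain ⟨u, hu, hu0⟩ := haE
  exact ⟨⟨⟨u, mem_space_of_mem ha hu⟩, ⟨u⁻¹, mem_space_of_mem (neg_mem ha) (S.inv_mem hu)⟩,
    Subtype.ext (mul_inv_cancel₀ hu0), Subtype.ext (inv_mul_cancel₀ hu0)⟩, hu⟩

/-- Start from the division ring `D₀` and adjoin, for each generator of `F`, a nonzero eigenvector.
It is a unit and normalizes the algebra already built. -/
theorem isTwoSidedNoetherian_algebraOf {F : AddSubgroup W} (hF : F ≤ S.Ev) (hfg : F.FG) :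
    IsTwoSidedNoetherian (S.algebraOf F) := by
  classical
  obtain ⟨s, rfl⟩ := hfg
  induction s using Finset.induction_on with
  | empty =>
    rw [Finset.coe_empty, AddSubgroup.closure_empty]
    have hdiv := isDivisionSubalgebra_bot (S := S)
    let F₀ : Subfield D := hdiv.toSubfield
    have h1 : IsNoetherianRing F₀ := inferInstance
    have h2 : IsNoetherianRing F₀ᵐᵒᵖ := inferInstance
    exact ⟨h1, h2⟩
  | insert a s _ ih =>
    have hle : AddSubgroup.closure (s : Set W) ≤ AddSubgroup.closure (insert a s : Finset W) :=
      AddSubgroup.closure_mono (by simp)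
    have ha : a ∈ AddSubgroup.closure ((insert a s : Finset W) : Set W) :=
      AddSubgroup.subset_closure (by simp)
    obtain ⟨x, hx⟩ := exists_unit ha (hF ha)
    have hG : AddSubgroup.closure ((insert a s : Finset W) : Set W) =
        AddSubgroup.closure (s : Set W) ⊔ AddSubgroup.zmultiples a := by
      rw [Finset.coe_insert, Set.insert_eq, AddSubgroup.closure_union,
        ← AddSubgroup.zmultiples_eq_closure, sup_comm]
    exact (isLaurentGenerated hG hle hx).isTwoSidedNoetherian (ih (hle.trans hF))

end WeightSystem

/-! ### Finite-dimensional extensions of division subalgebras -/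

section FiniteDimension

variable {K : Type v} [Field K] {D : Type w} [DivisionRing D] [Algebra K D]

/-- Right multiplication by a nonzero `x` is an injective left `C`-linear endomorphism of the
finite-dimensional space `B`, hence it hits `1`. -/
theorem HasLeftDimension.isDivisionSubalgebra {C B : Subalgebra K D} {n : ℕ}
    (h : HasLeftDimension C B n) (hC : IsDivisionSubalgebra C) : IsDivisionSubalgebra B := by
  intro x hx
  rcases eq_or_ne x 0 with rfl | hx0
  · rwa [inv_zero]
  obtain ⟨hCB, b, hb⟩ := h
  let F : Subfield D := hC.toSubfield
  let V : Submodule F D := Submodule.span F (Set.range fun i => (b i : D))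
  have hV : ∀ y, y ∈ V ↔ y ∈ B := by
    intro y
    constructor
    · intro hy
      induction hy using Submodule.span_induction with
      | mem y hy =>
        obtain ⟨i, rfl⟩ := hy
        exact (b i).2
      | zero => exact zero_mem _
      | add y z _ _ hy hz => exact add_mem hy hz
      | smul c y _ hy => exact mul_mem (hCB c.2) hy
    · intro hy
      obtain ⟨c, hc, -⟩ := hb ⟨y, hy⟩
      change y = _ at hc
      rw [hc]
      exact sum_mem fun i _ => Submodule.smul_mem V (⟨c i, (c i).2⟩ : F)
        (Submodule.subset_span ⟨i, rfl⟩)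
  have : FiniteDimensional F V := FiniteDimensional.span_of_finite F (Set.finite_range _)
  let m : V →ₗ[F] V :=
    { toFun := fun y => ⟨y * x, (hV _).2 (mul_mem ((hV _).1 y.2) hx)⟩
      map_add' := fun y z => Subtype.ext (add_mul _ _ _)
      map_smul' := fun c y => Subtype.ext (mul_assoc (c : D) y x) }
  have hinj : Function.Injective m := fun y z h =>
    Subtype.ext (mul_right_cancel₀ hx0 (congrArg Subtype.val h))
  obtain ⟨y, hy⟩ := LinearMap.injective_iff_surjective.1 hinj ⟨1, (hV _).2 (one_mem _)⟩
  have hy : (y : D) * x = 1 := congrArg Subtype.val hy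
  rw [inv_eq_of_mul_eq_one_left hy]
  exact (hV _).1 y.2

end FiniteDimension

/-! ### Finitely generated abelian groups -/

section FinitelyGenerated

/-- The quotient by torsion is free, so the quotient map splits; tensoring with ℚ forgets the
torsion, which identifies the free rank. -/
theorem nonempty_addEquiv_torsion_prod (G : Type u) [AddCommGroup G] [Module.Finite ℤ G] :
    Nonempty (G ≃+ Submodule.torsion ℤ G × (Fin (Module.finrank ℚ (ℚ ⊗[ℤ] G)) → ℤ)) := by
  obtain ⟨n, b⟩ := Module.basisOfFiniteTypeTorsionFree' (R := ℤ) (M := G ⧸ Submodule.torsion ℤ G)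
  obtain ⟨f, hf⟩ := Module.projective_lifting_property _ LinearMap.id
    (Submodule.torsion ℤ G).mkQ_surjective
  have hn : Module.finrank ℚ (ℚ ⊗[ℤ] G) = n := by
    have h1 := IsLocalizedModule.finrank_eq (nonZeroDivisors ℤ) (TensorProduct.mk ℤ ℚ G 1) le_rfl
    rw [← finrank_quotient_eq_of_le_torsion (le_refl (Submodule.torsion ℤ G)),
      Module.finrank_eq_card_basis b,
      Fintype.card_fin] at h1
    rw [IsLocalization.finrank_eq (R := ℤ) ℚ (nonZeroDivisors ℤ) le_rfl, ← h1]
    congr!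
  rw [hn]
  refine ⟨((lequivProdOfRightSplitExact (Submodule.torsion ℤ G).injective_subtype ?_ hf).symm.trans
    ((LinearEquiv.refl ℤ _).prodCongr b.equivFun)).toAddEquiv⟩
  rw [Submodule.range_subtype, Submodule.ker_mkQ]

end FinitelyGenerated

namespace WeightSystem

variable {K : Type v} [Field K] {D : Type w} [DivisionRing D] [Algebra K D] {t : ℕ} {W : Type v}
  [AddCommGroup W] {S : WeightSystem K D t W}

/-! ### Quotient division algebras of eigenalgebras -/

theorem op_mem_algebraOf {F : AddSubgroup W} (i : Fin t) {x : D} (hx : x ∈ S.algebraOf F) :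
    S.op i x ∈ S.algebraOf F := by
  induction hx using algebraOf_induction with
  | mem a ha x hx =>
    rw [mem_commonEigenspace.1 hx i]
    exact Subalgebra.smul_mem _ (mem_space_of_mem ha hx) _
  | add x y _ _ hx hy =>
    rw [map_add]
    exact add_mem hx hy

/-- Compare components in `a v = b`. If `a` has nonzero component `y` at `m`, then `b` has component
`y v ≠ 0` at `m + l`. So `m + l ∈ F`, hence `l ∈ F`, and `v = y⁻¹ (y v)`. -/
theorem exists_fraction_of_mem_space (hval : Function.Injective S.val) {F : AddSubgroup W}
    {a b : D} (ha : a ∈ S.algebraOf F) (hb : b ∈ S.algebraOf F) (ha0 : a ≠ 0) {l : W} {v : D}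
    (hv : v ∈ S.space l) (hv0 : v ≠ 0) (h : v = a⁻¹ * b) :
    l ∈ F ∧ ∃ m ∈ F, ∃ y ∈ S.space m, ∃ z ∈ S.space (l + m), y ≠ 0 ∧ v = y⁻¹ * z := by
  obtain ⟨f, hf, hfF⟩ := exists_isDecomposition ha
  obtain ⟨g, hg, hgF⟩ := exists_isDecomposition hb
  obtain ⟨g', hg', hfg⟩ := hf.mul_right hv
  have hab : a * v = b := by rw [h, mul_inv_cancel_left₀ ha0]
  rw [hab] at hg'
  obtain rfl := hg'.unique hval hg
  obtain ⟨m, hm⟩ : ∃ m, f m ≠ 0 := by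
    by_contra! h0
    refine ha0 ?_
    rw [← hf.sum_eq]
    exact Finset.sum_eq_zero fun m _ => h0 m
  have hml := hgF (m + l) (by rw [hfg]; exact mul_ne_zero hm hv0)
  refine ⟨(AddSubgroup.add_mem_cancel_left F (hfF m hm)).1 hml, m, hfF m hm, f m, hf.mem m,
    f m * v, ?_, hm, ?_⟩
  · rw [add_comm]
    exact S.mul_mem (hf.mem m) hv
  · rw [inv_mul_cancel_left₀ hm]

theorem _root_.IsQuotientDivisionSubalgebra.mono {B B' Q Q' : Subalgebra K D}
    (hQ : IsQuotientDivisionSubalgebra B Q) (hQ' : IsQuotientDivisionSubalgebra B' Q')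
    (h : B ≤ B') : Q ≤ Q' := by
  intro q hq
  obtain ⟨a, ha, b, hb, -, rfl⟩ := hQ.left_fraction q hq
  exact MulMemClass.mul_mem (hQ'.isDivision _ (hQ'.le (h ha))) (hQ'.le (h hb))

theorem exists_quotientDivisionSubalgebra_algebraOf {F : AddSubgroup W} (hF : F ≤ S.Ev)
    (hfg : F.FG) : ∃ Q, IsQuotientDivisionSubalgebra (S.algebraOf F) Q := by
  have h := isTwoSidedNoetherian_algebraOf hF hfg
  have := h.1
  have := h.2
  exact exists_isQuotientDivisionSubalgebra _

/-- Choose `F` finitely generated with maximal quotient division algebra `Q`. Adjoining any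
eigenvalue `l` to `F` leaves `Q` unchanged, so `Q` contains an eigenvector for `l`, and then `l ∈
F`. -/
theorem Ev_fg [IsNoetherianRing (D ⊗[K] Dᵐᵒᵖ)] (hval : Function.Injective S.val) : S.Ev.FG := by
  classical
  have := wellFoundedGT_divisionSubalgebra (K := K) (D := D)
  obtain ⟨Q, ⟨F, hF, hfg, hQ⟩, hmax⟩ := wellFounded_gt.has_min
    {Q : {E : Subalgebra K D // IsDivisionSubalgebra E} |
      ∃ F ≤ S.Ev, F.FG ∧ IsQuotientDivisionSubalgebra (S.algebraOf F) Q.1} (by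
    have h0 : (⊥ : AddSubgroup W).FG := ⟨∅, by simp⟩
    obtain ⟨Q, hQ⟩ := exists_quotientDivisionSubalgebra_algebraOf (S := S) bot_le h0
    exact ⟨⟨Q, hQ.isDivision⟩, ⊥, bot_le, h0, hQ⟩)
  have hle : S.Ev ≤ F := by
    intro l hl
    have hF' : F ⊔ AddSubgroup.zmultiples l ≤ S.Ev :=
      sup_le hF (by rwa [AddSubgroup.zmultiples_le])
    have hfg' : (F ⊔ AddSubgroup.zmultiples l).FG := by
      obtain ⟨s, rfl⟩ := hfg
      refine ⟨s ∪ {l}, ?_⟩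
      rw [Finset.coe_union, AddSubgroup.closure_union, Finset.coe_singleton,
        AddSubgroup.zmultiples_eq_closure]
    obtain ⟨Q', hQ'⟩ := exists_quotientDivisionSubalgebra_algebraOf hF' hfg'
    have hQQ' : Q ≤ ⟨Q', hQ'.isDivision⟩ := hQ.mono hQ' (S.algebraOf_mono le_sup_left)
    have heq := hQQ'.eq_or_lt.resolve_right (hmax ⟨Q', hQ'.isDivision⟩ ⟨_, hF', hfg', hQ'⟩)
    obtain ⟨u, hu, hu0⟩ := hl
    have huQ : u ∈ Q.1 := by
      rw [heq]
      exact hQ'.le (mem_space_of_mem (AddSubgroup.mem_sup_right (AddSubgroup.mem_zmultiples l)) hu)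
    obtain ⟨a, ha, b, hb, ha0, hab⟩ := hQ.left_fraction u huQ
    exact (exists_fraction_of_mem_space hval ha hb ha0 hu hu0 hab).1
  rwa [le_antisymm hle hF]

theorem fg_of_le_Ev (hE : S.Ev.FG) {F : AddSubgroup W} (hF : F ≤ S.Ev) : F.FG := by
  have hE' : S.Ev.toIntSubmodule.FG := by
    rw [Submodule.fg_iff_addSubgroup_fg]
    simpa using hE
  have : IsNoetherian ℤ S.Ev.toIntSubmodule := isNoetherian_of_fg_of_noetherian _ hE'
  have h := Submodule.FG.of_le hE' (show F.toIntSubmodule ≤ S.Ev.toIntSubmodule from hF)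
  rw [Submodule.fg_iff_addSubgroup_fg] at h
  simpa using h

/-- The hypothesis `hquot`, that stability of a subalgebra passes to its quotient division algebra,
is not a consequence of the weight axioms; it is checked separately for derivations and for
automorphisms. -/
theorem subgroupStructure (hval : Function.Injective S.val) (hE : S.Ev.FG)
    (hquot : ∀ B Q : Subalgebra K D, IsQuotientDivisionSubalgebra B Q →
      (∀ i, ∀ b ∈ B, S.op i b ∈ B) → ∀ i, ∀ q ∈ Q, S.op i q ∈ Q) : S.SubgroupStructure := by
  intro F hF
  have hfg := fg_of_le_Ev hE hF
  obtain ⟨Q, hQ⟩ := exists_quotientDivisionSubalgebra_algebraOf hF hfg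
  have key : ∀ a : W, ∀ q ∈ Q, q ∈ S.space a → q ≠ 0 →
      a ∈ F ∧ ∃ b ∈ F, ∃ y ∈ S.space b, ∃ z ∈ S.space (a + b), y ≠ 0 ∧ q = y⁻¹ * z := by
    intro l q hq hql hq0
    obtain ⟨a, ha, b, hb, ha0, hab⟩ := hQ.left_fraction q hq
    exact exists_fraction_of_mem_space hval ha hb ha0 hql hq0 hab
  refine ⟨isTwoSidedNoetherian_algebraOf hF hfg, inferInstance, Q, hQ,
    hquot _ _ hQ fun i b hb => op_mem_algebraOf i hb, fun a => ⟨?_, fun ha => ?_⟩, key⟩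
  · rintro ⟨q, hq, hqa, hq0⟩
    exact (key a q hq hqa hq0).1
  · obtain ⟨u, hu, hu0⟩ := hF ha
    exact ⟨u, hQ.le (mem_space_of_mem ha hu), hu, hu0⟩

/-! ### The group of eigenvalues -/

theorem mem_torsion_Ev_iff (x : S.Ev) :
    x ∈ Submodule.torsion ℤ S.Ev ↔ (x : W) ∈ S.Tor := by
  rw [← Submodule.mem_toAddSubgroup, Submodule.torsion_int]
  change IsOfFinAddOrder x ↔ (x : W) ∈ S.Ev ∧ IsOfFinAddOrder (x : W)
  rw [AddSubmonoid.isOfFinAddOrder_coe, and_iff_right x.2]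

variable (S) in
/-- The torsion submodule of `Ev(Δ)` is the torsion subgroup of `Ev(Δ)`. -/
def torsionEquiv : Submodule.torsion ℤ S.Ev ≃+ S.Tor where
  toFun x := ⟨x.1.1, (mem_torsion_Ev_iff _).1 x.2⟩
  invFun x := ⟨⟨x, x.2.1⟩, (mem_torsion_Ev_iff _).2 x.2⟩
  left_inv _ := rfl
  right_inv _ := rfl
  map_add' _ _ := rfl

theorem eigenvaluesFinGen (hE : S.Ev.FG) : S.EigenvaluesFinGen := by
  have hfin : Module.Finite ℤ S.Ev :=
    Module.Finite.iff_addGroup_fg.2 ((AddGroup.fg_iff_addSubgroup_fg _).2 hE)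
  have hfin' : Finite (Submodule.torsion ℤ S.Ev) :=
    Module.finite_of_fg_torsion _ (Submodule.torsion_isTorsion)
  obtain ⟨e⟩ := nonempty_addEquiv_torsion_prod S.Ev
  exact ⟨hE, Finite.of_equiv _ S.torsionEquiv.toEquiv,
    ⟨e.trans (S.torsionEquiv.prodCongr (AddEquiv.refl _))⟩⟩

/-! ### The torsion part of the eigenalgebra -/

theorem existsUnique_eigenvectors (hval : Function.Injective S.val) {T : AddSubgroup W}
    {ι : Type*} [Fintype ι] (e : ι ≃ T) {x : D} (hx : x ∈ S.algebraOf T) :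
    ∃! h : ι → D, (∀ i, h i ∈ S.space (e i)) ∧ x = ∑ i, h i := by
  classical
  have hinj : Function.Injective fun i => (e i : W) := Subtype.val_injective.comp e.injective
  obtain ⟨f, hf, hfT⟩ := exists_isDecomposition hx
  have hsum : x = ∑ i, f (e i) := by
    rw [← hf.sum_eq]
    refine Eq.trans ?_ (Finset.sum_map Finset.univ ⟨_, hinj⟩ f)
    refine Finset.sum_subset (fun a ha => ?_) fun a _ ha => Finsupp.notMem_support_iff.1 ha
    have haT := hfT a (Finsupp.mem_support_iff.1 ha)
    exact Finset.mem_map.2 ⟨e.symm ⟨a, haT⟩, Finset.mem_univ _, by simp⟩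
  refine ⟨fun i => f (e i), ⟨fun i => hf.mem _, hsum⟩, ?_⟩
  rintro h ⟨hh, hhx⟩
  funext i
  refine sub_eq_zero.1 (eq_zero_of_sum_eq_zero hval (s := Finset.univ) hinj.injOn
    (f := fun i => h i - f (e i)) (fun i _ => sub_mem (hh i) (hf.mem _)) ?_ i (Finset.mem_univ i))
  rw [Finset.sum_sub_distrib, ← hhx, ← hsum, sub_self]

/-- One nonzero eigenvector `u i` per eigenvalue forms a basis: each eigenspace is `D₀ (u i)`, since
`h (u i)⁻¹` has eigenvalue zero for every `h` in it. -/
theorem hasLeftDimension_algebraOf (hval : Function.Injective S.val) {T : AddSubgroup W}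
    (hT : T ≤ S.Ev) [Finite T] :
    HasLeftDimension (S.algebraOf ⊥) (S.algebraOf T) (Nat.card T) := by
  let e := (Finite.equivFin T).symm
  choose u hu hu0 using fun i => hT (e i).2
  refine ⟨S.algebraOf_mono bot_le, fun i => ⟨u i, mem_space_of_mem (e i).2 (hu i)⟩, fun x => ?_⟩
  obtain ⟨h, ⟨hh, hx⟩, huniq⟩ := existsUnique_eigenvectors hval e x.2
  refine ⟨fun i => ⟨h i * (u i)⁻¹, ?_⟩, ?_, fun c hc => ?_⟩
  · rw [mem_algebraOf_bot]
    have := S.mul_mem (hh i) (S.inv_mem (hu i))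
    rwa [add_neg_cancel] at this
  · simpa only [inv_mul_cancel_right₀ (hu0 _)] using hx
  · have hc' := huniq (fun i => c i * u i) ⟨fun i => ?_, hc⟩
    · funext i
      exact Subtype.ext ((eq_mul_inv_iff_mul_eq₀ (hu0 i)).2 (congrFun hc' i))
    · have := S.mul_mem (mem_algebraOf_bot.1 (c i).2) (hu i)
      rwa [zero_add] at this

theorem hasRightDimension_algebraOf (hval : Function.Injective S.val) {T : AddSubgroup W}
    (hT : T ≤ S.Ev) [Finite T] :
    HasRightDimension (S.algebraOf ⊥) (S.algebraOf T) (Nat.card T) := by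
  let e := (Finite.equivFin T).symm
  choose u hu hu0 using fun i => hT (e i).2
  refine ⟨S.algebraOf_mono bot_le, fun i => ⟨u i, mem_space_of_mem (e i).2 (hu i)⟩, fun x => ?_⟩
  obtain ⟨h, ⟨hh, hx⟩, huniq⟩ := existsUnique_eigenvectors hval e x.2
  refine ⟨fun i => ⟨(u i)⁻¹ * h i, ?_⟩, ?_, fun c hc => ?_⟩
  · rw [mem_algebraOf_bot]
    have := S.mul_mem (S.inv_mem (hu i)) (hh i)
    rwa [neg_add_cancel] at this
  · simpa only [mul_inv_cancel_left₀ (hu0 _)] using hx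
  · have hc' := huniq (fun i => u i * c i) ⟨fun i => ?_, hc⟩
    · funext i
      exact Subtype.ext ((eq_inv_mul_iff_mul_eq₀ (hu0 i)).2 (congrFun hc' i))
    · have := S.mul_mem (hu i) (mem_algebraOf_bot.1 (c i).2)
      rwa [add_zero] at this

end WeightSystem

namespace WeightSystem

variable {K : Type v} [Field K] {D : Type w} [DivisionRing D] [Algebra K D] {t : ℕ} {W : Type v}
  [AddCommGroup W] {S : WeightSystem K D t W}

/-! ### Skew Laurent extensions of eigenalgebras -/

/-- Conjugation by an eigenvector, as an automorphism of an eigenalgebra. -/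
def conjAlgEquiv (F : AddSubgroup W) {a : W} {u : D} (hu : u ∈ S.space a) (hu0 : u ≠ 0) :
    S.algebraOf F ≃ₐ[K] S.algebraOf F where
  toFun y := ⟨u * y * u⁻¹, conj_mem_algebraOf hu y.2⟩
  invFun y := ⟨u⁻¹ * y * u, conj_mem_algebraOf' hu y.2⟩
  left_inv y := Subtype.ext <| by
    change u⁻¹ * (u * y * u⁻¹) * u = y
    rw [mul_assoc u, inv_mul_cancel_left₀ hu0, inv_mul_cancel_right₀ hu0]
  right_inv y := Subtype.ext <| by
    change u * (u⁻¹ * y * u) * u⁻¹ = y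
    rw [mul_assoc u⁻¹, mul_inv_cancel_left₀ hu0, mul_inv_cancel_right₀ hu0]
  map_mul' y z := Subtype.ext <| by
    change u * (y * z) * u⁻¹ = u * y * u⁻¹ * (u * z * u⁻¹)
    rw [mul_assoc (u * (y : D)), ← mul_assoc u⁻¹, ← mul_assoc u⁻¹, inv_mul_cancel₀ hu0, one_mul]
    simp only [mul_assoc]
  map_add' y z := Subtype.ext <| by
    change u * (y + z) * u⁻¹ = u * y * u⁻¹ + u * z * u⁻¹
    rw [mul_add, add_mul]
  commutes' c := Subtype.ext <| by
    change u * algebraMap K D c * u⁻¹ = algebraMap K D c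
    rw [← Algebra.commutes, mul_assoc, mul_inv_cancel₀ hu0, mul_one]

theorem coe_zpow_unit {B : Subalgebra K D} (x : Bˣ) (n : ℤ) :
    (((x ^ n : Bˣ) : B) : D) = ((x : B) : D) ^ n := by
  have h := congrArg Units.val (map_zpow (Units.map (B.val : B →* D)) x n)
  rw [Units.val_zpow_eq_zpow_val] at h
  exact h

/-- Freeness over the powers of `x` is independence of eigenvectors: as no nonzero multiple of `a`
lies in `F`, the eigenvalues `b + m a` with `b ∈ F` are pairwise distinct. The automorphism is
conjugation by `x`. -/
theorem isSkewLaurentExtension_inclusion (hval : Function.Injective S.val) {F G : AddSubgroup W}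
    {a : W} (hG : G = F ⊔ AddSubgroup.zmultiples a) (hFG : F ≤ G)
    (hind : ∀ m : ℤ, m • a ∈ F → m = 0) {x : (S.algebraOf G)ˣ}
    (hx : ((x : S.algebraOf G) : D) ∈ S.space a) (hx0 : ((x : S.algebraOf G) : D) ≠ 0) :
    IsSkewLaurentExtension (Subalgebra.inclusion (S.algebraOf_mono hFG)) (conjAlgEquiv F hx hx0)
      x := by
  classical
  set u : D := ((x : S.algebraOf G) : D) with hu
  refine ⟨fun y => Subtype.ext ?_, ?_⟩
  · change u * y = u * y * u⁻¹ * u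
    rw [inv_mul_cancel_right₀ hx0]
  let Φ : (ℤ →₀ S.algebraOf F) →+ D := Finsupp.liftAddHom fun n =>
    (AddMonoidHom.mulRight (u ^ n)).comp (S.algebraOf F).val.toAddMonoidHom
  have hΦ : ∀ f : ℤ →₀ S.algebraOf F, ((f.sum fun n y =>
      Subalgebra.inclusion (S.algebraOf_mono hFG) y * ((x ^ n : (S.algebraOf G)ˣ) : S.algebraOf G) :
        S.algebraOf G) : D) = Φ f := by
    intro f
    rw [Finsupp.sum, AddSubmonoidClass.coe_finsetSum]
    refine Finset.sum_congr rfl fun n _ => ?_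
    change _ * (((x ^ n : (S.algebraOf G)ˣ) : S.algebraOf G) : D) = _
    rw [coe_zpow_unit]
    rfl
  have hinj : Function.Injective Φ := by
    rw [injective_iff_map_eq_zero]
    intro f hf
    choose d hd hdF using fun n => exists_isDecomposition (f n).2
    have h0 : ∑ p ∈ f.support.sigma fun n => (d n).support, d p.1 p.2 * u ^ p.1 = 0 := by
      rw [Finset.sum_sigma, ← hf]
      refine Finset.sum_congr rfl fun n _ => ?_
      refine (Finset.sum_mul (d n).support (d n) (u ^ n)).symm.trans ?_
      rw [(hd n).sum_eq]
      rfl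
    have h1 := eq_zero_of_sum_eq_zero hval (g := fun p : Σ _ : ℤ, W => p.2 + p.1 • a) ?_
      (fun p _ => S.mul_mem ((hd p.1).mem p.2) (zpow_mem_space hx p.1)) h0
    · ext n
      by_contra hn
      have h2 : ∀ b, d n b = 0 := by
        intro b
        by_contra hb
        have := h1 ⟨n, b⟩ (Finset.mem_sigma.2 ⟨Finsupp.mem_support_iff.2 fun h => hn (by simp [h]),
          Finsupp.mem_support_iff.2 hb⟩)
        exact mul_ne_zero hb (zpow_ne_zero n hx0) this
      refine hn ?_
      rw [← (hd n).sum_eq]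
      exact Finset.sum_eq_zero fun b _ => h2 b
    · rintro ⟨m, b⟩ hb ⟨n, c⟩ hc h
      have hb' := hdF _ b (Finsupp.mem_support_iff.1 (Finset.mem_sigma.1 hb).2)
      have hc' := hdF _ c (Finsupp.mem_support_iff.1 (Finset.mem_sigma.1 hc).2)
      have h : b + m • a = c + n • a := h
      have hmn : m = n := by
        refine sub_eq_zero.1 (hind _ ?_)
        have e : (m - n) • a = c - b := by
          rw [sub_smul, sub_eq_sub_iff_add_eq_add, add_comm, h]
        rw [e]
        exact sub_mem hc' hb'
      subst hmn
      rw [add_right_cancel h]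
  have hsurj : ∀ y ∈ S.algebraOf G, ∃ f, Φ f = y := by
    intro y hy
    induction hy using algebraOf_induction with
    | mem b hb y hy =>
      rw [hG, AddSubgroup.mem_sup] at hb
      obtain ⟨c, hc, _, ⟨n, rfl⟩, rfl⟩ := hb
      have h4 : y * u ^ (-n) ∈ S.algebraOf F := by
        have h5 := S.mul_mem hy (zpow_mem_space hx (-n))
        have e : c + (fun x => x • a) n + -n • a = c := by simp
        rw [e] at h5
        exact mem_space_of_mem hc h5
      refine ⟨Finsupp.single n ⟨_, h4⟩, ?_⟩
      rw [Finsupp.liftAddHom_apply_single]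
      change y * u ^ (-n) * u ^ n = y
      rw [mul_assoc, ← zpow_add₀ hx0]
      simp
    | add y z _ _ hy hz =>
      obtain ⟨f, rfl⟩ := hy
      obtain ⟨g, rfl⟩ := hz
      exact ⟨f + g, map_add _ _ _⟩
  constructor
  · intro f g hfg
    refine hinj ?_
    rw [← hΦ, ← hΦ]
    exact congrArg Subtype.val hfg
  · intro y
    obtain ⟨f, hf⟩ := hsurj y y.2
    exact ⟨f, Subtype.ext ((hΦ f).trans hf)⟩

/-- The subgroup generated by `T` and a finite family. -/
def adjoinFamily (T : AddSubgroup W) {r : ℕ} (e : Fin r → W) : AddSubgroup W :=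
  T ⊔ (Submodule.span ℤ (Set.range e)).toAddSubgroup

theorem mem_adjoinFamily {T : AddSubgroup W} {r : ℕ} {e : Fin r → W} {a : W} :
    a ∈ adjoinFamily T e ↔ ∃ n : Fin r → ℤ, a - ∑ i, n i • e i ∈ T := by
  rw [adjoinFamily, AddSubgroup.mem_sup]
  simp only [Submodule.mem_toAddSubgroup, Submodule.mem_span_range_iff_exists_fun]
  constructor
  · rintro ⟨y, hy, _, ⟨n, rfl⟩, rfl⟩
    exact ⟨n, by simpa using hy⟩
  · rintro ⟨n, hn⟩
    exact ⟨_, hn, _, ⟨n, rfl⟩, by simp⟩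

theorem adjoinFamily_succ (T : AddSubgroup W) {r : ℕ} (e : Fin (r + 1) → W) :
    adjoinFamily T e =
      adjoinFamily T (fun i => e (Fin.castSucc i)) ⊔ AddSubgroup.zmultiples (e (Fin.last r)) := by
  ext a
  rw [AddSubgroup.mem_sup]
  constructor
  · intro ha
    obtain ⟨n, hn⟩ := mem_adjoinFamily.1 ha
    rw [Fin.sum_univ_castSucc, ← sub_sub, sub_right_comm] at hn
    exact ⟨_, mem_adjoinFamily.2 ⟨_, hn⟩, _, ⟨n (Fin.last r), rfl⟩, sub_add_cancel _ _⟩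
  · rintro ⟨y, hy, _, ⟨m, rfl⟩, rfl⟩
    obtain ⟨n, hn⟩ := mem_adjoinFamily.1 hy
    refine mem_adjoinFamily.2 ⟨Fin.snoc n m, ?_⟩
    rw [Fin.sum_univ_castSucc]
    simpa using hn

theorem isIteratedSkewLaurentExtension_adjoinFamily (hval : Function.Injective S.val)
    (T : AddSubgroup W) {r : ℕ} (e : Fin r → W) (he : ∀ i, e i ∈ S.Ev)
    (hind : ∀ n : Fin r → ℤ, ∑ i, n i • e i ∈ T → n = 0) (hT : T ≤ adjoinFamily T e) :
    IsIteratedSkewLaurentExtension r (Subalgebra.inclusion (S.algebraOf_mono hT)) := by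
  induction r with
  | zero =>
    have h : adjoinFamily T e = T := by
      ext a
      rw [mem_adjoinFamily]
      simp
    refine ⟨Subalgebra.inclusion_injective _, fun y => ⟨⟨y, ?_⟩, rfl⟩⟩
    exact S.algebraOf_mono h.le y.2
  | succ r ih =>
    have hG := adjoinFamily_succ T e
    have hle : adjoinFamily T (fun i => e (Fin.castSucc i)) ≤ adjoinFamily T e := by
      rw [hG]
      exact le_sup_left
    obtain ⟨x, hx⟩ := exists_unit (S := S) (G := adjoinFamily T e) (a := e (Fin.last r))
      (by rw [hG]; exact AddSubgroup.mem_sup_right (AddSubgroup.mem_zmultiples _)) (he _)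
    have hx0 : ((x : S.algebraOf (adjoinFamily T e)) : D) ≠ 0 := fun h =>
      x.ne_zero (Subtype.ext h)
    refine ⟨S.algebraOf (adjoinFamily T fun i => e (Fin.castSucc i)), inferInstance, inferInstance,
      Subalgebra.inclusion (S.algebraOf_mono le_sup_left),
      Subalgebra.inclusion (S.algebraOf_mono hle), _, x, ih _ (fun i => he _) (fun n hn => ?_) le_sup_left,
      isSkewLaurentExtension_inclusion hval hG hle (fun m hm => ?_) hx hx0, rfl⟩
    -- A relation among the first `r` elements is a relation among all of them with last coefficient
    -- zero.
    · have := hind (Fin.snoc n 0) (by rw [Fin.sum_univ_castSucc]; simpa using hn)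
      funext i
      simpa using congrFun this (Fin.castSucc i)
    -- If `m` times the last element is congruent to `∑ nᵢ eᵢ` modulo `T`, then `(-n, m)` is a
    -- relation, so `m = 0`.
    · obtain ⟨n, hn⟩ := mem_adjoinFamily.1 hm
      have := hind (Fin.snoc (-n) m) (by
        rw [Fin.sum_univ_castSucc]
        simpa [sub_eq_neg_add] using hn)
      simpa using congrFun this (Fin.last r)

/-- The `eᵢ` are the preimages of the standard basis under the splitting of `Ev(Δ)`. A relation
modulo torsion gives an element of finite order in ℤʳ, hence zero. -/
theorem exists_basis_mod_torsion (h : S.EigenvaluesFinGen) : ∃ e : Fin S.rank → W,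
    (∀ i, e i ∈ S.Ev) ∧ (∀ n : Fin S.rank → ℤ, ∑ i, n i • e i ∈ S.Tor → n = 0) ∧
      S.Ev = adjoinFamily S.Tor e := by
  obtain ⟨-, hfin, ⟨ψ⟩⟩ := h
  let e : Fin S.rank → S.Ev := fun i => ψ.symm (0, Pi.single i 1)
  have hsum : ∀ n : Fin S.rank → ℤ, ∑ i, n i • e i = ψ.symm (0, n) := by
    intro n
    apply ψ.injective
    simp only [map_sum, map_zsmul, e, AddEquiv.apply_symm_apply]
    refine Prod.ext (by simp [Prod.fst_sum]) ?_
    rw [Prod.snd_sum]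
    funext j
    simp [Finset.sum_apply, Pi.single_apply]
  have hcoe : ∀ n : Fin S.rank → ℤ, ∑ i, n i • (e i : W) = (ψ.symm (0, n) : S.Ev) := by
    intro n
    rw [← hsum]
    simp
  refine ⟨fun i => e i, fun i => (e i).2, fun n hn => ?_, ?_⟩
  · rw [hcoe] at hn
    have h1 : IsOfFinAddOrder (ψ.symm (0, n)) := AddSubmonoid.isOfFinAddOrder_coe.1 hn.2
    have h2 := ψ.toAddMonoidHom.isOfFinAddOrder h1
    obtain ⟨k, hk, hkn⟩ := isOfFinAddOrder_iff_nsmul_eq_zero.1 h2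
    have h3 := congrArg Prod.snd hkn
    funext i
    have h4 := congrFun h3 i
    simpa [hk.ne'] using h4
  · refine le_antisymm (fun a ha => ?_) (sup_le inf_le_left ?_)
    · rw [mem_adjoinFamily]
      refine ⟨(ψ ⟨a, ha⟩).2, ?_⟩
      rw [hcoe]
      have h1 : (⟨a, ha⟩ : S.Ev) - ψ.symm (0, (ψ ⟨a, ha⟩).2) = ψ.symm ((ψ ⟨a, ha⟩).1, 0) := by
        apply ψ.injective
        ext <;> simp
      have h2 : a - ψ.symm (0, (ψ ⟨a, ha⟩).2) = ψ.symm ((ψ ⟨a, ha⟩).1, 0) :=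
        congrArg Subtype.val h1
      rw [h2]
      refine ⟨Subtype.prop _, AddSubmonoid.isOfFinAddOrder_coe.2 ?_⟩
      have h3 := (isOfFinAddOrder_of_finite (ψ ⟨a, ha⟩).1)
      exact ψ.symm.toAddMonoidHom.isOfFinAddOrder
        ((AddMonoidHom.inl S.Tor (Fin S.rank → ℤ)).isOfFinAddOrder h3)
    · have h : Submodule.span ℤ (Set.range fun i => (e i : W)) ≤ S.Ev.toIntSubmodule := by
        rw [Submodule.span_le]
        rintro _ ⟨i, rfl⟩
        exact (e i).2
      exact fun a ha => h ha

theorem eigenalgebraStructure (hval : Function.Injective S.val) (hE : S.Ev.FG) :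
    S.EigenalgebraStructure := by
  have h := eigenvaluesFinGen hE
  have := h.2.1
  have hTor : S.Tor ≤ S.Ev := inf_le_left
  have hleft := hasLeftDimension_algebraOf hval hTor
  refine ⟨iSupIndep_space hval Subtype.val_injective, isTwoSidedNoetherian_algebraOf le_rfl hE,
    inferInstance, isDivisionSubalgebra_bot, hleft.isDivisionSubalgebra isDivisionSubalgebra_bot,
    hleft, hasRightDimension_algebraOf hval hTor, ?_⟩
  obtain ⟨e, he, hind, hEe⟩ := exists_basis_mod_torsion h
  -- The group is generalized so that the equality of subgroups can be substituted inside the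
  -- dependent type of the inclusion.
  have key : ∀ G (hG : G = adjoinFamily S.Tor e) (hle : S.Tor ≤ G),
      IsIteratedSkewLaurentExtension S.rank (Subalgebra.inclusion (S.algebraOf_mono hle)) := by
    rintro G rfl hle
    exact isIteratedSkewLaurentExtension_adjoinFamily hval _ e he hind hle
  exact key _ hEe hTor

theorem eigenConclusions [IsNoetherianRing (D ⊗[K] Dᵐᵒᵖ)] (hval : Function.Injective S.val)
    (hquot : ∀ B Q : Subalgebra K D, IsQuotientDivisionSubalgebra B Q →
      (∀ i, ∀ b ∈ B, S.op i b ∈ B) → ∀ i, ∀ q ∈ Q, S.op i q ∈ Q) : S.EigenConclusions :=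
  have hE := Ev_fg hval
  ⟨eigenvaluesFinGen hE, eigenalgebraStructure hval hE, subgroupStructure hval hE hquot⟩

end WeightSystem

/-! ### The two cases: commuting derivations and commuting automorphisms -/

section Families

variable {K : Type v} [Field K] {D : Type w} [DivisionRing D] [Algebra K D] {t : ℕ}

theorem derivationWeights_eigenConclusions [IsNoetherianRing (D ⊗[K] Dᵐᵒᵖ)]
    (δ : CommutingDerivations K D t) : (derivationWeights δ).EigenConclusions := by
  refine WeightSystem.eigenConclusions (fun _ _ h => h) ?_
  intro B Q hQ hB i q hq
  obtain ⟨a, ha, b, hb, ha0, rfl⟩ := hQ.left_fraction q hq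
  change δ.toFun i (a⁻¹ * b) ∈ Q
  have h := δ.leibniz i a (a⁻¹ * b)
  rw [mul_inv_cancel_left₀ ha0] at h
  -- The quotient rule: differentiate `b = a q` and solve for the derivative of `q`.
  have e : δ.toFun i (a⁻¹ * b) = a⁻¹ * (δ.toFun i b - δ.toFun i a * (a⁻¹ * b)) := by
    rw [h, add_sub_cancel_left, inv_mul_cancel_left₀ ha0]
  rw [e]
  exact mul_mem (hQ.isDivision _ (hQ.le ha))
    (sub_mem (hQ.le (hB i b hb)) (mul_mem (hQ.le (hB i a ha)) hq))

theorem automorphismWeights_eigenConclusions [IsNoetherianRing (D ⊗[K] Dᵐᵒᵖ)]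
    (δ : CommutingAutomorphisms K D t) : (automorphismWeights δ).EigenConclusions := by
  refine WeightSystem.eigenConclusions (fun a b h => ?_) ?_
  · refine Additive.toMul.injective (funext fun i => Units.ext ?_)
    exact congrFun h i
  intro B Q hQ hB i q hq
  obtain ⟨a, ha, b, hb, ha0, rfl⟩ := hQ.left_fraction q hq
  change δ.toFun i (a⁻¹ * b) ∈ Q
  rw [map_mul, map_inv₀]
  exact mul_mem (hQ.isDivision _ (hQ.le (hB i a ha))) (hQ.le (hB i b hb))

end Families

theorem corollary3p2 {K : Type v} [Field K] [CharZero K] {A : Type u} [CommRing A] [IsDomain A]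
    [Algebra K A] [Algebra.Smooth K A] :
    -- the quotient division algebra of the ring of differential operators exists
    (∃ (D₀ : Type u) (_ : DivisionRing D₀) (_ : Algebra K D₀) (j : DiffOps K A →ₐ[K] D₀),
      IsQuotientDivisionAlgebra j) ∧
    -- and, for any (hence the unique) such quotient division algebra `D`,
    ∀ (D : Type w) [DivisionRing D] [Algebra K D] (j : DiffOps K A →ₐ[K] D),
      IsQuotientDivisionAlgebra j →
      -- `D ⊗ Dᵒ` is Noetherian, and it is a domain if `Spec A` is geometrically irreducible
      IsTwoSidedNoetherian (D ⊗[K] Dᵐᵒᵖ) ∧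
      (IsDomain (AlgebraicClosure K ⊗[K] A) → IsDomain (D ⊗[K] Dᵐᵒᵖ)) ∧
      -- ascending chain condition on division subalgebras
      (∀ E : ℕ → Subalgebra K D, (∀ n, IsDivisionSubalgebra (E n)) → Monotone E →
        ∃ n, ∀ m, n ≤ m → E m = E n) ∧
      -- division subalgebras are finitely generated
      (∀ E : Subalgebra K D, IsDivisionSubalgebra E → IsFinGenDivisionSubalgebra E) ∧
      -- commuting derivations
      (∀ (t : ℕ) (δ : CommutingDerivations K D t), (derivationWeights δ).EigenConclusions) ∧
      -- commuting automorphisms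
      (∀ (t : ℕ) (δ : CommutingAutomorphisms K D t),
        (automorphismWeights δ).EigenConclusions) := by
  have : Algebra.FiniteType K A := inferInstance
  obtain ⟨D₀, h₁, h₂, j₀, hj₀, -⟩ := exists_quotientDivisionAlgebra_diffOps (K := K) (A := A)
  refine ⟨⟨D₀, h₁, h₂, j₀, hj₀⟩, ?_⟩
  intro D _ _ j hj
  obtain ⟨hnoeth, hdom⟩ := hj.tensorProduct_op
  have := hnoeth.1
  exact ⟨hnoeth, hdom, division_subalgebras_stabilize, isFinGenDivisionSubalgebra,
    fun _ => derivationWeights_eigenConclusions, fun _ => automorphismWeights_eigenConclusions⟩
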